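/- **Setting.** Let $M$ be a smooth manifold of dimension $2n+1$ (Hausdorff, $\sigma$-compact, without boundary) with a contact form $\theta$ and Reeb field $E$ ($\theta(E)=1$, $\iota_E d\theta=0$). Suppose that $\theta$ is regular: the orbits of $E$ are all closed with the same period, i.e. the flow of $E$ is a free circle action. Let $\alpha>0$ and let $\langle\cdot,\cdot\rangle$ be an associated Riemannian metric on $M$, rescaled so that $E$ has length $\alpha$: $\alpha^2\theta(u)=\langle u,E\rangle$, and there is a $(1,1)$-tensor $\phi$ with $\phi^2u=-u+\theta(u)E$ and $d\theta(u,v)=\langle u,\phi v\rangle$. Let $\mu$ be its Riemannian volume. Let $\pi:M\to N$ be the Boothby–Wang quotient (a smooth surjective submersion whose fibres are the orbits of $E$), $\omega$ the symplectic form on $N$ with $\pi^*\omega=d\theta$, and let $N$ carry the Riemannian metric for which $\pi$ is a Riemannian submersion, with Laplacian $\Delta$. On $N$ put $\omega(X_f,\cdot)=-df$ and $\{f,g\}=X_f(g)$. For a function $f$ on $M$ let $S f$ be the vector field $u$ with $\theta(u)=f$ and $\iota_u d\theta=E(f)\theta-df$, and put $\{f,g\}=(Sf)(g)-gE(f)$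 (the contact bracket on $M$). Let $\mathfrak q$ be the Lie algebra of smooth vector fields $u$ on $M$ with $\mathcal L_u\theta=0$. Let $p,q$ be smooth functions on $M$ with $E(p)=E(q)=0$ whose contact bracket is $\{p,q\}=\psi\circ\pi$ for a function $\psi$ on $N$, and let $b(u,v)=-\int_M p\,[u,v](q)\,d\mu$. On the central extension $\mathfrak q\oplus\mathbb R$ put $\mathrm{ad}_{(u,a)}(v,b')=(-[u,v],\,b(u,v))$ and $\langle\langle (u,a),(v,b')\rangle\rangle=\int_M\langle u,v\rangle\,d\mu+ab'$. The Euler–Arnold equation $\dot U+\mathrm{ad}_U^*U=0$ for a curve $U$ in $\mathfrak q\oplus\mathbb R$ means that $-\dot U$ lies in $\mathfrak q\oplus\mathbb R$ and $\langle\langle -\dot U,V\rangle\rangle=\langle\langle U,\mathrm{ad}_UV\rangle\rangle$ for all $V=(v,b')\in\mathfrak q\oplus\mathbb R$ with $v$ compactly supported (for all $V$, if $M$ is compact). **Statement.** (1) A vector field $u$ on $M$ lies in $\mathfrak q$ if and only if $u=S(\bar f\circ\pi)$ for a unique smooth function $\bar f$ on $N$. (2) Let $J\subseteq\mathbb R$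 be an open interval, $\bar f:J\times N\to\mathbb R$ smooth and $c:J\to\mathbb R$ differentiable. The curve $U(t)=(S(\bar f(t)\circ\pi),c(t))$ satisfies the Euler–Arnold equation on $J$ if and only if $c$ is constant, $c\equiv-\beta$, and $$\varpi_t+\{\bar f,\varpi\}=0,\qquad \varpi=\Delta\bar f-\alpha^2\bar f-\beta\psi .$$ (3) Let $N=\mathbb R^2$ with the flat metric, $\omega=\sigma\,dx\wedge dy$ with $\sigma\in\{1,-1\}$ (so that $\{f,g\}=\sigma(f_xg_y-f_yg_x)$), and $\psi(x,y)=y$. Then $U$ satisfies the Euler–Arnold equation on $J$ if and only if $c$ is constant, $c\equiv-\beta$, and $$(-\alpha^2\bar f+\Delta\bar f)_t+\{\bar f,\Delta\bar f\}-\sigma\beta\,\partial_x\bar f=0 .$$ This is the $\beta$-plane quasigeostrophic equation: its coefficient of $\partial_x\bar f$ is $\beta$ for $\omega=dy\wedge dx$, and $-\beta=c$ for $\omega=dx\wedge dy$. -/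

import Mathlib

open scoped Manifold ContDiff
open Bundle MeasureTheory

noncomputable section

namespace QuantExt

/-! ### Differential forms, metric, volume and Laplacian on a `d`-dimensional manifold -/

section Manifold

variable {d : ℕ} {M : Type*} [TopologicalSpace M] [ChartedSpace (EuclideanSpace ℝ (Fin d)) M]

/-- A (not necessarily smooth) vector field. -/
abbrev VField (d : ℕ) (M : Type*) [TopologicalSpace M]
    [ChartedSpace (EuclideanSpace ℝ (Fin d)) M] : Type _ :=
  ∀ x : M, TangentSpace (𝓡 d) x

/-- A (not necessarily smooth) `1`-form. -/
abbrev OneForm (d : ℕ) (M : Type*) [TopologicalSpace M]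
    [ChartedSpace (EuclideanSpace ℝ (Fin d)) M] : Type _ :=
  ∀ x : M, TangentSpace (𝓡 d) x →L[ℝ] ℝ

/-- A (not necessarily smooth) field of bilinear forms. -/
abbrev TwoForm (d : ℕ) (M : Type*) [TopologicalSpace M]
    [ChartedSpace (EuclideanSpace ℝ (Fin d)) M] : Type _ :=
  ∀ x : M, TangentSpace (𝓡 d) x →L[ℝ] TangentSpace (𝓡 d) x →L[ℝ] ℝ

/-- Smooth Riemannian metrics. -/
abbrev RMetric (d : ℕ) (M : Type*) [TopologicalSpace M]
    [ChartedSpace (EuclideanSpace ℝ (Fin d)) M] [IsManifold (𝓡 d) ∞ M] : Type _ :=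
  ContMDiffRiemannianMetric (𝓡 d) ∞ (EuclideanSpace ℝ (Fin d))
    (fun x : M => TangentSpace (𝓡 d) x)

/-- Smoothness of a vector field, as a section of the tangent bundle. -/
def SmoothField [IsManifold (𝓡 d) ∞ M] (X : VField d M) : Prop :=
  ContMDiff (𝓡 d) (𝓡 d).tangent ∞ (fun x => (⟨x, X x⟩ : TangentBundle (𝓡 d) M))

/-- Smoothness of a `1`-form, as a section of the cotangent bundle. -/
def SmoothForm [IsManifold (𝓡 d) ∞ M] (θ : OneForm d M) : Prop :=
  ContMDiff (𝓡 d) ((𝓡 d).prod 𝓘(ℝ, EuclideanSpace ℝ (Fin d) →L[ℝ] ℝ)) ∞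
    (fun x => TotalSpace.mk' (EuclideanSpace ℝ (Fin d) →L[ℝ] ℝ)
      (E := fun x : M => TangentSpace (𝓡 d) x →L[ℝ] Trivial M ℝ x) x (θ x))

/-- The differential of a real function, as a `1`-form. -/
def dFun (f : M → ℝ) : OneForm d M := fun x => mfderiv (𝓡 d) 𝓘(ℝ, ℝ) f x

/-- The pullback `(φ⁻¹)^* θ` of a `1`-form to the model space, `φ` the preferred chart at `x₀`. -/
def formInChart (θ : OneForm d M) (x₀ : M) (y : EuclideanSpace ℝ (Fin d)) :
    EuclideanSpace ℝ (Fin d) →L[ℝ] ℝ :=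
  (θ ((extChartAt (𝓡 d) x₀).symm y)).comp
    (mfderiv 𝓘(ℝ, EuclideanSpace ℝ (Fin d)) (𝓡 d) (extChartAt (𝓡 d) x₀).symm y)

/-- The exterior derivative of a `1`-form (convention `dθ(X,Y) = X θ(Y) - Y θ(X) - θ([X,Y])`),
computed at `x` by pulling back to the model space through the preferred chart at `x`. -/
def dForm (θ : OneForm d M) (x : M) (v w : TangentSpace (𝓡 d) x) : ℝ :=
  extDeriv
    (fun y => ContinuousAlternatingMap.ofSubsingleton ℝ (EuclideanSpace ℝ (Fin d)) ℝ (0 : Fin 1)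
      (formInChart θ x y))
    (extChartAt (𝓡 d) x x)
    ![mfderiv (𝓡 d) 𝓘(ℝ, EuclideanSpace ℝ (Fin d)) (extChartAt (𝓡 d) x) x v,
      mfderiv (𝓡 d) 𝓘(ℝ, EuclideanSpace ℝ (Fin d)) (extChartAt (𝓡 d) x) x w]

/-- The matrix `(g_ij)` of the metric in a chart `e`, at the point `y` of its target. -/
def gramMatrix [IsManifold (𝓡 d) ∞ M] (g : RMetric d M)
    (e : OpenPartialHomeomorph M (EuclideanSpace ℝ (Fin d))) (y : EuclideanSpace ℝ (Fin d)) :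
    Matrix (Fin d) (Fin d) ℝ :=
  Matrix.of fun i j => g.inner (e.symm y)
    (mfderiv (𝓡 d) (𝓡 d) e.symm y (EuclideanSpace.single i (1 : ℝ)))
    (mfderiv (𝓡 d) (𝓡 d) e.symm y (EuclideanSpace.single j (1 : ℝ)))

/-- `μ` is the Riemannian volume measure of `g`: in every smooth chart it has density
`√(det (g_ij))` with respect to Lebesgue measure. -/
def IsRiemannianVolume [IsManifold (𝓡 d) ∞ M] [MeasurableSpace M] (g : RMetric d M)
    (μ : Measure M) : Prop :=
  ∀ e ∈ IsManifold.maximalAtlas (𝓡 d) ∞ M, ∀ A : Set M, MeasurableSet A → A ⊆ e.source →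
    μ A = ∫⁻ y in e '' A, ENNReal.ofReal (Real.sqrt (gramMatrix g e y).det)

/-- The Laplace-Beltrami operator `Δf = |g|^{-1/2} ∂_i (|g|^{1/2} g^{ij} ∂_j f)`, computed at `x`
in the preferred chart at `x`. -/
def laplacian [IsManifold (𝓡 d) ∞ M] (g : RMetric d M) (f : M → ℝ) (x : M) : ℝ :=
  let e := chartAt (EuclideanSpace ℝ (Fin d)) x
  (Real.sqrt (gramMatrix g e (e x)).det)⁻¹ *
    ∑ i, fderiv ℝ (fun y => Real.sqrt (gramMatrix g e y).det *
      ∑ j, (gramMatrix g e y)⁻¹ i j *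
        fderiv ℝ (fun z => f (e.symm z)) y (EuclideanSpace.single j (1 : ℝ)))
      (e x) (EuclideanSpace.single i (1 : ℝ))

/-- The Hamiltonian vector field of `f` for a nondegenerate form `Ω`, with sign `Ω(X_f, ·) = -df`. -/
def hamiltonianField (Ω : TwoForm d M) (f : M → ℝ) : VField d M := fun x =>
  Classical.epsilon fun X : TangentSpace (𝓡 d) x => ∀ w, Ω x X w = -(dFun f x w)

/-- The Poisson bracket `{f, g} = X_f(g) = Ω(X_f, X_g)`.
For `Ω = dx ∧ dy` this is `f_x g_y - f_y g_x`. -/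
def poissonBracket (Ω : TwoForm d M) (f g : M → ℝ) (x : M) : ℝ :=
  dFun g x (hamiltonianField Ω f x)

end Manifold

/-! ### Contact geometry in dimension `2n+1` -/

section Contact

variable {n : ℕ} {M : Type*} [TopologicalSpace M]
  [ChartedSpace (EuclideanSpace ℝ (Fin (2 * n + 1))) M]

/-- The form `θ ∧ (dθ)^n`, up to a positive combinatorial factor. -/
def contactVolume (θ : OneForm (2 * n + 1) M) (x : M)
    (v : Fin (2 * n + 1) → TangentSpace (𝓡 (2 * n + 1)) x) : ℝ :=
  ∑ σ : Equiv.Perm (Fin (2 * n + 1)), ((Equiv.Perm.sign σ : ℤ) : ℝ) *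
    (θ x (v (σ 0)) *
      ∏ k : Fin n, dForm θ x (v (σ ⟨2 * (k : ℕ) + 1, by omega⟩))
        (v (σ ⟨2 * (k : ℕ) + 2, by omega⟩)))

/-- `θ` is a contact form: `θ ∧ (dθ)^n` is nowhere zero. -/
def IsContactForm [IsManifold (𝓡 (2 * n + 1)) ∞ M] (θ : OneForm (2 * n + 1) M) : Prop :=
  SmoothForm θ ∧ ∀ x : M, ∃ v, contactVolume θ x v ≠ 0

variable {d : ℕ} {P : Type*} [TopologicalSpace P] [ChartedSpace (EuclideanSpace ℝ (Fin d)) P]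

/-- `E` is the Reeb field of `θ`: `θ(E) = 1` and `ι_E dθ = 0`. -/
def IsReebField [IsManifold (𝓡 d) ∞ P] (θ : OneForm d P) (E : VField d P) : Prop :=
  SmoothField E ∧ ∀ x, θ x (E x) = 1 ∧ ∀ w, dForm θ x (E x) w = 0

/-- The metric `g` is associated to `θ`, rescaled so that the Reeb field has length `α`:
`α² θ(u) = ⟨u, E⟩`, and there is a `(1,1)`-tensor `φ` with `φ²(u) = -u + θ(u) E` and
`dθ(u, v) = ⟨u, φ v⟩`.  (For `α = 1` this is the usual notion of an associated metric.) -/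
def IsAssociatedMetric [IsManifold (𝓡 d) ∞ P] (θ : OneForm d P) (E : VField d P) (α : ℝ)
    (g : RMetric d P) : Prop :=
  (∀ x u, α ^ 2 * θ x u = g.inner x u (E x)) ∧
  ∃ φ : ∀ x : P, TangentSpace (𝓡 d) x →L[ℝ] TangentSpace (𝓡 d) x,
    (∀ x u, φ x (φ x u) = -u + θ x u • E x) ∧
    ∀ x u v, dForm θ x u v = g.inner x u (φ x v)

/-- Regularity of a contact form in terms of its Reeb field `E`: the orbits of `E` are all closed,
with the same period `T`, i.e. the flow `Φ` of `E` is a free circle action. -/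
def IsRegularReeb (E : VField d P) : Prop :=
  ∃ T : ℝ, 0 < T ∧ ∃ Φ : ℝ → P → P,
    ContMDiff (𝓘(ℝ, ℝ).prod (𝓡 d)) (𝓡 d) ∞ (Function.uncurry Φ) ∧
    (∀ x, Φ 0 x = x) ∧
    (∀ x, IsMIntegralCurve (I := 𝓡 d) (fun t => Φ t x) E) ∧
    ∀ x t, Φ t x = x ↔ ∃ k : ℤ, t = k * T

/-- `x` and `y` lie on the same orbit of `E`. -/
def SameOrbit (E : VField d P) (x y : P) : Prop :=
  ∃ γ : ℝ → P, IsMIntegralCurve (I := 𝓡 d) γ E ∧ γ 0 = x ∧ ∃ t, γ t = y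

/-- The contact vector field `S_θ f`: the vector field `u` with `θ(u) = f` and
`ι_u dθ = E(f) θ - df`. -/
def contactField (θ : OneForm d P) (E : VField d P) (f : P → ℝ) : VField d P := fun x =>
  Classical.epsilon fun u : TangentSpace (𝓡 d) x =>
    θ x u = f x ∧ ∀ w, dForm θ x u w = dFun f x (E x) * θ x w - dFun f x w

/-- The contact bracket `{f, g} = S_θ f (g) - g E(f)`. -/
def contactBracket (θ : OneForm d P) (E : VField d P) (f g : P → ℝ) (x : P) : ℝ :=
  dFun g x (contactField θ E f x) - g x * dFun f x (E x)

/-- `X` belongs to the Lie algebra of the quantomorphism group `{η | η^* θ = θ}`: it is smooth and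
its Lie derivative `L_X θ = ι_X dθ + d(θ(X))` vanishes. -/
def IsQuantField [IsManifold (𝓡 d) ∞ P] (θ : OneForm d P) (X : VField d P) : Prop :=
  SmoothField X ∧ ∀ x w, dForm θ x (X x) w + dFun (fun y => θ y (X y)) x w = 0

/-- `X` vanishes outside a compact set. -/
def CompactlySupported (X : VField d P) : Prop :=
  ∃ K : Set P, IsCompact K ∧ ∀ x ∉ K, X x = 0

end Contact

/-! ### The centrally extended Lie algebra and its Euler-Arnold equation -/

section Extension

variable {d : ℕ} {P : Type*} [TopologicalSpace P] [ChartedSpace (EuclideanSpace ℝ (Fin d)) P]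
  [IsManifold (𝓡 d) ∞ P] [MeasurableSpace P]

/-- The cocycle `b(u, v) = -∫ p [u, v](q) dμ`, with `[u, v]` the bracket of vector fields. -/
def cocycle (μ : Measure P) (p q : P → ℝ) (u v : VField d P) : ℝ :=
  -∫ x, p x * dFun q x (VectorField.mlieBracket (𝓡 d) u v x) ∂μ

/-- The adjoint operator of the central extension,
`ad_{(u,a)} (v,b) = (ad_u v, b(u, v)) = (-[u, v], b(u, v))`. -/
def adExt (μ : Measure P) (p q : P → ℝ) (U V : VField d P × ℝ) : VField d P × ℝ :=
  (-VectorField.mlieBracket (𝓡 d) U.1 V.1, cocycle μ p q U.1 V.1)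

/-- The inner product `⟪(u,a), (v,b)⟫ = ∫ ⟨u, v⟩ dμ + a b`. -/
def innerExt (g : RMetric d P) (μ : Measure P) (U V : VField d P × ℝ) : ℝ :=
  ∫ x, g.inner x (U.1 x) (V.1 x) ∂μ + U.2 * V.2

/-- `A` is an element of the extended algebra that represents `ad_U^* W`:
`⟪A, V⟫ = ⟪W, ad_U V⟫` for every (compactly supported) element `V` of the extended algebra.
If the manifold is compact, `V` ranges over the whole algebra. -/
def IsAdTranspose (θ : OneForm d P) (g : RMetric d P) (μ : Measure P) (p q : P → ℝ)
    (U W A : VField d P × ℝ) : Prop :=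
  IsQuantField θ A.1 ∧ ∀ V : VField d P × ℝ, IsQuantField θ V.1 → CompactlySupported V.1 →
    innerExt g μ A V = innerExt g μ W (adExt μ p q U V)

/-- The time derivative of a curve in the extended algebra. -/
def velocity (U : ℝ → VField d P × ℝ) (t : ℝ) : VField d P × ℝ :=
  (fun x => deriv (fun s => (U s).1 x) t, deriv (fun s => (U s).2) t)

/-- The Euler-Arnold equation `U' + ad_U^* U = 0` at all times `t ∈ J`. -/
def SolvesEulerArnold (θ : OneForm d P) (g : RMetric d P) (μ : Measure P) (p q : P → ℝ)
    (J : Set ℝ) (U : ℝ → VField d P × ℝ) : Prop :=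
  ∀ t ∈ J, IsAdTranspose θ g μ p q (U t) (U t) (-velocity U t)

end Extension

/-! ### Boothby-Wang fibrations with compatible metrics -/

section Fibration

/-- A `(2n+1)`-manifold `M` with a regular contact form `θ` and an associated metric for which the
Reeb field has length `α`, together with its Boothby-Wang quotient `π : M → N` (a smooth surjective
submersion whose fibres are the Reeb orbits), the form `Ω` on `N` with `π^* Ω = dθ` (which is then
automatically symplectic), and the metric on `N` for which `π` is a Riemannian submersion. -/
structure BoothbyWang (n : ℕ) (M N : Type*)
    [TopologicalSpace M] [ChartedSpace (EuclideanSpace ℝ (Fin (2 * n + 1))) M]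
    [IsManifold (𝓡 (2 * n + 1)) ∞ M]
    [TopologicalSpace N] [ChartedSpace (EuclideanSpace ℝ (Fin (2 * n))) N]
    [IsManifold (𝓡 (2 * n)) ∞ N] where
  θ : OneForm (2 * n + 1) M
  reeb : VField (2 * n + 1) M
  α : ℝ
  gM : RMetric (2 * n + 1) M
  proj : M → N
  Ω : TwoForm (2 * n) N
  gN : RMetric (2 * n) N
  contact : IsContactForm θ
  isReeb : IsReebField θ reeb
  α_pos : 0 < α
  associated : IsAssociatedMetric θ reeb α gM
  regular : IsRegularReeb reeb
  proj_smooth : ContMDiff (𝓡 (2 * n + 1)) (𝓡 (2 * n)) ∞ proj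
  proj_surjective : Function.Surjective proj
  proj_submersion : ∀ x, Function.Surjective (mfderiv (𝓡 (2 * n + 1)) (𝓡 (2 * n)) proj x)
  proj_fibres : ∀ x y, proj x = proj y ↔ SameOrbit reeb x y
  proj_pullback : ∀ x v w,
    Ω (proj x) (mfderiv (𝓡 (2 * n + 1)) (𝓡 (2 * n)) proj x v)
      (mfderiv (𝓡 (2 * n + 1)) (𝓡 (2 * n)) proj x w) = dForm θ x v w
  proj_isometry : ∀ x v w,
    (∀ k, mfderiv (𝓡 (2 * n + 1)) (𝓡 (2 * n)) proj x k = 0 → gM.inner x v k = 0) →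
    (∀ k, mfderiv (𝓡 (2 * n + 1)) (𝓡 (2 * n)) proj x k = 0 → gM.inner x w k = 0) →
    gN.inner (proj x) (mfderiv (𝓡 (2 * n + 1)) (𝓡 (2 * n)) proj x v)
      (mfderiv (𝓡 (2 * n + 1)) (𝓡 (2 * n)) proj x w) = gM.inner x v w

variable {n : ℕ} {M N : Type*}
  [TopologicalSpace M] [ChartedSpace (EuclideanSpace ℝ (Fin (2 * n + 1))) M]
  [IsManifold (𝓡 (2 * n + 1)) ∞ M]
  [TopologicalSpace N] [ChartedSpace (EuclideanSpace ℝ (Fin (2 * n))) N]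
  [IsManifold (𝓡 (2 * n)) ∞ N]

/-- The contact vector field on `M` with stream function `f ∘ π`. -/
def BoothbyWang.lift (D : BoothbyWang n M N) (f : N → ℝ) : VField (2 * n + 1) M :=
  contactField D.θ D.reeb (f ∘ D.proj)

/-- The functions `p`, `q` that enter the cocycle: smooth and Reeb-invariant functions on `M` whose
contact bracket is the function `ψ` on the quotient. -/
structure BoothbyWang.IsCocyclePair (D : BoothbyWang n M N) (p q : M → ℝ) (ψ : N → ℝ) :
    Prop where
  p_smooth : ContMDiff (𝓡 (2 * n + 1)) 𝓘(ℝ, ℝ) ∞ p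
  q_smooth : ContMDiff (𝓡 (2 * n + 1)) 𝓘(ℝ, ℝ) ∞ q
  p_invariant : ∀ x, dFun p x (D.reeb x) = 0
  q_invariant : ∀ x, dFun q x (D.reeb x) = 0
  bracket : ∀ x, contactBracket D.θ D.reeb p q x = ψ (D.proj x)

/-- The potential vorticity `ϖ = Δf - α² f - β ψ` on the quotient. -/
def BoothbyWang.vorticity (D : BoothbyWang n M N) (β : ℝ) (ψ : N → ℝ) (f : N → ℝ) (y : N) : ℝ :=
  laplacian D.gN f y - D.α ^ 2 * f y - β * ψ y

end Fibration

/-! ### The plane -/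

/-- The plane, with coordinates `x = z 0` and `y = z 1`. -/
abbrev Plane : Type := EuclideanSpace ℝ (Fin (2 * 1))

/-- The partial derivative `∂_x`. -/
def partialX (f : Plane → ℝ) (z : Plane) : ℝ := fderiv ℝ f z (EuclideanSpace.single 0 (1 : ℝ))

/-- The partial derivative `∂_y`. -/
def partialY (f : Plane → ℝ) (z : Plane) : ℝ := fderiv ℝ f z (EuclideanSpace.single 1 (1 : ℝ))

/-- The Laplacian `∂_x² + ∂_y²`. -/
def planeLaplacian (f : Plane → ℝ) (z : Plane) : ℝ :=
  partialX (partialX f) z + partialY (partialY f) z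

/-- The bracket `f_x g_y - f_y g_x`. -/
def planeBracket (f g : Plane → ℝ) (z : Plane) : ℝ :=
  partialX f z * partialY g z - partialY f z * partialX g z

end QuantExt

end

/-! Everything is reduced to functions. A field `X` with `L_X θ = 0` satisfies `dθ(X, ·) = -dF` for
`F = θ(X)`, and `dθ` is nondegenerate modulo the Reeb field `E`, so `X = S F`. Evaluation at `E`
gives `E(F) = 0`, hence `F` is constant on the fibres of `π`. It descends to a smooth function
because a submersion has smooth local sections. This is the first claim (`isQuantField_iff`).

The second claim is a computation of the weak equation against fields `S G`, with `G` Reeb-invariant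
and compactly supported. It rests on three facts: `[S F, S G] = S(dG(S F))` (`mlieBracket_S`); the
fields `S F` are divergence free for the Riemannian volume (`IsQuantField.hasDivergence`); the
gradient of `f ∘ π` has divergence `(Δf) ∘ π` (`hasDivergence_grad`). The last one gives `∫ ⟨S f, S
G⟩ = ∫ G (α² f - Δf)`. The first two allow integration by parts along contact fields and turn the
cocycle into `-∫ G {f, ψ}`. In `innerExt_sub_eq` the defect of the equation becomes one integral
against `G`, minus `c' b`. Varying `b` gives `c' = 0`; varying `G` gives the pointwise equation.
There are enough test functions because the orbits are circles, so small compact sets of `N` have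
compact preimages.

For the volume: a field that preserves `θ` preserves the bilinear form `dθ + θ ⊗ θ`, whose
determinant is a constant multiple of that of the metric; Jacobi's formula converts this into
vanishing divergence. For the Laplacian: the divergence of `Z` is half of `tr (G⁻¹ L_Z G)`. The
metric on `M` is `α² θ ⊗ θ + π^* g_N`, and for the horizontal lift `Z` of a gradient `L_Z θ = ι_Z
dθ` vanishes on `E`, so `θ ⊗ θ` contributes only mixed terms, which the trace does not see.

Finally time derivatives are moved through `S` and `Δ`, and the constant `c = -β` is absorbed into
the potential vorticity. In the plane `{f, f} = 0` and `{f, y} = σ ∂_x f`. -/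

noncomputable section

namespace QuantExt

open Set Filter Topology

/-! ### Fields, forms and metrics read in charts. -/

section Charts

variable {d : ℕ} {M : Type*} [TopologicalSpace M] [ChartedSpace (EuclideanSpace ℝ (Fin d)) M]

/-- The differential at `x` of the preferred chart at `x₀`. -/
def push (x₀ x : M) : TangentSpace (𝓡 d) x →L[ℝ] EuclideanSpace ℝ (Fin d) :=
  mfderiv (𝓡 d) 𝓘(ℝ, EuclideanSpace ℝ (Fin d)) (extChartAt (𝓡 d) x₀) x

/-- The differential at `y` of the inverse of the preferred chart at `x₀`. -/
def pull (x₀ : M) (y : EuclideanSpace ℝ (Fin d)) :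
    EuclideanSpace ℝ (Fin d) →L[ℝ] TangentSpace (𝓡 d) ((extChartAt (𝓡 d) x₀).symm y) :=
  mfderiv 𝓘(ℝ, EuclideanSpace ℝ (Fin d)) (𝓡 d) (extChartAt (𝓡 d) x₀).symm y

/-- A vector field read in the preferred chart at `x₀`. -/
def fieldInChart (X : VField d M) (x₀ : M) (y : EuclideanSpace ℝ (Fin d)) :
    EuclideanSpace ℝ (Fin d) :=
  push x₀ ((extChartAt (𝓡 d) x₀).symm y) (X ((extChartAt (𝓡 d) x₀).symm y))

lemma extChart_target_eq (x₀ : M) :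
    (extChartAt (𝓡 d) x₀).target = (chartAt (EuclideanSpace ℝ (Fin d)) x₀).target := by
  simp [extChartAt, OpenPartialHomeomorph.extend]

lemma isOpen_target (x₀ : M) : IsOpen (extChartAt (𝓡 d) x₀).target := by
  rw [extChart_target_eq]; exact (chartAt _ x₀).open_target

lemma symm_mem_source {x₀ : M} {y : EuclideanSpace ℝ (Fin d)}
    (hy : y ∈ (extChartAt (𝓡 d) x₀).target) :
    (extChartAt (𝓡 d) x₀).symm y ∈ (chartAt (EuclideanSpace ℝ (Fin d)) x₀).source := by
  rw [← extChartAt_source (I := 𝓡 d)]; exact (extChartAt (𝓡 d) x₀).map_target hy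

lemma exists_mem_target {x₀ x : M} (hx : x ∈ (chartAt (EuclideanSpace ℝ (Fin d)) x₀).source) :
    ∃ y ∈ (extChartAt (𝓡 d) x₀).target, (extChartAt (𝓡 d) x₀).symm y = x := by
  rw [← extChartAt_source (I := 𝓡 d)] at hx
  exact ⟨_, (extChartAt (𝓡 d) x₀).map_source hx, (extChartAt (𝓡 d) x₀).left_inv hx⟩

lemma exists_mem_target_self (x : M) :
    ∃ y ∈ (extChartAt (𝓡 d) x).target, (extChartAt (𝓡 d) x).symm y = x :=
  exists_mem_target (mem_chart_source _ x)

lemma pull_eq (x₀ : M) (y : EuclideanSpace ℝ (Fin d)) :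
    pull x₀ y = mfderivWithin 𝓘(ℝ, EuclideanSpace ℝ (Fin d)) (𝓡 d)
      (extChartAt (𝓡 d) x₀).symm (range (𝓡 d)) y := by
  rw [ModelWithCorners.range_eq_univ, mfderivWithin_univ]; rfl

lemma formInChart_apply (θ : OneForm d M) (x₀ : M) (y v : EuclideanSpace ℝ (Fin d)) :
    formInChart θ x₀ y v = θ ((extChartAt (𝓡 d) x₀).symm y) (pull x₀ y v) := rfl

variable [IsManifold (𝓡 d) ∞ M]

lemma push_pull {x₀ : M} {y : EuclideanSpace ℝ (Fin d)} (hy : y ∈ (extChartAt (𝓡 d) x₀).target)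
    (v : EuclideanSpace ℝ (Fin d)) :
    push x₀ ((extChartAt (𝓡 d) x₀).symm y) (pull x₀ y v) = v := by
  rw [pull_eq]
  exact congrArg (fun L => L v)
    (mfderiv_extChartAt_comp_mfderivWithin_extChartAt_symm (I := 𝓡 d) hy)

lemma pull_push {x₀ : M} {y : EuclideanSpace ℝ (Fin d)} (hy : y ∈ (extChartAt (𝓡 d) x₀).target)
    (v : TangentSpace (𝓡 d) ((extChartAt (𝓡 d) x₀).symm y)) :
    pull x₀ y (push x₀ ((extChartAt (𝓡 d) x₀).symm y) v) = v := by
  rw [pull_eq]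
  exact congrArg (fun L => L v)
    (mfderivWithin_extChartAt_symm_comp_mfderiv_extChartAt (I := 𝓡 d) hy)

lemma push_pull_push {x₀ x : M} (hx : x ∈ (chartAt (EuclideanSpace ℝ (Fin d)) x₀).source)
    (x₁ : M) (v : TangentSpace (𝓡 d) x) :
    push x₁ ((extChartAt (𝓡 d) x₀).symm (extChartAt (𝓡 d) x₀ x))
      (pull x₀ (extChartAt (𝓡 d) x₀ x) (push x₀ x v)) = push x₁ x v := by
  obtain ⟨y, hy, rfl⟩ := exists_mem_target hx
  rw [(extChartAt (𝓡 d) x₀).right_inv hy, pull_push hy]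

lemma pull_fieldInChart {x₀ : M} {y : EuclideanSpace ℝ (Fin d)}
    (hy : y ∈ (extChartAt (𝓡 d) x₀).target) (X : VField d M) :
    pull x₀ y (fieldInChart X x₀ y) = X ((extChartAt (𝓡 d) x₀).symm y) :=
  pull_push hy _

lemma mdifferentiableAt_symm {x₀ : M} {y : EuclideanSpace ℝ (Fin d)}
    (hy : y ∈ (extChartAt (𝓡 d) x₀).target) :
    MDifferentiableAt 𝓘(ℝ, EuclideanSpace ℝ (Fin d)) (𝓡 d) (extChartAt (𝓡 d) x₀).symm y := by
  have := mdifferentiableWithinAt_extChartAt_symm (I := 𝓡 d) hy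
  simpa [mdifferentiableWithinAt_univ] using this

lemma contMDiffOn_symm (x₀ : M) :
    ContMDiffOn 𝓘(ℝ, EuclideanSpace ℝ (Fin d)) (𝓡 d) ∞ (extChartAt (𝓡 d) x₀).symm
      (extChartAt (𝓡 d) x₀).target :=
  contMDiffOn_extChartAt_symm x₀

lemma contDiffOn_comp_symm {f : M → ℝ} (hf : ContMDiff (𝓡 d) 𝓘(ℝ, ℝ) ∞ f) (x₀ : M) :
    ContDiffOn ℝ ∞ (fun y => f ((extChartAt (𝓡 d) x₀).symm y)) (extChartAt (𝓡 d) x₀).target :=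
  (hf.comp_contMDiffOn (contMDiffOn_symm x₀)).contDiffOn

lemma contMDiff_of_comp_symm {F : Type*} [NormedAddCommGroup F] [NormedSpace ℝ F] {f : M → F}
    (hf : ∀ x₀ : M, ContDiffOn ℝ ∞ (fun y => f ((extChartAt (𝓡 d) x₀).symm y))
      (extChartAt (𝓡 d) x₀).target) : ContMDiff (𝓡 d) 𝓘(ℝ, F) ∞ f := by
  intro x₀
  have h1 := (hf x₀).contMDiffOn.comp (contMDiffOn_extChartAt (I := 𝓡 d) (x := x₀) (n := ∞))
    (fun x hx => (extChartAt (𝓡 d) x₀).map_source (by rwa [extChartAt_source]))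
  refine ((h1.congr ?_).contMDiffAt
    ((chartAt (EuclideanSpace ℝ (Fin d)) x₀).open_source.mem_nhds (mem_chart_source _ x₀)))
  intro x hx
  simp only [Function.comp]
  rw [(extChartAt (𝓡 d) x₀).left_inv (by rwa [extChartAt_source])]

lemma fderiv_comp_symm {f : M → ℝ} {x₀ : M} {y : EuclideanSpace ℝ (Fin d)}
    (hy : y ∈ (extChartAt (𝓡 d) x₀).target)
    (hf : MDifferentiableAt (𝓡 d) 𝓘(ℝ, ℝ) f ((extChartAt (𝓡 d) x₀).symm y))
    (v : EuclideanSpace ℝ (Fin d)) :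
    fderiv ℝ (fun y => f ((extChartAt (𝓡 d) x₀).symm y)) y v =
      dFun f ((extChartAt (𝓡 d) x₀).symm y) (pull x₀ y v) := by
  have h := mfderiv_comp (I := 𝓘(ℝ, EuclideanSpace ℝ (Fin d))) (I' := 𝓡 d) (I'' := 𝓘(ℝ, ℝ))
    (f := (extChartAt (𝓡 d) x₀).symm) y hf (mdifferentiableAt_symm hy)
  rw [mfderiv_eq_fderiv] at h
  exact congrArg (fun L => L v) h

lemma fderiv_comp_symm_field {f : M → ℝ} {x₀ : M} {y : EuclideanSpace ℝ (Fin d)}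
    (hy : y ∈ (extChartAt (𝓡 d) x₀).target)
    (hf : MDifferentiableAt (𝓡 d) 𝓘(ℝ, ℝ) f ((extChartAt (𝓡 d) x₀).symm y)) (X : VField d M) :
    fderiv ℝ (fun y => f ((extChartAt (𝓡 d) x₀).symm y)) y (fieldInChart X x₀ y) =
      dFun f ((extChartAt (𝓡 d) x₀).symm y) (X ((extChartAt (𝓡 d) x₀).symm y)) := by
  rw [fderiv_comp_symm hy hf, pull_fieldInChart hy]

/-- A metric read in the preferred chart at `x₀`. -/
def metricInChart (g : RMetric d M) (x₀ : M) (y : EuclideanSpace ℝ (Fin d)) :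
    EuclideanSpace ℝ (Fin d) →L[ℝ] EuclideanSpace ℝ (Fin d) →L[ℝ] ℝ :=
  -- The ascriptions view the tangent space at the varying point as the fixed model space.
  let G : EuclideanSpace ℝ (Fin d) →L[ℝ] EuclideanSpace ℝ (Fin d) →L[ℝ] ℝ :=
    g.inner ((extChartAt (𝓡 d) x₀).symm y)
  let A : EuclideanSpace ℝ (Fin d) →L[ℝ] EuclideanSpace ℝ (Fin d) := pull x₀ y
  G.bilinearComp A A

lemma metricInChart_apply (g : RMetric d M) (x₀ : M) (y v w : EuclideanSpace ℝ (Fin d)) :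
    metricInChart g x₀ y v w =
      g.inner ((extChartAt (𝓡 d) x₀).symm y) (pull x₀ y v) (pull x₀ y w) := rfl

/-- The trivialisation of the tangent bundle at `x₀` is the differential of the chart at `x₀`, so
over the chart domain a section is smooth exactly when its chart representative is. -/
lemma smoothField_iff {X : VField d M} :
    SmoothField X ↔ ∀ x₀ : M, ContDiffOn ℝ ∞ (fieldInChart X x₀) (extChartAt (𝓡 d) x₀).target := by
  have key : ∀ x₀ : M, ∀ x ∈ (chartAt (EuclideanSpace ℝ (Fin d)) x₀).source,
      (trivializationAt (EuclideanSpace ℝ (Fin d)) (TangentSpace (𝓡 d)) x₀ ⟨x, X x⟩).2 =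
        push x₀ x (X x) := by
    intro x₀ x hx
    have := TangentBundle.continuousLinearMapAt_trivializationAt (I := 𝓡 d) hx
    rw [push, ← this, Trivialization.continuousLinearMapAt_apply,
      Trivialization.coe_linearMapAt_of_mem]
    exact hx
  have hon : ∀ x₀ : M, (ContMDiffOn (𝓡 d) (𝓡 d).tangent ∞
      (fun x => (⟨x, X x⟩ : TangentBundle (𝓡 d) M))
      (chartAt (EuclideanSpace ℝ (Fin d)) x₀).source ↔
      ContMDiffOn (𝓡 d) 𝓘(ℝ, EuclideanSpace ℝ (Fin d)) ∞ (fun x => push x₀ x (X x))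
        (chartAt (EuclideanSpace ℝ (Fin d)) x₀).source) := by
    intro x₀
    refine Iff.trans (Trivialization.contMDiffOn_section_iff
      (trivializationAt (EuclideanSpace ℝ (Fin d)) (TangentSpace (𝓡 d)) x₀)
      (chartAt _ x₀).open_source (by simp)) ?_
    exact contMDiffOn_congr (fun x hx => key x₀ x hx)
  constructor
  · intro h x₀
    have h1 := (hon x₀).1 h.contMDiffOn
    exact (h1.comp (contMDiffOn_symm x₀) (fun y hy => symm_mem_source hy)).contDiffOn
  · intro h x₀
    refine ContMDiffOn.contMDiffAt ((hon x₀).2 ?_)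
      ((chartAt _ x₀).open_source.mem_nhds (mem_chart_source _ x₀))
    have h1 := (h x₀).contMDiffOn.comp (contMDiffOn_extChartAt (I := 𝓡 d) (x := x₀) (n := ∞))
      (fun x hx => (extChartAt (𝓡 d) x₀).map_source (by rwa [extChartAt_source]))
    refine h1.congr ?_
    intro x hx
    simp only [Function.comp, fieldInChart]
    rw [(extChartAt (𝓡 d) x₀).left_inv (by rwa [extChartAt_source])]

/-- Coordinate fields are the images of constant sections under the tangent map of the inverse
chart. Pairing with them is how smoothness of forms and metrics is read off in coordinates. -/
lemma contMDiffOn_pull_const (x₀ : M) (v : EuclideanSpace ℝ (Fin d)) :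
    ContMDiffOn 𝓘(ℝ, EuclideanSpace ℝ (Fin d)) (𝓡 d).tangent ∞
      (fun y => (⟨(extChartAt (𝓡 d) x₀).symm y, pull x₀ y v⟩ : TangentBundle (𝓡 d) M))
      (extChartAt (𝓡 d) x₀).target := by
  have h1 := (contMDiffOn_symm (d := d) x₀).contMDiffOn_tangentMapWithin (m := ∞) (by simp)
    (isOpen_target x₀).uniqueMDiffOn
  have h2 : ContMDiff 𝓘(ℝ, EuclideanSpace ℝ (Fin d)) 𝓘(ℝ, EuclideanSpace ℝ (Fin d)).tangent ∞
      (fun y => (⟨y, v⟩ : TangentBundle 𝓘(ℝ, EuclideanSpace ℝ (Fin d))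
        (EuclideanSpace ℝ (Fin d)))) :=
    contMDiff_vectorSpace_iff_contDiff.2 contDiff_const
  refine (h1.comp h2.contMDiffOn (fun y hy => hy)).congr ?_
  intro y hy
  simp only [Function.comp, tangentMapWithin, pull]
  rw [mfderivWithin_of_isOpen (isOpen_target x₀) hy]
  rfl

lemma SmoothForm.contDiffOn {θ : OneForm d M} (h : SmoothForm θ) (x₀ : M) :
    ContDiffOn ℝ ∞ (formInChart θ x₀) (extChartAt (𝓡 d) x₀).target := by
  rw [contDiffOn_clm_apply]
  intro v
  have h1 := (h.comp_contMDiffOn (contMDiffOn_symm (d := d) x₀))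
  have h2 := ContMDiffOn.clm_bundle_apply (E₁ := fun x : M => TangentSpace (𝓡 d) x)
    (E₂ := Trivial M ℝ) (b := (extChartAt (𝓡 d) x₀).symm) h1 (contMDiffOn_pull_const x₀ v)
  intro y hy
  have h3 := (contMDiffWithinAt_totalSpace.1 (h2 y hy)).2
  exact h3.contDiffWithinAt

lemma contDiffOn_metricInChart (g : RMetric d M) (x₀ : M) :
    ContDiffOn ℝ ∞ (metricInChart g x₀) (extChartAt (𝓡 d) x₀).target := by
  rw [contDiffOn_clm_apply]
  intro v
  rw [contDiffOn_clm_apply]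
  intro w
  have h1 := (g.contMDiff.comp_contMDiffOn (contMDiffOn_symm (d := d) x₀))
  have h2 := ContMDiffOn.clm_bundle_apply₂ (E₁ := fun x : M => TangentSpace (𝓡 d) x)
    (E₂ := fun x : M => TangentSpace (𝓡 d) x)
    (E₃ := Trivial M ℝ) (b := (extChartAt (𝓡 d) x₀).symm) h1 (contMDiffOn_pull_const x₀ v)
    (contMDiffOn_pull_const x₀ w)
  intro y hy
  have h3 := (contMDiffWithinAt_totalSpace.1 (h2 y hy)).2
  exact h3.contDiffWithinAt

lemma two_le_infty : (2 : WithTop ℕ∞) ≤ ∞ := ENat.LEInfty.out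

lemma extDeriv_ofSubsingleton {E : Type*} [NormedAddCommGroup E] [NormedSpace ℝ E]
    {η : E → E →L[ℝ] ℝ} {y : E} (h : DifferentiableAt ℝ η y) (v w : E) :
    extDeriv (fun y => ContinuousAlternatingMap.ofSubsingleton ℝ E ℝ (0 : Fin 1) (η y)) y ![v, w] =
      fderiv ℝ η y v w - fderiv ℝ η y w v := by
  have h1 : HasFDerivAt
      (fun y => ContinuousAlternatingMap.ofSubsingleton ℝ E ℝ (0 : Fin 1) (η y))
      (((ContinuousAlternatingMap.ofSubsingletonLIE (𝕜 := ℝ) (E := E) (F := ℝ) (0 : Fin 1)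
        ).toContinuousLinearEquiv.toContinuousLinearMap).comp (fderiv ℝ η y)) y :=
    ((ContinuousAlternatingMap.ofSubsingletonLIE (𝕜 := ℝ) (E := E) (F := ℝ) (0 : Fin 1)
        ).toContinuousLinearEquiv.toContinuousLinearMap).hasFDerivAt.comp y h.hasFDerivAt
  rw [extDeriv_apply h1.differentiableAt]
  have h2 : ∀ a b, fderiv ℝ (fun x => η x a) y b = fderiv ℝ η y b a := by
    intro a b
    rw [(h.hasFDerivAt.clm_apply (hasFDerivAt_const a y)).fderiv]
    simp
  simp only [ContinuousAlternatingMap.ofSubsingleton_apply_apply, h2]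
  simp [Fin.sum_univ_two, Fin.removeNth, sub_eq_add_neg]

/-- `dForm` uses a different chart at each point, whereas differentiation needs one chart on a
neighbourhood. The exterior derivative commutes with pullback along the transition map `τ`, so any
chart around the point gives the same value. -/
lemma dForm_pull {θ : OneForm d M} (h : SmoothForm θ) {x₀ : M} {y : EuclideanSpace ℝ (Fin d)}
    (hy : y ∈ (extChartAt (𝓡 d) x₀).target) (v w : EuclideanSpace ℝ (Fin d)) :
    dForm θ ((extChartAt (𝓡 d) x₀).symm y) (pull x₀ y v) (pull x₀ y w) =
      fderiv ℝ (formInChart θ x₀) y v w - fderiv ℝ (formInChart θ x₀) y w v := by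
  set x := (extChartAt (𝓡 d) x₀).symm y with hx
  set z := extChartAt (𝓡 d) x x with hz
  set τ : EuclideanSpace ℝ (Fin d) → EuclideanSpace ℝ (Fin d) :=
    fun z => extChartAt (𝓡 d) x₀ ((extChartAt (𝓡 d) x).symm z) with hτ
  have hzt : z ∈ (extChartAt (𝓡 d) x).target := mem_extChartAt_target x
  have hxz : (extChartAt (𝓡 d) x).symm z = x := extChartAt_to_inv x
  have hτz : τ z = y := by
    simp only [hτ, hxz]; exact (extChartAt (𝓡 d) x₀).right_inv hy
  have hcont : ContinuousAt (extChartAt (𝓡 d) x).symm z := continuousAt_extChartAt_symm x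
  have hxs : x ∈ (chartAt (EuclideanSpace ℝ (Fin d)) x₀).source := symm_mem_source hy
  have hev : ∀ᶠ z' in 𝓝 z, z' ∈ (extChartAt (𝓡 d) x).target ∧
      (extChartAt (𝓡 d) x).symm z' ∈ (chartAt (EuclideanSpace ℝ (Fin d)) x₀).source := by
    refine Filter.Eventually.and ((isOpen_target x).mem_nhds hzt) (hcont.preimage_mem_nhds ?_)
    rw [hxz]
    exact (chartAt _ x₀).open_source.mem_nhds hxs
  have hmd : ∀ z', z' ∈ (extChartAt (𝓡 d) x).target ∧
      (extChartAt (𝓡 d) x).symm z' ∈ (chartAt (EuclideanSpace ℝ (Fin d)) x₀).source →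
      ∀ a, fderiv ℝ τ z' a = push x₀ ((extChartAt (𝓡 d) x).symm z') (pull x z' a) := by
    rintro z' ⟨h1, h2⟩ a
    have h := mfderiv_comp (I := 𝓘(ℝ, EuclideanSpace ℝ (Fin d))) (I' := 𝓡 d)
      (I'' := 𝓘(ℝ, EuclideanSpace ℝ (Fin d)))
      (f := (extChartAt (𝓡 d) x).symm) (g := extChartAt (𝓡 d) x₀) z'
      (mdifferentiableAt_extChartAt h2) (mdifferentiableAt_symm h1)
    rw [mfderiv_eq_fderiv] at h
    exact congrArg (fun L => L a) h
  have hτsm : ContDiffAt ℝ ∞ τ z := by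
    have h1 : ContMDiffAt (𝓡 d) 𝓘(ℝ, EuclideanSpace ℝ (Fin d)) ∞ (extChartAt (𝓡 d) x₀)
        ((extChartAt (𝓡 d) x).symm z) := by
      rw [hxz]
      exact contMDiffAt_extChartAt' hxs
    have h2 := (contMDiffOn_symm (d := d) x).contMDiffAt ((isOpen_target x).mem_nhds hzt)
    exact (h1.comp z h2).contDiffAt
  -- Near `z` the form in the chart at `x` is the pullback by `τ` of the form in the chart at `x₀`.
  have hform : (fun z' => ContinuousAlternatingMap.ofSubsingleton ℝ (EuclideanSpace ℝ (Fin d)) ℝ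
      (0 : Fin 1) (formInChart θ x z')) =ᶠ[𝓝 z] fun z' =>
      (ContinuousAlternatingMap.ofSubsingleton ℝ (EuclideanSpace ℝ (Fin d)) ℝ
      (0 : Fin 1) (formInChart θ x₀ (τ z'))).compContinuousLinearMap (fderiv ℝ τ z') := by
    filter_upwards [hev] with z' hz'
    ext a
    obtain ⟨y', hy', hyz'⟩ := exists_mem_target hz'.2
    have e1 : τ z' = y' := by
      simp only [hτ, ← hyz']; exact (extChartAt (𝓡 d) x₀).right_inv hy'
    simp only [ContinuousAlternatingMap.ofSubsingleton_apply_apply,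
      ContinuousAlternatingMap.compContinuousLinearMap_apply, Function.comp, formInChart_apply,
      hmd z' hz', e1]
    -- The vector is generalised because its type mentions the point that is about to be rewritten.
    generalize pull x z' (a 0) = b
    revert b
    rw [← hyz']
    intro b
    rw [pull_push hy']
  have hd : DifferentiableAt ℝ (formInChart θ x₀) y :=
    ((h.contDiffOn x₀).contDiffAt ((isOpen_target x₀).mem_nhds hy)).differentiableAt (by simp)
  have hd' : DifferentiableAt ℝ (fun y => ContinuousAlternatingMap.ofSubsingleton ℝ
      (EuclideanSpace ℝ (Fin d)) ℝ (0 : Fin 1) (formInChart θ x₀ y)) (τ z) := by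
    rw [hτz]
    exact ((ContinuousAlternatingMap.ofSubsingletonLIE (𝕜 := ℝ)
      (E := EuclideanSpace ℝ (Fin d)) (F := ℝ) (0 : Fin 1)
        ).toContinuousLinearEquiv.toContinuousLinearMap).differentiableAt.comp y hd
  have hvec : ∀ a, fderiv ℝ τ z (push x x (pull x₀ y a)) = a := by
    intro a
    rw [hmd z hev.self_of_nhds, hz, push_pull_push (mem_chart_source _ x)]
    exact push_pull hy a
  unfold dForm
  rw [← hz, hform.extDeriv_eq, extDeriv_pullback hd' hτsm (r := ∞) (by simpa using two_le_infty), hτz,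
    ContinuousAlternatingMap.compContinuousLinearMap_apply, ← extDeriv_ofSubsingleton hd]
  congr 1
  ext i : 1
  fin_cases i
  · exact hvec v
  · exact hvec w

end Charts

/-! ### Determinants and traces. -/

section LinearAlgebra

/-- Jacobi's formula for the derivative of a determinant. -/
lemma hasFDerivAt_det {ι E : Type*} [Fintype ι] [DecidableEq ι] [NormedAddCommGroup E]
    [NormedSpace ℝ E] {A : E → Matrix ι ι ℝ} {A' : ι → ι → E →L[ℝ] ℝ} {y : E}
    (h : ∀ i j, HasFDerivAt (fun z => A z i j) (A' i j) y) :
    HasFDerivAt (fun z => (A z).det) (∑ i, ∑ j, (A y).adjugate i j • A' j i) y := by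
  have h1 : HasFDerivAt (fun z => (A z).det)
      (∑ σ : Equiv.Perm ι, ((Equiv.Perm.sign σ : ℤ) : ℝ) •
        ∑ i, (∏ j ∈ Finset.univ.erase i, A y (σ j) j) • A' (σ i) i) y := by
    simp only [Matrix.det_apply']
    exact HasFDerivAt.fun_sum fun σ _ =>
      (HasFDerivAt.finsetProd (fun i _ => h (σ i) i)).const_mul _
  refine h1.congr_fderiv ?_
  ext v
  simp only [sum_apply, smul_apply, smul_eq_mul]
  simp_rw [Finset.mul_sum]
  rw [Finset.sum_comm]
  refine Finset.sum_congr rfl fun i _ => ?_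
  -- Cramer's rule: row `i` of the adjugate against a vector is the determinant with column `i`
  -- replaced by it.
  have h2 : ∑ j, (A y).adjugate i j * A' j i v =
      ((A y).updateCol i (fun j => A' j i v)).det := by
    rw [← Matrix.cramer_apply, Matrix.cramer_eq_adjugate_mulVec]
    rfl
  rw [h2, Matrix.det_apply']
  refine Finset.sum_congr rfl fun σ _ => ?_
  congr 1
  rw [← Finset.mul_prod_erase Finset.univ _ (Finset.mem_univ i), mul_comm]
  congr 1
  · simp
  · exact Finset.prod_congr rfl fun j hj => by
      rw [Matrix.updateCol_ne (Finset.ne_of_mem_erase hj)]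

/-- The trace `tr (G⁻¹ L)` does not change when `G` and `L` are pulled back by a submersion and
`G` is completed by `α² θ ⊗ θ`, while `L` is completed by off-diagonal terms. -/
lemma trace_inv_mul_of_submersion {m n : Type*} [Fintype m] [Fintype n] [DecidableEq m]
    [DecidableEq n] {GN LN : Matrix m m ℝ} {GM LM : Matrix n n ℝ} {l : m → ℝ} {α : ℝ}
    {P : Matrix m n ℝ} {R : Matrix n m ℝ} {θ E : n → ℝ} (hα : α ≠ 0)
    (hPR : P * R = 1) (hPE : P.mulVec E = 0) (hθR : Matrix.vecMul θ R = 0) (hθE : θ ⬝ᵥ E = 1)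
    (hRP : R * P + Matrix.vecMulVec E θ = 1) (hGN : IsUnit GN.det)
    (hGM : GM = α ^ 2 • Matrix.vecMulVec θ θ + P.transpose * GN * P)
    (hLM : LM = α ^ 2 • (Matrix.vecMulVec (Matrix.vecMul l P) θ +
      Matrix.vecMulVec θ (Matrix.vecMul l P)) + P.transpose * LN * P) :
    (GM⁻¹ * LM).trace = (GN⁻¹ * LN).trace := by
  have hPR' : R.transpose * P.transpose = 1 := by
    rw [← Matrix.transpose_mul, hPR, Matrix.transpose_one]
  -- The block inverse in the splitting into the horizontal space (the range of `R`) and the line of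
  -- `E`, where `GM` is block diagonal.
  have hinv : GM⁻¹ = R * GN⁻¹ * R.transpose + (α ^ 2)⁻¹ • Matrix.vecMulVec E E := by
    apply Matrix.inv_eq_right_inv
    have e1 : P.transpose * GN * P * (R * GN⁻¹ * R.transpose) = P.transpose * R.transpose := by
      calc _ = P.transpose * (GN * (P * R) * GN⁻¹) * R.transpose := by
            simp only [Matrix.mul_assoc]
        _ = _ := by rw [hPR, Matrix.mul_one, Matrix.mul_nonsing_inv _ hGN, Matrix.mul_one]
    have e2 : P.transpose * GN * P * Matrix.vecMulVec E E = 0 := by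
      rw [Matrix.mul_assoc _ P, Matrix.mul_vecMulVec, hPE]; simp
    have e3 : Matrix.vecMulVec θ θ * (R * GN⁻¹ * R.transpose) = 0 := by
      rw [Matrix.mul_assoc R, Matrix.vecMulVec_mul, ← Matrix.vecMul_vecMul, hθR]; simp
    have e4 : Matrix.vecMulVec θ θ * Matrix.vecMulVec E E = Matrix.vecMulVec θ E := by
      rw [Matrix.vecMulVec_mul_vecMulVec, hθE]; simp
    have e5 : P.transpose * R.transpose + Matrix.vecMulVec θ E = 1 := by
      have := congrArg Matrix.transpose hRP
      rw [Matrix.transpose_add, Matrix.transpose_mul, Matrix.transpose_vecMulVec,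
        Matrix.transpose_one] at this
      exact this
    rw [hGM, Matrix.mul_add, Matrix.add_mul, Matrix.add_mul, e1, Matrix.mul_smul, Matrix.mul_smul,
      Matrix.smul_mul, Matrix.smul_mul, e2, e3, e4, smul_zero, smul_zero, add_zero, zero_add,
      smul_smul, inv_mul_cancel₀ (pow_ne_zero 2 hα), one_smul, e5]
  -- Each mixed term has a factor `θ`, which `R` kills.
  have hRL : R.transpose * LM * R = LN := by
    have e1 : R.transpose * Matrix.vecMulVec θ (Matrix.vecMul l P) = 0 := by
      rw [Matrix.mul_vecMulVec, Matrix.mulVec_transpose, hθR]; simp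
    have e2 : Matrix.vecMulVec (Matrix.vecMul l P) θ * R = 0 := by
      rw [Matrix.vecMulVec_mul, hθR]; ext; simp [Matrix.vecMulVec]
    rw [hLM, Matrix.mul_add, Matrix.add_mul, Matrix.mul_smul, Matrix.smul_mul, Matrix.mul_add,
      Matrix.add_mul, e1, Matrix.mul_assoc, e2]
    calc _ = (R.transpose * P.transpose) * LN * (P * R) := by simp [Matrix.mul_assoc]
      _ = LN := by rw [hPR, hPR', Matrix.one_mul, Matrix.mul_one]
  -- Each mixed term also has a factor `l P`, and `P E = 0`, so there is no vertical-vertical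
  -- component.
  have hEL : E ⬝ᵥ LM.mulVec E = 0 := by
    have e1 : (P.transpose * LN * P).mulVec E = 0 := by
      rw [← Matrix.mulVec_mulVec, hPE, Matrix.mulVec_zero]
    have e2 : Matrix.vecMul l P ⬝ᵥ E = 0 := by
      rw [← Matrix.dotProduct_mulVec, hPE, dotProduct_zero]
    rw [hLM, Matrix.add_mulVec, e1, add_zero, Matrix.smul_mulVec, Matrix.add_mulVec,
      Matrix.vecMulVec_mulVec, Matrix.vecMulVec_mulVec, e2]
    simp [dotProduct_comm E, e2]
  rw [hinv, Matrix.add_mul, Matrix.trace_add, Matrix.smul_mul, Matrix.trace_smul,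
    Matrix.vecMulVec_mul, Matrix.trace_vecMulVec, dotProduct_comm, ← Matrix.dotProduct_mulVec, hEL,
    smul_zero, add_zero, Matrix.mul_assoc, Matrix.mul_assoc, Matrix.trace_mul_comm, ← hRL]
  simp only [Matrix.mul_assoc]

end LinearAlgebra

/-! ### Lie derivatives in coordinates and invariant densities. -/

section Coordinates

/-- A linear equation with smooth injective coefficients has smooth solutions. -/
lemma contDiffOn_of_clm_apply_eq {E : Type*} [NormedAddCommGroup E] [NormedSpace ℝ E]
    [FiniteDimensional ℝ E] {U : Set E} {A : E → E →L[ℝ] E →L[ℝ] ℝ}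
    {b : E → E →L[ℝ] ℝ} {u : E → E} (hA : ContDiffOn ℝ ∞ A U) (hb : ContDiffOn ℝ ∞ b U)
    (hinj : ∀ y ∈ U, ∀ v, A y v = 0 → v = 0) (hu : ∀ y ∈ U, A y (u y) = b y) :
    ContDiffOn ℝ ∞ u U := by
  -- Equality of dimensions upgrades injectivity of `A y` to invertibility; operator inversion is
  -- smooth at invertible maps.
  have hfin : Module.finrank ℝ E = Module.finrank ℝ (E →L[ℝ] ℝ) := by
    rw [← (LinearMap.toContinuousLinearMap (𝕜 := ℝ) (E := E) (F' := ℝ)).finrank_eq]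
    exact (Subspace.dual_finrank_eq (K := ℝ) (V := E)).symm
  have hinv : ∀ y ∈ U, (A y).IsInvertible := by
    intro y hy
    refine ⟨(LinearEquiv.ofInjectiveOfFinrankEq (A y).toLinearMap ?_
      hfin).toContinuousLinearEquiv, ?_⟩
    · exact (injective_iff_map_eq_zero _).2 (hinj y hy)
    · ext v w; rfl
  have heq : ∀ y ∈ U, u y = (A y).inverse (b y) := by
    intro y hy
    rw [← hu y hy]
    exact ((hinv y hy).inverse_apply_eq.2 rfl).symm
  refine ContDiffOn.congr ?_ heq
  refine ContDiffOn.clm_apply ?_ hb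
  intro y hy
  exact ((hinv y hy).contDiffAt_map_inverse.comp_contDiffWithinAt y (hA y hy))

variable {d : ℕ}

/-- The divergence of a vector field on `ℝ^d`. -/
def divg (X : EuclideanSpace ℝ (Fin d) → EuclideanSpace ℝ (Fin d)) (y : EuclideanSpace ℝ (Fin d)) :
    ℝ :=
  ∑ i, fderiv ℝ X y (EuclideanSpace.single i 1) i

/-- The matrix of a bilinear form. -/
def bilinMat (B : EuclideanSpace ℝ (Fin d) →L[ℝ] EuclideanSpace ℝ (Fin d) →L[ℝ] ℝ) :
    Matrix (Fin d) (Fin d) ℝ :=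
  Matrix.of fun i j => B (EuclideanSpace.single i 1) (EuclideanSpace.single j 1)

/-- The matrix of the Lie derivative of a field of bilinear forms on `ℝ^d`. -/
def lieMat (B : EuclideanSpace ℝ (Fin d) → EuclideanSpace ℝ (Fin d) →L[ℝ]
      EuclideanSpace ℝ (Fin d) →L[ℝ] ℝ)
    (X : EuclideanSpace ℝ (Fin d) → EuclideanSpace ℝ (Fin d)) (y : EuclideanSpace ℝ (Fin d)) :
    Matrix (Fin d) (Fin d) ℝ :=
  Matrix.of fun i j =>
    fderiv ℝ B y (X y) (EuclideanSpace.single i 1) (EuclideanSpace.single j 1) +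
      B y (fderiv ℝ X y (EuclideanSpace.single i 1)) (EuclideanSpace.single j 1) +
      B y (EuclideanSpace.single i 1) (fderiv ℝ X y (EuclideanSpace.single j 1))

lemma sum_smul_single (v : EuclideanSpace ℝ (Fin d)) :
    ∑ i, v i • EuclideanSpace.single i (1 : ℝ) = v := by
  ext j
  simp [Pi.single_apply]

lemma clm_apply_eq_sum {F : Type*} [NormedAddCommGroup F] [NormedSpace ℝ F]
    (L : EuclideanSpace ℝ (Fin d) →L[ℝ] F) (v : EuclideanSpace ℝ (Fin d)) :
    L v = ∑ i, v i • L (EuclideanSpace.single i 1) := by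
  conv_lhs => rw [← sum_smul_single v]
  simp

lemma fderiv_clm_apply_const {E F G : Type*} [NormedAddCommGroup E] [NormedSpace ℝ E]
    [NormedAddCommGroup F] [NormedSpace ℝ F] [NormedAddCommGroup G] [NormedSpace ℝ G]
    {B : E → F →L[ℝ] G} {y : E} (h : DifferentiableAt ℝ B y) (a : F) (v : E) :
    fderiv ℝ (fun z => B z a) y v = fderiv ℝ B y v a := by
  rw [(h.hasFDerivAt.clm_apply (hasFDerivAt_const a y)).fderiv]
  simp

/-- The derivative of the density of a metric along a vector field. -/
lemma fderiv_det_add_divg {B : EuclideanSpace ℝ (Fin d) → EuclideanSpace ℝ (Fin d) →L[ℝ]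
      EuclideanSpace ℝ (Fin d) →L[ℝ] ℝ}
    (X : EuclideanSpace ℝ (Fin d) → EuclideanSpace ℝ (Fin d)) {y : EuclideanSpace ℝ (Fin d)}
    (hB : DifferentiableAt ℝ B y) :
    fderiv ℝ (fun z => (bilinMat (B z)).det) y (X y) + 2 * ((bilinMat (B y)).det * divg X y) =
      ((bilinMat (B y)).adjugate * lieMat B X y).trace := by
  have h : ∀ i j, HasFDerivAt (fun z => bilinMat (B z) i j)
      (fderiv ℝ (fun z => bilinMat (B z) i j) y) y := by
    intro i j
    refine DifferentiableAt.hasFDerivAt ?_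
    exact (hB.clm_apply (differentiableAt_const _)).clm_apply (differentiableAt_const _)
  have h' : ∀ i j, fderiv ℝ (fun z => bilinMat (B z) i j) y (X y) =
      fderiv ℝ B y (X y) (EuclideanSpace.single i 1) (EuclideanSpace.single j 1) := by
    intro i j
    simp only [bilinMat, Matrix.of_apply]
    rw [fderiv_clm_apply_const (hB.clm_apply (differentiableAt_const _)),
      fderiv_clm_apply_const hB]
  set Q : Matrix (Fin d) (Fin d) ℝ :=
    Matrix.of fun i j => fderiv ℝ X y (EuclideanSpace.single j 1) i with hQ
  set D : Matrix (Fin d) (Fin d) ℝ := Matrix.of fun i j =>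
    fderiv ℝ B y (X y) (EuclideanSpace.single i 1) (EuclideanSpace.single j 1) with hD
  set A := bilinMat (B y) with hA
  -- `Q` is the Jacobian of `X`. Against the adjugate, each of the last two terms has trace `det A *
  -- tr Q`, and `D` gives Jacobi's formula.
  have hlie : lieMat B X y = D + Q.transpose * A + A * Q := by
    ext i j
    simp only [lieMat, Matrix.of_apply, Matrix.add_apply, Matrix.mul_apply, Matrix.transpose_apply,
      hD, hQ, hA, bilinMat]
    congr 1
    · congr 1
      rw [clm_apply_eq_sum (B y) (fderiv ℝ X y (EuclideanSpace.single i 1))]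
      simp
    · rw [clm_apply_eq_sum (B y _) (fderiv ℝ X y (EuclideanSpace.single j 1))]
      simp [mul_comm]
  have hdiv : divg X y = Q.trace := by simp [divg, Matrix.trace, hQ]
  have e1 : (A.adjugate * (Q.transpose * A)).trace = A.det * Q.trace := by
    rw [Matrix.trace_mul_comm, Matrix.mul_assoc, Matrix.mul_adjugate, Matrix.mul_smul,
      Matrix.mul_one, Matrix.trace_smul, Matrix.trace_transpose, smul_eq_mul]
  have e2 : (A.adjugate * (A * Q)).trace = A.det * Q.trace := by
    rw [← Matrix.mul_assoc, Matrix.adjugate_mul, Matrix.smul_mul, Matrix.one_mul,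
      Matrix.trace_smul, smul_eq_mul]
  have e3 : (A.adjugate * D).trace = fderiv ℝ (fun z => (bilinMat (B z)).det) y (X y) := by
    rw [(hasFDerivAt_det h).fderiv]
    simp only [sum_apply, smul_apply, smul_eq_mul, h']
    simp [Matrix.trace, Matrix.mul_apply, hD]
    rfl
  rw [hlie, Matrix.mul_add, Matrix.mul_add, Matrix.trace_add, Matrix.trace_add, e1, e2, e3, hdiv]
  ring

section Quant

set_option synthInstance.maxHeartbeats 200000

variable {E : Type*} [NormedAddCommGroup E] [NormedSpace ℝ E]

/-- The vanishing of the Lie derivative of a `1`-form along a vector field of a normed space. -/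
def LieFree (θ : E → E →L[ℝ] ℝ) (X : E → E) (y : E) : Prop :=
  ∀ w, fderiv ℝ θ y (X y) w + θ y (fderiv ℝ X y w) = 0

variable {θ : E → E →L[ℝ] ℝ} {X Y : E → E} {y : E}

/-- The identity `L_X θ = 0` differentiated along `v` with `w` frozen. This is the second-order
input for the bracket of two such fields and for the invariance of `dθ`. -/
lemma fderiv_lieFree (hθ : ContDiffAt ℝ ∞ θ y) (hX : ContDiffAt ℝ ∞ X y)
    (h : ∀ᶠ z in 𝓝 y, LieFree θ X z) (v w : E) :
    fderiv ℝ (fderiv ℝ θ) y v (X y) w + fderiv ℝ θ y (fderiv ℝ X y v) w +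
      fderiv ℝ θ y v (fderiv ℝ X y w) + θ y (fderiv ℝ (fderiv ℝ X) y v w) = 0 := by
  have h1 : (fun z => fderiv ℝ θ z (X z) w + θ z (fderiv ℝ X z w)) =ᶠ[𝓝 y] fun _ => 0 := by
    filter_upwards [h] with z hz using hz w
  have hθ' : DifferentiableAt ℝ (fderiv ℝ θ) y :=
    (hθ.fderiv_right (m := ∞) (by simp)).differentiableAt (by simp)
  have hX' : DifferentiableAt ℝ (fderiv ℝ X) y :=
    (hX.fderiv_right (m := ∞) (by simp)).differentiableAt (by simp)
  have hθd := hθ.differentiableAt (by simp)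
  have hXd := hX.differentiableAt (by simp)
  have h2 : HasFDerivAt (fun z => fderiv ℝ θ z (X z) w + θ z (fderiv ℝ X z w)) _ y :=
    ((hθ'.hasFDerivAt.clm_apply hXd.hasFDerivAt).clm_apply (hasFDerivAt_const w y)).add
    (hθd.hasFDerivAt.clm_apply (hX'.hasFDerivAt.clm_apply (hasFDerivAt_const w y)))
  have h3 := h1.fderiv_eq (𝕜 := ℝ)
  have h4 := DFunLike.congr_fun (h2.fderiv.symm.trans h3) v
  simp at h4
  linarith [h4]

/-- This is `L_[X,Y] = [L_X, L_Y]`. The differentiated identities along `Y` and `X` are subtracted;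
symmetry of second derivatives cancels `D²θ`, and the undifferentiated identities at `DY w` and `DX
w` remove the remaining products. -/
lemma LieFree.lieBracket (hθ : ContDiffAt ℝ ∞ θ y) (hX : ContDiffAt ℝ ∞ X y)
    (hY : ContDiffAt ℝ ∞ Y y) (h : ∀ᶠ z in 𝓝 y, LieFree θ X z)
    (h' : ∀ᶠ z in 𝓝 y, LieFree θ Y z) :
    LieFree θ (VectorField.lieBracket ℝ X Y) y := by
  intro w
  have hX' : DifferentiableAt ℝ (fderiv ℝ X) y :=
    (hX.fderiv_right (m := ∞) (by simp)).differentiableAt (by simp)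
  have hY' : DifferentiableAt ℝ (fderiv ℝ Y) y :=
    (hY.fderiv_right (m := ∞) (by simp)).differentiableAt (by simp)
  have hXd := hX.differentiableAt (by simp)
  have hYd := hY.differentiableAt (by simp)
  have hbr : HasFDerivAt (VectorField.lieBracket ℝ X Y) _ y :=
    (hY'.hasFDerivAt.clm_apply hXd.hasFDerivAt).sub (hX'.hasFDerivAt.clm_apply hYd.hasFDerivAt)
  have e1 := fderiv_lieFree hθ hX h (Y y) w
  have e2 := fderiv_lieFree hθ hY h' (X y) w
  have e3 := h.self_of_nhds (fderiv ℝ Y y w)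
  have e4 := h'.self_of_nhds (fderiv ℝ X y w)
  have sθ := (hθ.isSymmSndFDerivAt (by simpa using two_le_infty)) (X y) (Y y)
  have sX := (hX.isSymmSndFDerivAt (by simpa using two_le_infty)) (Y y) w
  have sY := (hY.isSymmSndFDerivAt (by simpa using two_le_infty)) (X y) w
  rw [hbr.fderiv]
  simp only [VectorField.lieBracket, map_sub, map_add, sub_apply, add_apply,
    ContinuousLinearMap.comp_apply, ContinuousLinearMap.flip_apply]
  rw [sθ] at e2
  rw [sX] at e1
  rw [sY] at e2
  linarith

/-- The form `dθ + θ ⊗ θ`. -/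
def contactBilin (θ : E → E →L[ℝ] ℝ) (z : E) : E →L[ℝ] E →L[ℝ] ℝ :=
  let D : E →L[ℝ] E →L[ℝ] ℝ := fderiv ℝ θ z
  let S : E →L[ℝ] E →L[ℝ] ℝ := (θ z).smulRight (θ z)
  D - D.flip + S

lemma contactBilin_apply (θ : E → E →L[ℝ] ℝ) (z v w : E) :
    contactBilin θ z v w = fderiv ℝ θ z v w - fderiv ℝ θ z w v + θ z v * θ z w := by
  simp [contactBilin]

lemma contDiffAt_contactBilin (hθ : ContDiffAt ℝ ∞ θ y) :
    ContDiffAt ℝ ∞ (contactBilin θ) y := by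
  have h1 := hθ.fderiv_right (m := ∞) (by simp)
  have h0 := ContinuousLinearMap.contDiff (𝕜 := ℝ) (E := E →L[ℝ] E →L[ℝ] ℝ)
    (F := E →L[ℝ] E →L[ℝ] ℝ) (n := ∞)
    (ContinuousLinearMap.flipₗᵢ ℝ E E ℝ).toContinuousLinearEquiv.toContinuousLinearMap
  have h2 : ContDiffAt ℝ ∞ (fun z => (fderiv ℝ θ z).flip) y := h0.contDiffAt.comp y h1
  exact (h1.sub h2).add (hθ.smulRight hθ)

end Quant

/-- `L_X` commutes with `d` and is a derivation of tensor products. Concretely, antisymmetrising the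
differentiated identity handles `dθ`, and the identity itself handles `θ ⊗ θ`. -/
lemma lieMat_contactBilin {θ : EuclideanSpace ℝ (Fin d) → EuclideanSpace ℝ (Fin d) →L[ℝ] ℝ}
    {X : EuclideanSpace ℝ (Fin d) → EuclideanSpace ℝ (Fin d)} {y : EuclideanSpace ℝ (Fin d)}
    (hθ : ContDiffAt ℝ ∞ θ y) (hX : ContDiffAt ℝ ∞ X y) (h : ∀ᶠ z in 𝓝 y, LieFree θ X z) :
    lieMat (contactBilin θ) X y = 0 := by
  ext i j
  simp only [lieMat, Matrix.of_apply, Matrix.zero_apply]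
  generalize EuclideanSpace.single i (1 : ℝ) = v
  generalize EuclideanSpace.single j (1 : ℝ) = w
  have hθ' : DifferentiableAt ℝ (fderiv ℝ θ) y :=
    (hθ.fderiv_right (m := ∞) (by simp)).differentiableAt (by simp)
  have hθd := hθ.differentiableAt (by simp)
  have hB := (contDiffAt_contactBilin hθ).differentiableAt (by simp)
  have e0 : fderiv ℝ (contactBilin θ) y (X y) v w =
      fderiv ℝ (fderiv ℝ θ) y (X y) v w - fderiv ℝ (fderiv ℝ θ) y (X y) w v +
        (fderiv ℝ θ y (X y) v * θ y w + θ y v * fderiv ℝ θ y (X y) w) := by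
    rw [← fderiv_clm_apply_const hB, ← fderiv_clm_apply_const
      (hB.clm_apply (differentiableAt_const _))]
    simp only [contactBilin_apply]
    have hf : ∀ a b, HasFDerivAt (fun z => fderiv ℝ θ z a b) _ y := fun a b =>
      (hθ'.hasFDerivAt.clm_apply (hasFDerivAt_const a y)).clm_apply (hasFDerivAt_const b y)
    have hg : ∀ a, HasFDerivAt (fun z => θ z a) _ y := fun a =>
      hθd.hasFDerivAt.clm_apply (hasFDerivAt_const a y)
    have hfg : HasFDerivAt (fun z => fderiv ℝ θ z v w - fderiv ℝ θ z w v + θ z v * θ z w) _ y :=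
      ((hf v w).sub (hf w v)).add ((hg v).mul (hg w))
    rw [hfg.fderiv]
    simp
    ring
  have e1 := fderiv_lieFree hθ hX h v w
  have e2 := fderiv_lieFree hθ hX h w v
  have e3 := h.self_of_nhds v
  have e4 := h.self_of_nhds w
  have sv := (hθ.isSymmSndFDerivAt (by simpa using two_le_infty)) (X y) v
  have sw := (hθ.isSymmSndFDerivAt (by simpa using two_le_infty)) (X y) w
  have sX := (hX.isSymmSndFDerivAt (by simpa using two_le_infty)) v w
  rw [e0, contactBilin_apply, contactBilin_apply, sv, sw]
  rw [sX] at e1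
  linear_combination e1 - e2 + θ y w * e3 + θ y v * e4

/-- A field that preserves `θ` is divergence free for every density that is a multiple of the
Pfaffian of `dθ + θ ⊗ θ`. -/
lemma fderiv_det_add_divg_eq_zero
    {θ : EuclideanSpace ℝ (Fin d) → EuclideanSpace ℝ (Fin d) →L[ℝ] ℝ}
    {X : EuclideanSpace ℝ (Fin d) → EuclideanSpace ℝ (Fin d)} {y : EuclideanSpace ℝ (Fin d)}
    {G : EuclideanSpace ℝ (Fin d) → EuclideanSpace ℝ (Fin d) →L[ℝ]
      EuclideanSpace ℝ (Fin d) →L[ℝ] ℝ} {c : ℝ}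
    (hG : DifferentiableAt ℝ G y)
    (hθ : ContDiffAt ℝ ∞ θ y) (hX : ContDiffAt ℝ ∞ X y) (h : ∀ᶠ z in 𝓝 y, LieFree θ X z)
    (hpos : (bilinMat (G y)).det ≠ 0)
    (hdet : ∀ᶠ z in 𝓝 y, (bilinMat (G z)).det ^ 2 = c * (bilinMat (contactBilin θ z)).det ^ 2) :
    fderiv ℝ (fun z => (bilinMat (G z)).det) y (X y) + 2 * ((bilinMat (G y)).det * divg X y) = 0 := by
  have hB := (contDiffAt_contactBilin hθ).differentiableAt (by simp)
  have e1 := fderiv_det_add_divg X hB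
  rw [lieMat_contactBilin hθ hX h, Matrix.mul_zero, Matrix.trace_zero] at e1
  have hdiff : ∀ {B : EuclideanSpace ℝ (Fin d) → EuclideanSpace ℝ (Fin d) →L[ℝ]
      EuclideanSpace ℝ (Fin d) →L[ℝ] ℝ}, DifferentiableAt ℝ B y →
      DifferentiableAt ℝ (fun z => (bilinMat (B z)).det) y := by
    intro B hB
    refine (hasFDerivAt_det fun i j => DifferentiableAt.hasFDerivAt ?_).differentiableAt
    exact (hB.clm_apply (differentiableAt_const _)).clm_apply (differentiableAt_const _)
  have e2 := DFunLike.congr_fun (Filter.EventuallyEq.fderiv_eq (𝕜 := ℝ) hdet) (X y)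
  rw [((hdiff hG).hasFDerivAt.pow 2).fderiv,
    (((hdiff hB).hasFDerivAt.pow 2).const_mul c).fderiv] at e2
  have e3 := hdet.self_of_nhds
  simp at e2
  -- The form `dθ + θ ⊗ θ` satisfies the claimed identity by `e1`. Differentiating the relation
  -- between the squares carries it over to `G`, at the price of a factor `det G`.
  have e4 : (bilinMat (G y)).det * (fderiv ℝ (fun z => (bilinMat (G z)).det) y (X y) +
      2 * ((bilinMat (G y)).det * divg X y)) = 0 := by
    linear_combination (1/2 : ℝ) * e2 + c * (bilinMat (contactBilin θ y)).det * e1 +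
      2 * divg X y * e3
  exact (mul_eq_zero.1 e4).resolve_left hpos

end Coordinates

/-! ### Riemannian submersions in coordinates. -/

section Submersion

set_option synthInstance.maxHeartbeats 200000

variable {d k : ℕ}

/-- The matrix of the pullback of a bilinear form by a linear map. -/
lemma of_apply_apply_eq_mul (B : EuclideanSpace ℝ (Fin k) →L[ℝ] EuclideanSpace ℝ (Fin k) →L[ℝ] ℝ)
    (L : EuclideanSpace ℝ (Fin d) →L[ℝ] EuclideanSpace ℝ (Fin k)) :
    (Matrix.of fun i j => B (L (EuclideanSpace.single i 1)) (L (EuclideanSpace.single j 1))) =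
      (Matrix.of fun (i : Fin k) (j : Fin d) => L (EuclideanSpace.single j 1) i).transpose *
        bilinMat B * Matrix.of fun (i : Fin k) (j : Fin d) => L (EuclideanSpace.single j 1) i := by
  ext i j
  simp only [Matrix.mul_apply, Matrix.of_apply, Matrix.transpose_apply, bilinMat]
  rw [clm_apply_eq_sum (B _) (L (EuclideanSpace.single j 1))]
  refine Finset.sum_congr rfl fun b _ => ?_
  rw [clm_apply_eq_sum B (L (EuclideanSpace.single i 1))]
  simp [mul_comm]

/-- The Lie derivative of `GM = α² θ ⊗ θ + P^* GN` along a lift `Z` of `Y`. Since `θ(Z) = 0`, `L_Z θ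
= ι_Z dθ`, which `hl` writes as `l ∘ dP`; since `Z` is `P`-related to `Y`, the other term is
`P^*(L_Y GN)`. -/
lemma lieBilin_of_submersion
    {P : EuclideanSpace ℝ (Fin d) → EuclideanSpace ℝ (Fin k)}
    {θ : EuclideanSpace ℝ (Fin d) → EuclideanSpace ℝ (Fin d) →L[ℝ] ℝ}
    {Z : EuclideanSpace ℝ (Fin d) → EuclideanSpace ℝ (Fin d)}
    {Y : EuclideanSpace ℝ (Fin k) → EuclideanSpace ℝ (Fin k)}
    {GM : EuclideanSpace ℝ (Fin d) → EuclideanSpace ℝ (Fin d) →L[ℝ]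
      EuclideanSpace ℝ (Fin d) →L[ℝ] ℝ}
    {GN : EuclideanSpace ℝ (Fin k) → EuclideanSpace ℝ (Fin k) →L[ℝ]
      EuclideanSpace ℝ (Fin k) →L[ℝ] ℝ} {α : ℝ} {y : EuclideanSpace ℝ (Fin d)}
    {l : EuclideanSpace ℝ (Fin k) →L[ℝ] ℝ}
    (hP : ContDiffAt ℝ ∞ P y) (hθ : DifferentiableAt ℝ θ y) (hZ : DifferentiableAt ℝ Z y)
    (hY : DifferentiableAt ℝ Y (P y)) (hGM : DifferentiableAt ℝ GM y)
    (hGN : DifferentiableAt ℝ GN (P y))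
    (hG : ∀ᶠ z in 𝓝 y, ∀ v w, GM z v w =
      α ^ 2 * (θ z v * θ z w) + GN (P z) (fderiv ℝ P z v) (fderiv ℝ P z w))
    (hθZ : ∀ᶠ z in 𝓝 y, θ z (Z z) = 0)
    (hPZ : ∀ᶠ z in 𝓝 y, fderiv ℝ P z (Z z) = Y (P z))
    (hl : ∀ v, fderiv ℝ θ y (Z y) v - fderiv ℝ θ y v (Z y) = l (fderiv ℝ P y v))
    (v w : EuclideanSpace ℝ (Fin d)) :
    fderiv ℝ GM y (Z y) v w + GM y (fderiv ℝ Z y v) w + GM y v (fderiv ℝ Z y w) =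
      α ^ 2 * (l (fderiv ℝ P y v) * θ y w + θ y v * l (fderiv ℝ P y w)) +
      (fderiv ℝ GN (P y) (Y (P y)) (fderiv ℝ P y v) (fderiv ℝ P y w) +
        GN (P y) (fderiv ℝ Y (P y) (fderiv ℝ P y v)) (fderiv ℝ P y w) +
        GN (P y) (fderiv ℝ P y v) (fderiv ℝ Y (P y) (fderiv ℝ P y w))) := by
  have hP' : DifferentiableAt ℝ (fderiv ℝ P) y :=
    (hP.fderiv_right (m := ∞) (by simp)).differentiableAt (by simp)
  have hPd := hP.differentiableAt (by simp)
  have e1 : fderiv ℝ GM y (Z y) v w =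
      α ^ 2 * (fderiv ℝ θ y (Z y) v * θ y w + θ y v * fderiv ℝ θ y (Z y) w) +
      (fderiv ℝ GN (P y) (Y (P y)) (fderiv ℝ P y v) (fderiv ℝ P y w) +
        GN (P y) (fderiv ℝ (fderiv ℝ P) y (Z y) v) (fderiv ℝ P y w) +
        GN (P y) (fderiv ℝ P y v) (fderiv ℝ (fderiv ℝ P) y (Z y) w)) := by
    rw [← fderiv_clm_apply_const hGM, ← fderiv_clm_apply_const
      (hGM.clm_apply (differentiableAt_const _))]
    have h1 : (fun z => GM z v w) =ᶠ[𝓝 y] fun z =>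
        α ^ 2 * (θ z v * θ z w) + GN (P z) (fderiv ℝ P z v) (fderiv ℝ P z w) := by
      filter_upwards [hG] with z hz using hz v w
    have hg : ∀ a, HasFDerivAt (fun z => θ z a) _ y := fun a =>
      hθ.hasFDerivAt.clm_apply (hasFDerivAt_const a y)
    have hp : ∀ a, HasFDerivAt (fun z => fderiv ℝ P z a) _ y := fun a =>
      hP'.hasFDerivAt.clm_apply (hasFDerivAt_const a y)
    have hn := HasFDerivAt.comp (𝕜 := ℝ) (g := GN)
      (G := EuclideanSpace ℝ (Fin k) →L[ℝ] EuclideanSpace ℝ (Fin k) →L[ℝ] ℝ) y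
      hGN.hasFDerivAt hPd.hasFDerivAt
    have h2 : HasFDerivAt (fun z => α ^ 2 * (θ z v * θ z w) +
        GN (P z) (fderiv ℝ P z v) (fderiv ℝ P z w)) _ y :=
      (((hg v).mul (hg w)).const_mul (α ^ 2)).add
        ((hn.clm_apply (hp v)).clm_apply (hp w))
    rw [h1.fderiv_eq, h2.fderiv, ← hPZ.self_of_nhds]
    simp
    ring
  have e2 : ∀ a, fderiv ℝ θ y a (Z y) + θ y (fderiv ℝ Z y a) = 0 := by
    intro a
    have h1 : HasFDerivAt (fun z => θ z (Z z)) _ y := hθ.hasFDerivAt.clm_apply hZ.hasFDerivAt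
    have h2 : (fun z => θ z (Z z)) =ᶠ[𝓝 y] fun _ => (0 : ℝ) := hθZ
    have h3 := DFunLike.congr_fun (h1.fderiv.symm.trans (h2.fderiv_eq (𝕜 := ℝ))) a
    simp at h3
    linarith
  -- The relation `dP(Z) = Y ∘ P` is differentiated, and symmetry of `D²P` puts `Z` into the first
  -- slot.
  have e3 : ∀ a, fderiv ℝ (fderiv ℝ P) y (Z y) a + fderiv ℝ P y (fderiv ℝ Z y a) =
      fderiv ℝ Y (P y) (fderiv ℝ P y a) := by
    intro a
    have h1 : HasFDerivAt (fun z => fderiv ℝ P z (Z z)) _ y :=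
      hP'.hasFDerivAt.clm_apply hZ.hasFDerivAt
    have h2 : (fun z => fderiv ℝ P z (Z z)) =ᶠ[𝓝 y] fun z => Y (P z) := hPZ
    have h4 : HasFDerivAt (fun z => Y (P z)) _ y := hY.hasFDerivAt.comp y hPd.hasFDerivAt
    have h3 := DFunLike.congr_fun
      (h1.fderiv.symm.trans ((h2.fderiv_eq (𝕜 := ℝ)).trans h4.fderiv)) a
    simp at h3
    rw [(hP.isSymmSndFDerivAt (by simpa using two_le_infty)) (Z y) a, ← h3]
    exact add_comm _ _
  rw [e1, hG.self_of_nhds, hG.self_of_nhds, ← hl, ← hl, ← e3, ← e3]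
  simp only [map_add, add_apply]
  linear_combination α ^ 2 * θ y w * e2 v + α ^ 2 * θ y v * e2 w

/-- The terms produced by `L_Z θ` are mixed, so `trace_inv_mul_of_submersion` discards them: the
fibres add nothing to the divergence of a horizontal lift. -/
lemma trace_lieMat_of_submersion
    {P : EuclideanSpace ℝ (Fin d) → EuclideanSpace ℝ (Fin k)}
    {θ : EuclideanSpace ℝ (Fin d) → EuclideanSpace ℝ (Fin d) →L[ℝ] ℝ}
    {Z : EuclideanSpace ℝ (Fin d) → EuclideanSpace ℝ (Fin d)}
    {Y : EuclideanSpace ℝ (Fin k) → EuclideanSpace ℝ (Fin k)}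
    {GM : EuclideanSpace ℝ (Fin d) → EuclideanSpace ℝ (Fin d) →L[ℝ]
      EuclideanSpace ℝ (Fin d) →L[ℝ] ℝ}
    {GN : EuclideanSpace ℝ (Fin k) → EuclideanSpace ℝ (Fin k) →L[ℝ]
      EuclideanSpace ℝ (Fin k) →L[ℝ] ℝ} {α : ℝ} {y E : EuclideanSpace ℝ (Fin d)}
    {l : EuclideanSpace ℝ (Fin k) →L[ℝ] ℝ} (hα : α ≠ 0)
    (hP : ContDiffAt ℝ ∞ P y) (hθ : DifferentiableAt ℝ θ y) (hZ : DifferentiableAt ℝ Z y)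
    (hY : DifferentiableAt ℝ Y (P y)) (hGM : DifferentiableAt ℝ GM y)
    (hGN : DifferentiableAt ℝ GN (P y))
    (hG : ∀ᶠ z in 𝓝 y, ∀ v w, GM z v w =
      α ^ 2 * (θ z v * θ z w) + GN (P z) (fderiv ℝ P z v) (fderiv ℝ P z w))
    (hθZ : ∀ᶠ z in 𝓝 y, θ z (Z z) = 0)
    (hPZ : ∀ᶠ z in 𝓝 y, fderiv ℝ P z (Z z) = Y (P z))
    (hl : ∀ v, fderiv ℝ θ y (Z y) v - fderiv ℝ θ y v (Z y) = l (fderiv ℝ P y v))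
    (hPE : fderiv ℝ P y E = 0) (hθE : θ y E = 1)
    (hker : ∀ v, fderiv ℝ P y v = 0 → v = θ y v • E)
    (hsurj : Function.Surjective (fderiv ℝ P y))
    (hdet : (bilinMat (GN (P y))).det ≠ 0) :
    ((bilinMat (GM y))⁻¹ * lieMat GM Z y).trace =
      ((bilinMat (GN (P y)))⁻¹ * lieMat GN Y (P y)).trace := by
  -- Horizontal lifts of the basis vectors: any lift is corrected by a multiple of `E`, which `P`
  -- does not see.
  have hr : ∀ i : Fin k, ∃ r, fderiv ℝ P y r = EuclideanSpace.single i 1 ∧ θ y r = 0 := by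
    intro i
    obtain ⟨r, hr⟩ := hsurj (EuclideanSpace.single i 1)
    exact ⟨r - θ y r • E, by simp [hr, hPE], by simp [hθE]⟩
  choose r hr1 hr2 using hr
  set Pm : Matrix (Fin k) (Fin d) ℝ :=
    Matrix.of fun i j => fderiv ℝ P y (EuclideanSpace.single j 1) i with hPm
  set R : Matrix (Fin d) (Fin k) ℝ := Matrix.of fun j i => r i j with hR
  set t : Fin d → ℝ := fun j => θ y (EuclideanSpace.single j 1) with ht
  have hPv : ∀ v i, fderiv ℝ P y v i = ∑ j, Pm i j * v j := by
    intro v i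
    rw [clm_apply_eq_sum (fderiv ℝ P y) v]
    simp [hPm, mul_comm]
  have hθv : ∀ v, θ y v = ∑ j, t j * v j := by
    intro v
    rw [clm_apply_eq_sum (θ y) v]
    simp [ht, mul_comm]
  have hlv : ∀ v, l v = ∑ i, l (EuclideanSpace.single i 1) * v i := by
    intro v
    rw [clm_apply_eq_sum l v]
    simp [mul_comm]
  -- A vector is the horizontal lift of its image plus its vertical part: the lift minus the vector
  -- lies in the kernel of `dP`, hence is a multiple of `E` by `hker`.
  have hRP : R * Pm + Matrix.vecMulVec E t = 1 := by
    ext a j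
    have h1 : ∑ i, Pm i j • r i + t j • E = EuclideanSpace.single j 1 := by
      have h2 := hker (∑ i, Pm i j • r i - EuclideanSpace.single j 1) (by
        rw [map_sub, map_sum]
        simp only [map_smul, hr1]
        rw [sub_eq_zero, ← sum_smul_single (fderiv ℝ P y (EuclideanSpace.single j 1))]
        rfl)
      rw [map_sub, map_sum] at h2
      simp only [map_smul, hr2, smul_zero, Finset.sum_const_zero, zero_sub, neg_smul] at h2
      rw [sub_eq_iff_eq_add] at h2
      rw [h2]
      simp [ht]
    have h3 := congrArg (fun v : EuclideanSpace ℝ (Fin d) => v a) h1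
    simp at h3
    simp [Matrix.add_apply, Matrix.mul_apply, hR, Matrix.vecMulVec, Matrix.one_apply]
    simpa [mul_comm] using h3
  refine trace_inv_mul_of_submersion (α := α) (P := Pm) (R := R) (θ := t) (E := E)
    (l := fun i => l (EuclideanSpace.single i 1)) hα ?_ ?_ ?_ ?_ hRP
    (isUnit_iff_ne_zero.2 hdet) ?_ ?_
  · ext i j
    have := congrArg (fun v : EuclideanSpace ℝ (Fin k) => v i) (hr1 j)
    simp only [hPv] at this
    simpa [Matrix.mul_apply, hR, Matrix.one_apply, Pi.single_apply] using this
  · ext i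
    have := congrArg (fun v : EuclideanSpace ℝ (Fin k) => v i) hPE
    simp only [hPv] at this
    simpa [Matrix.mulVec, dotProduct] using this
  · ext i
    have := hr2 i
    rw [hθv] at this
    simpa [Matrix.vecMul, dotProduct, hR] using this
  · rw [hθv] at hθE
    simpa [dotProduct] using hθE
  · rw [hPm, ← of_apply_apply_eq_mul]
    ext i j
    simp [bilinMat, hG.self_of_nhds, Matrix.vecMulVec, ht]
  · have h1 : lieMat GN Y (P y) = bilinMat (fderiv ℝ GN (P y) (Y (P y)) +
        (GN (P y)).comp (fderiv ℝ Y (P y)) +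
        ((ContinuousLinearMap.compL ℝ _ _ ℝ).flip (fderiv ℝ Y (P y))).comp (GN (P y))) := by
      ext i j
      simp [lieMat, bilinMat]
    rw [h1, hPm, ← of_apply_apply_eq_mul]
    ext i j
    have h2 := lieBilin_of_submersion hP hθ hZ hY hGM hGN hG hθZ hPZ hl
      (EuclideanSpace.single i 1) (EuclideanSpace.single j 1)
    simp only [lieMat, Matrix.of_apply, h2, Matrix.add_apply, Matrix.smul_apply,
      Matrix.vecMulVec_apply, ht, smul_eq_mul]
    rw [hlv (fderiv ℝ P y (EuclideanSpace.single i 1)),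
      hlv (fderiv ℝ P y (EuclideanSpace.single j 1))]
    simp [Matrix.vecMul, dotProduct]

/-- The product rule, arranged so that the bracket on the right is the left side of
`fderiv_det_add_divg`. This links densities `√det` to traces of Lie derivatives. -/
lemma sum_fderiv_sqrt_mul {Γ : EuclideanSpace ℝ (Fin d) → ℝ}
    {Y : EuclideanSpace ℝ (Fin d) → EuclideanSpace ℝ (Fin d)} {y : EuclideanSpace ℝ (Fin d)}
    (hΓ : DifferentiableAt ℝ Γ y) (hY : DifferentiableAt ℝ Y y) (hpos : 0 < Γ y) :
    ∑ i, fderiv ℝ (fun z => Real.sqrt (Γ z) * Y z i) y (EuclideanSpace.single i 1) =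
      (Real.sqrt (Γ y))⁻¹ * (1 / 2 * (fderiv ℝ Γ y (Y y) + 2 * (Γ y * divg Y y))) := by
  have hc : ∀ i, HasFDerivAt (fun z => Y z i)
      ((EuclideanSpace.proj i : EuclideanSpace ℝ (Fin d) →L[ℝ] ℝ).comp (fderiv ℝ Y y)) y :=
    fun i => (EuclideanSpace.proj i : EuclideanSpace ℝ (Fin d) →L[ℝ] ℝ).hasFDerivAt.comp y
      hY.hasFDerivAt
  have h1 : ∀ i, fderiv ℝ (fun z => Real.sqrt (Γ z) * Y z i) y (EuclideanSpace.single i 1) =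
      (1 / (2 * Real.sqrt (Γ y))) * (Y y i * fderiv ℝ Γ y (EuclideanSpace.single i 1)) +
      Real.sqrt (Γ y) * fderiv ℝ Y y (EuclideanSpace.single i 1) i := by
    intro i
    have h : HasFDerivAt (fun z => Real.sqrt (Γ z) * Y z i) _ y :=
      (hΓ.hasFDerivAt.sqrt hpos.ne').mul (hc i)
    rw [h.fderiv]
    simp
    ring
  simp_rw [h1]
  rw [Finset.sum_add_distrib, ← Finset.mul_sum, ← Finset.mul_sum, clm_apply_eq_sum _ (Y y)]
  simp only [smul_eq_mul]
  have hs := Real.sqrt_pos.2 hpos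
  rw [← divg]
  field_simp
  rw [Real.sq_sqrt hpos.le]
  ring

end Submersion

/-! ### Riemannian volume and Laplacian in charts. -/

section Volume

variable {d : ℕ} {M : Type*} [TopologicalSpace M] [ChartedSpace (EuclideanSpace ℝ (Fin d)) M]
  [IsManifold (𝓡 d) ∞ M]

/-- The determinant of the metric in the preferred chart at `x₀`. -/
def density (g : RMetric d M) (x₀ : M) (y : EuclideanSpace ℝ (Fin d)) : ℝ :=
  (bilinMat (metricInChart g x₀ y)).det

lemma metricInChart_comm (g : RMetric d M) (x₀ : M) (y v w : EuclideanSpace ℝ (Fin d)) :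
    metricInChart g x₀ y v w = metricInChart g x₀ y w v := by
  rw [metricInChart_apply, metricInChart_apply, g.symm]

lemma pull_eq_zero_iff {x₀ : M} {y : EuclideanSpace ℝ (Fin d)}
    (hy : y ∈ (extChartAt (𝓡 d) x₀).target) {v : EuclideanSpace ℝ (Fin d)} :
    pull x₀ y v = 0 ↔ v = 0 := by
  refine ⟨fun h => ?_, fun h => by rw [h, map_zero]⟩
  rw [← push_pull hy v, h, map_zero]

lemma metricInChart_pos (g : RMetric d M) {x₀ : M} {y : EuclideanSpace ℝ (Fin d)}
    (hy : y ∈ (extChartAt (𝓡 d) x₀).target) {v : EuclideanSpace ℝ (Fin d)} (hv : v ≠ 0) :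
    0 < metricInChart g x₀ y v v := by
  rw [metricInChart_apply]
  exact g.pos _ _ fun h => hv ((pull_eq_zero_iff hy).1 h)

lemma bilinMat_mulVec (B : EuclideanSpace ℝ (Fin d) →L[ℝ] EuclideanSpace ℝ (Fin d) →L[ℝ] ℝ)
    (v : EuclideanSpace ℝ (Fin d)) (i : Fin d) :
    (bilinMat B).mulVec v i = B (EuclideanSpace.single i 1) v := by
  rw [clm_apply_eq_sum (B _) v]
  simp [Matrix.mulVec, dotProduct, bilinMat, mul_comm]

lemma density_pos (g : RMetric d M) {x₀ : M} {y : EuclideanSpace ℝ (Fin d)}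
    (hy : y ∈ (extChartAt (𝓡 d) x₀).target) : 0 < density g x₀ y := by
  refine Matrix.PosDef.det_pos (Matrix.PosDef.of_dotProduct_mulVec_pos ?_ ?_)
  · ext i j
    simp only [Matrix.conjTranspose_apply, bilinMat, Matrix.of_apply, star_trivial]
    exact metricInChart_comm g x₀ y _ _
  · intro x hx
    have h1 := metricInChart_pos g hy (v := WithLp.toLp 2 x) (by
      intro h
      apply hx
      ext i
      exact congrArg (fun v : EuclideanSpace ℝ (Fin d) => v i) h)
    have h2 : star x ⬝ᵥ (bilinMat (metricInChart g x₀ y)).mulVec x =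
        metricInChart g x₀ y (WithLp.toLp 2 x) (WithLp.toLp 2 x) := by
      rw [clm_apply_eq_sum (metricInChart g x₀ y)]
      simp only [dotProduct, sum_apply, smul_apply, smul_eq_mul]
      refine Finset.sum_congr rfl fun i _ => ?_
      rw [← bilinMat_mulVec]
      rfl
    rw [h2]
    exact h1

lemma contDiffOn_density (g : RMetric d M) (x₀ : M) :
    ContDiffOn ℝ ∞ (density g x₀) (extChartAt (𝓡 d) x₀).target := by
  unfold density
  simp only [Matrix.det_apply', bilinMat, Matrix.of_apply]
  refine ContDiffOn.sum fun σ _ => contDiffOn_const.mul (contDiffOn_prod fun i _ => ?_)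
  exact ((contDiffOn_metricInChart g x₀).clm_apply contDiffOn_const).clm_apply contDiffOn_const

lemma contDiffOn_sqrt_density (g : RMetric d M) (x₀ : M) :
    ContDiffOn ℝ ∞ (fun y => Real.sqrt (density g x₀ y)) (extChartAt (𝓡 d) x₀).target :=
  (contDiffOn_density g x₀).sqrt fun _ hy => (density_pos g hy).ne'

/-- The Laplacian of `f` is half of the trace of the Lie derivative of the metric along the
gradient. -/
lemma laplacian_eq (g : RMetric d M) {f : M → ℝ} {x : M}
    {Y : EuclideanSpace ℝ (Fin d) → EuclideanSpace ℝ (Fin d)}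
    (hY : DifferentiableAt ℝ Y (extChartAt (𝓡 d) x x))
    (hYf : ∀ᶠ z in 𝓝 (extChartAt (𝓡 d) x x), ∀ w, metricInChart g x z (Y z) w =
      fderiv ℝ (fun z => f ((extChartAt (𝓡 d) x).symm z)) z w) :
    laplacian g f x = 1 / 2 * ((bilinMat (metricInChart g x (extChartAt (𝓡 d) x x)))⁻¹ *
      lieMat (metricInChart g x) Y (extChartAt (𝓡 d) x x)).trace := by
  set z₀ := extChartAt (𝓡 d) x x with hz₀
  have hz : z₀ ∈ (extChartAt (𝓡 d) x).target := mem_extChartAt_target x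
  have hpos := density_pos g hz
  have hd : DifferentiableAt ℝ (density g x) z₀ :=
    ((contDiffOn_density g x).contDiffAt ((isOpen_target x).mem_nhds hz)).differentiableAt
      (by simp)
  have hG : DifferentiableAt ℝ (metricInChart g x) z₀ :=
    ((contDiffOn_metricInChart g x).contDiffAt ((isOpen_target x).mem_nhds hz)).differentiableAt
      (by simp)
  have h1 : laplacian g f x = (Real.sqrt (density g x z₀))⁻¹ *
      ∑ i, fderiv ℝ (fun y => Real.sqrt (density g x y) *
        ∑ j, (bilinMat (metricInChart g x y))⁻¹ i j *
          fderiv ℝ (fun z => f ((extChartAt (𝓡 d) x).symm z)) y (EuclideanSpace.single j (1 : ℝ)))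
        z₀ (EuclideanSpace.single i (1 : ℝ)) := rfl
  -- The hypothesis on `Y` says that the Gram matrix sends `Y` to the coordinates of `df`, so the
  -- vector with entries `∑ j, g^{ij} ∂_j f` is `Y` itself.
  have h2 : ∀ i, (fun y => Real.sqrt (density g x y) *
        ∑ j, (bilinMat (metricInChart g x y))⁻¹ i j *
          fderiv ℝ (fun z => f ((extChartAt (𝓡 d) x).symm z)) y
            (EuclideanSpace.single j (1 : ℝ))) =ᶠ[𝓝 z₀]
      fun y => Real.sqrt (density g x y) * Y y i := by
    intro i
    filter_upwards [hYf, (isOpen_target x).mem_nhds hz] with y hy hyt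
    congr 1
    have h3 : (bilinMat (metricInChart g x y)).mulVec (Y y) = fun j =>
        fderiv ℝ (fun z => f ((extChartAt (𝓡 d) x).symm z)) y (EuclideanSpace.single j (1 : ℝ)) := by
      ext j
      rw [bilinMat_mulVec, metricInChart_comm, hy]
    have h4 : (bilinMat (metricInChart g x y))⁻¹.mulVec
        ((bilinMat (metricInChart g x y)).mulVec (Y y)) = Y y := by
      rw [Matrix.mulVec_mulVec, Matrix.nonsing_inv_mul _
        (isUnit_iff_ne_zero.2 (density_pos g hyt).ne'), Matrix.one_mulVec]
    rw [h3] at h4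
    exact congrFun h4 i
  rw [h1]
  simp_rw [fun i => (h2 i).fderiv_eq (𝕜 := ℝ)]
  rw [sum_fderiv_sqrt_mul hd hY hpos]
  have h5 := fderiv_det_add_divg Y hG
  change fderiv ℝ (density g x) z₀ (Y z₀) + 2 * (density g x z₀ * divg Y z₀) = _ at h5
  rw [h5, Matrix.inv_def, Matrix.smul_mul, Matrix.trace_smul, Ring.inverse_eq_inv']
  change _ = 1 / 2 * ((density g x z₀)⁻¹ • _)
  rw [smul_eq_mul]
  have hs := Real.sqrt_pos.2 hpos
  have h6 : (density g x z₀)⁻¹ = (Real.sqrt (density g x z₀))⁻¹ * (Real.sqrt (density g x z₀))⁻¹ := by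
    rw [← mul_inv, Real.mul_self_sqrt hpos.le]
  rw [h6]
  ring

variable [MeasurableSpace M] [BorelSpace M] {g : RMetric d M} {μ : Measure M}

/-- The definition of the volume by values on sets becomes an identity of measures, so that
integrals can be transported through the chart. -/
lemma IsRiemannianVolume.restrict_source (h : IsRiemannianVolume g μ) (x₀ : M) :
    μ.restrict (chartAt (EuclideanSpace ℝ (Fin d)) x₀).source =
      ((volume.restrict (extChartAt (𝓡 d) x₀).target).withDensity
        (fun y => ENNReal.ofReal (Real.sqrt (density g x₀ y)))).map (extChartAt (𝓡 d) x₀).symm := by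
  set e := chartAt (EuclideanSpace ℝ (Fin d)) x₀ with he
  have hm : AEMeasurable (extChartAt (𝓡 d) x₀).symm
      ((volume.restrict (extChartAt (𝓡 d) x₀).target).withDensity
        (fun y => ENNReal.ofReal (Real.sqrt (density g x₀ y)))) := by
    refine AEMeasurable.mono_ac ?_ (withDensity_absolutelyContinuous _ _)
    exact (contMDiffOn_symm x₀).continuousOn.aemeasurable (isOpen_target x₀).measurableSet
  ext A hA
  have hAe : MeasurableSet (A ∩ e.source) := hA.inter e.open_source.measurableSet
  have himg : e '' (A ∩ e.source) = (extChartAt (𝓡 d) x₀).target ∩ e.symm ⁻¹' A := by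
    ext y
    rw [extChart_target_eq]
    constructor
    · rintro ⟨x, ⟨hxA, hxs⟩, rfl⟩
      exact ⟨e.map_source hxs, by simpa [e.left_inv hxs] using hxA⟩
    · rintro ⟨hyt, hyA⟩
      exact ⟨e.symm y, ⟨hyA, e.map_target hyt⟩, e.right_inv hyt⟩
  rw [Measure.restrict_apply hA, h e (IsManifold.chart_mem_maximalAtlas x₀) _ hAe
    inter_subset_right, Measure.map_apply_of_aemeasurable hm hA, himg]
  have hA' : NullMeasurableSet ((extChartAt (𝓡 d) x₀).symm ⁻¹' A)
    ((volume.restrict (extChartAt (𝓡 d) x₀).target)) :=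
      ((contMDiffOn_symm x₀).continuousOn.aemeasurable
        (isOpen_target x₀).measurableSet).nullMeasurable hA
  rw [withDensity_apply₀ _ hA', Measure.restrict_restrict₀ hA', inter_comm]
  rfl

lemma IsRiemannianVolume.integral_eq (h : IsRiemannianVolume g μ) (x₀ : M) {u : M → ℝ}
    (hu : Continuous u) (hsupp : ∀ x, u x ≠ 0 → x ∈ (chartAt (EuclideanSpace ℝ (Fin d)) x₀).source) :
    ∫ x, u x ∂μ = ∫ y in (extChartAt (𝓡 d) x₀).target,
      Real.sqrt (density g x₀ y) * u ((extChartAt (𝓡 d) x₀).symm y) := by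
  have hm0 : AEMeasurable (fun y => ENNReal.ofReal (Real.sqrt (density g x₀ y)))
      (volume.restrict (extChartAt (𝓡 d) x₀).target) :=
    ((contDiffOn_sqrt_density g x₀).continuousOn.aemeasurable
      (isOpen_target x₀).measurableSet).ennreal_ofReal
  have hm : AEMeasurable (extChartAt (𝓡 d) x₀).symm
      ((volume.restrict (extChartAt (𝓡 d) x₀).target).withDensity
        (fun y => ENNReal.ofReal (Real.sqrt (density g x₀ y)))) := by
    refine AEMeasurable.mono_ac ?_ (withDensity_absolutelyContinuous _ _)
    exact (contMDiffOn_symm x₀).continuousOn.aemeasurable (isOpen_target x₀).measurableSet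
  rw [← setIntegral_eq_integral_of_forall_compl_eq_zero
    (s := (chartAt (EuclideanSpace ℝ (Fin d)) x₀).source) (fun x hx => by
      by_contra hne; exact hx (hsupp x hne)), h.restrict_source x₀,
    integral_map hm hu.measurable.aestronglyMeasurable,
    integral_withDensity_eq_integral_toReal_smul₀ hm0 (by simp)]
  refine integral_congr_ae (Eventually.of_forall fun y => ?_)
  simp [ENNReal.toReal_ofReal (Real.sqrt_nonneg _)]

/-- The density is continuous, hence integrable on a compact neighbourhood inside the chart. This
gives integrability of all compactly supported continuous integrands below. -/
lemma IsRiemannianVolume.isLocallyFiniteMeasure (h : IsRiemannianVolume g μ) :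
    IsLocallyFiniteMeasure μ := by
  refine ⟨fun x => ?_⟩
  set e := chartAt (EuclideanSpace ℝ (Fin d)) x with he
  have hx : e x ∈ e.target := e.map_source (mem_chart_source _ x)
  obtain ⟨K, hK, hKt, hKc⟩ := exists_compact_subset e.open_target hx |>.imp
    fun K h => (⟨h.2.1, h.2.2, h.1⟩ : _ ∧ _ ∧ IsCompact K)
  set A : Set M := e.source ∩ e ⁻¹' interior K with hA
  have hAo : IsOpen A := e.isOpen_inter_preimage isOpen_interior
  refine ⟨A, hAo.mem_nhds ⟨mem_chart_source _ x, hK⟩, ?_⟩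
  rw [h e (IsManifold.chart_mem_maximalAtlas x) A hAo.measurableSet inter_subset_left]
  refine (lintegral_mono_set (t := K) ?_).trans_lt ?_
  · rintro _ ⟨z, hz, rfl⟩
    exact interior_subset hz.2
  · have hc : ContinuousOn (fun y => Real.sqrt (density g x y)) K :=
      (contDiffOn_sqrt_density g x).continuousOn.mono (by rw [extChart_target_eq]; exact hKt)
    exact (hc.integrableOn_compact hKc).lintegral_lt_top

/-- The density is strictly positive in every preferred chart. This supplies the strict inequality
in the fundamental lemma of the calculus of variations. -/
lemma IsRiemannianVolume.isOpenPosMeasure (h : IsRiemannianVolume g μ) :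
    Measure.IsOpenPosMeasure μ := by
  refine ⟨fun U hU ⟨x, hx⟩ hμ => ?_⟩
  set e := chartAt (EuclideanSpace ℝ (Fin d)) x with he
  set A : Set M := U ∩ e.source with hA
  have hAo : IsOpen A := hU.inter e.open_source
  have h0 : μ A = 0 := measure_mono_null inter_subset_left hμ
  have himg : IsOpen (e '' A) := e.isOpen_image_of_subset_source hAo inter_subset_right
  have hsub : e '' A ⊆ (extChartAt (𝓡 d) x).target := by
    rw [extChart_target_eq]
    rintro _ ⟨z, hz, rfl⟩
    exact e.map_source hz.2
  rw [h e (IsManifold.chart_mem_maximalAtlas x) A hAo.measurableSet inter_subset_right] at h0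
  have hm : AEMeasurable (fun y => ENNReal.ofReal (Real.sqrt (density g x y)))
      (volume.restrict (e '' A)) :=
    (((contDiffOn_sqrt_density g x).continuousOn.mono hsub).aemeasurable
      himg.measurableSet).ennreal_ofReal
  have h1 := (lintegral_eq_zero_iff' hm).1 h0
  have h2 : ∀ᵐ y ∂(volume.restrict (e '' A)), False := by
    filter_upwards [h1, ae_restrict_mem himg.measurableSet] with y hy hyA
    have h3 := Real.sqrt_pos.2 (density_pos g (hsub hyA))
    simp at hy
    exact absurd hy (not_le.2 h3)
  have h3 : volume.restrict (e '' A) = 0 := by simpa using h2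
  rw [Measure.restrict_eq_zero] at h3
  exact (himg.measure_pos volume ⟨e x, x, ⟨hx, mem_chart_source _ x⟩, rfl⟩).ne' h3

end Volume

/-! ### The divergence theorem. -/

section Divergence

/-- Integration by parts against the constant function `1`. -/
lemma integral_fderiv_eq_zero {E : Type*} [NormedAddCommGroup E] [NormedSpace ℝ E]
    [FiniteDimensional ℝ E] [MeasurableSpace E] [BorelSpace E] {μ : Measure E}
    [μ.IsAddHaarMeasure] {u : E → ℝ} (hu : ContDiff ℝ 1 u) (hc : HasCompactSupport u) (v : E) :
    ∫ x, fderiv ℝ u x v ∂μ = 0 := by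
  have hc' : HasCompactSupport fun x => fderiv ℝ u x v := hc.fderiv_apply (𝕜 := ℝ) v
  have hcont : Continuous fun x => fderiv ℝ u x v :=
    (hu.continuous_fderiv one_ne_zero).clm_apply continuous_const
  have h := integral_mul_fderiv_eq_neg_fderiv_mul_of_integrable (μ := μ) (𝕜 := ℝ)
    (f := fun _ => (1 : ℝ)) (g := u) (v := v) (by simp)
    (by simpa using hcont.integrable_of_hasCompactSupport hc')
    (by simpa using hu.continuous.integrable_of_hasCompactSupport hc)
    (fun x _ => differentiableAt_const _) (fun x _ => (hu.differentiable one_ne_zero) x)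
  simpa using h

/-- A function that is smooth on an open set and vanishes off a compact subset is smooth. -/
lemma contDiff_of_eq_zero_off_compact {E F : Type*} [NormedAddCommGroup E] [NormedSpace ℝ E]
    [NormedAddCommGroup F] [NormedSpace ℝ F]
    {U K : Set E} {u : E → F} (hU : IsOpen U) (hK : IsCompact K) (hKU : K ⊆ U)
    (hu : ContDiffOn ℝ ∞ u U) (h0 : ∀ x ∉ K, u x = 0) : ContDiff ℝ ∞ u := by
  rw [contDiff_iff_contDiffAt]
  intro x
  by_cases hx : x ∈ K
  · exact hu.contDiffAt (hU.mem_nhds (hKU hx))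
  · have : u =ᶠ[𝓝 x] fun _ => 0 := by
      filter_upwards [hK.isClosed.isOpen_compl.mem_nhds hx] with z hz using h0 z hz
    exact contDiffAt_const.congr_of_eventuallyEq this

variable {d : ℕ} {M : Type*} [TopologicalSpace M] [ChartedSpace (EuclideanSpace ℝ (Fin d)) M]

lemma mdifferentiableAt_of_smooth {f : M → ℝ} (hf : ContMDiff (𝓡 d) 𝓘(ℝ, ℝ) ∞ f)
    (x : M) : MDifferentiableAt (𝓡 d) 𝓘(ℝ, ℝ) f x :=
  (hf x).mdifferentiableAt (by simp)

lemma dFun_eq_zero_of_notMem_tsupport {χ : M → ℝ} {x : M} (hx : x ∉ tsupport χ)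
    (v : TangentSpace (𝓡 d) x) : dFun χ x v = 0 := by
  have h1 : χ =ᶠ[𝓝 x] fun _ => (0 : ℝ) := notMem_tsupport_iff_eventuallyEq.1 hx
  unfold dFun
  rw [h1.mfderiv_eq, mfderiv_const]
  rfl

lemma exists_chart_point (x : M) : ∃ x₀ : M, ∃ y ∈ (extChartAt (𝓡 d) x₀).target,
    (extChartAt (𝓡 d) x₀).symm y = x := ⟨x, exists_mem_target_self x⟩

variable [IsManifold (𝓡 d) ∞ M]

lemma differentiableAt_comp_symm {u : M → ℝ} (hu : ContMDiff (𝓡 d) 𝓘(ℝ, ℝ) ∞ u) {x₀ : M}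
    {y : EuclideanSpace ℝ (Fin d)} (hy : y ∈ (extChartAt (𝓡 d) x₀).target) :
    DifferentiableAt ℝ (fun y => u ((extChartAt (𝓡 d) x₀).symm y)) y :=
  ((contDiffOn_comp_symm hu x₀).contDiffAt ((isOpen_target x₀).mem_nhds hy)).differentiableAt
    (by simp)

lemma contMDiff_dFun {f : M → ℝ} (hf : ContMDiff (𝓡 d) 𝓘(ℝ, ℝ) ∞ f) {X : VField d M}
    (hX : SmoothField X) : ContMDiff (𝓡 d) 𝓘(ℝ, ℝ) ∞ (fun x => dFun f x (X x)) := by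
  refine contMDiff_of_comp_symm fun x₀ => ?_
  have h1 := (contDiffOn_comp_symm hf x₀).fderiv_of_isOpen (m := ∞) (isOpen_target x₀) (by simp)
  refine (h1.clm_apply (smoothField_iff.1 hX x₀)).congr fun y hy => ?_
  exact (fderiv_comp_symm_field hy (mdifferentiableAt_of_smooth hf _) X).symm

lemma dFun_mul {f h : M → ℝ} (hf : ContMDiff (𝓡 d) 𝓘(ℝ, ℝ) ∞ f)
    (hh : ContMDiff (𝓡 d) 𝓘(ℝ, ℝ) ∞ h) (x : M) (v : TangentSpace (𝓡 d) x) :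
    dFun (fun x => f x * h x) x v = f x * dFun h x v + h x * dFun f x v := by
  obtain ⟨x₀, y, hy, rfl⟩ := exists_chart_point (d := d) x
  obtain ⟨w, rfl⟩ : ∃ w, pull x₀ y w = v := ⟨_, pull_push hy v⟩
  rw [← fderiv_comp_symm hy (mdifferentiableAt_of_smooth hf _),
    ← fderiv_comp_symm hy (mdifferentiableAt_of_smooth hh _),
    ← fderiv_comp_symm (f := fun x => f x * h x) hy (mdifferentiableAt_of_smooth (hf.mul hh) _)]
  have h1 : HasFDerivAt (fun y => (fun x => f x * h x) ((extChartAt (𝓡 d) x₀).symm y)) _ y :=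
    (differentiableAt_comp_symm hf hy).hasFDerivAt.mul
      (differentiableAt_comp_symm hh hy).hasFDerivAt
  rw [h1.fderiv]
  simp

lemma dFun_sum {ι : Type*} (s : Finset ι) {f : ι → M → ℝ}
    (hf : ∀ i ∈ s, ContMDiff (𝓡 d) 𝓘(ℝ, ℝ) ∞ (f i)) (x : M) (v : TangentSpace (𝓡 d) x) :
    dFun (fun x => ∑ i ∈ s, f i x) x v = ∑ i ∈ s, dFun (f i) x v := by
  obtain ⟨x₀, y, hy, rfl⟩ := exists_chart_point (d := d) x
  obtain ⟨w, rfl⟩ : ∃ w, pull x₀ y w = v := ⟨_, pull_push hy v⟩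
  rw [← fderiv_comp_symm hy (mdifferentiableAt_of_smooth (ContMDiff.sum hf) _)]
  have h1 : HasFDerivAt (fun y => (fun x => ∑ i ∈ s, f i x) ((extChartAt (𝓡 d) x₀).symm y)) _ y :=
    HasFDerivAt.fun_sum fun i hi => (differentiableAt_comp_symm (hf i hi) hy).hasFDerivAt
  rw [h1.fderiv, sum_apply]
  refine Finset.sum_congr rfl fun i hi => ?_
  rw [← fderiv_comp_symm hy (mdifferentiableAt_of_smooth (hf i hi) _)]

/-- `D` is the divergence of `X` with respect to the Riemannian volume. -/
def HasDivergence (g : RMetric d M) (X : VField d M) (D : M → ℝ) : Prop :=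
  ∀ x₀ : M, ∀ y ∈ (extChartAt (𝓡 d) x₀).target,
    fderiv ℝ (density g x₀) y (fieldInChart X x₀ y) +
      2 * (density g x₀ y * divg (fieldInChart X x₀) y) =
    2 * (density g x₀ y * D ((extChartAt (𝓡 d) x₀).symm y))

/-- The defining relation determines `D` in a chart as a quotient of smooth functions with
denominator twice the positive density. -/
lemma HasDivergence.contMDiff {g : RMetric d M} {X : VField d M} {D : M → ℝ}
    (h : HasDivergence g X D) (hX : SmoothField X) : ContMDiff (𝓡 d) 𝓘(ℝ, ℝ) ∞ D := by
  refine contMDiff_of_comp_symm fun x₀ => ?_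
  have hd := contDiffOn_density g x₀
  have hx := smoothField_iff.1 hX x₀
  have h1 := hd.fderiv_of_isOpen (m := ∞) (isOpen_target x₀) (by simp)
  have h2 := hx.fderiv_of_isOpen (m := ∞) (isOpen_target x₀) (by simp)
  have h3 : ContDiffOn ℝ ∞ (divg (fieldInChart X x₀)) (extChartAt (𝓡 d) x₀).target := by
    unfold divg
    refine ContDiffOn.sum fun i _ => ?_
    exact (EuclideanSpace.proj i : EuclideanSpace ℝ (Fin d) →L[ℝ] ℝ).contDiff.comp_contDiffOn
      (h2.clm_apply contDiffOn_const)
  refine (((h1.clm_apply hx).add ((contDiffOn_const (c := (2 : ℝ))).mul (hd.mul h3))).div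
    ((contDiffOn_const (c := (2 : ℝ))).mul hd) fun y hy => mul_ne_zero two_ne_zero (density_pos g hy).ne').congr
    fun y hy => ?_
  have := h x₀ y hy
  have hp := density_pos g hy
  simp only [Pi.div_apply]
  rw [this]
  field_simp

variable [MeasurableSpace M] [BorelSpace M] {g : RMetric d M} {μ : Measure M}

/-- The divergence theorem for a function supported in a chart. -/
lemma HasDivergence.integral_of_chart [T2Space M] {X : VField d M} {D χ : M → ℝ}
    (h : HasDivergence g X D) (hμ : IsRiemannianVolume g μ)
    (hX : SmoothField X) (hχ : ContMDiff (𝓡 d) 𝓘(ℝ, ℝ) ∞ χ) (hc : HasCompactSupport χ) (x₀ : M)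
    (hs : tsupport χ ⊆ (chartAt (EuclideanSpace ℝ (Fin d)) x₀).source) :
    ∫ x, (dFun χ x (X x) + χ x * D x) ∂μ = 0 := by
  have hD := h.contMDiff hX
  have hdχ := contMDiff_dFun hχ hX
  rw [hμ.integral_eq x₀ (u := fun x => dFun χ x (X x) + χ x * D x)
    (hdχ.continuous.add (hχ.continuous.mul hD.continuous))
    (fun x hx => hs (by
      by_contra hx'
      exact hx (by simp [dFun_eq_zero_of_notMem_tsupport hx', image_eq_zero_of_notMem_tsupport hx'])))]
  set U := (extChartAt (𝓡 d) x₀).target with hU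
  set K := extChartAt (𝓡 d) x₀ '' tsupport χ with hK
  have hKc : IsCompact K := IsCompact.image_of_continuousOn hc
    ((continuousOn_extChartAt x₀).mono (by rw [extChartAt_source]; exact hs))
  have hKU : K ⊆ U := by
    rintro _ ⟨x, hx, rfl⟩
    exact (extChartAt (𝓡 d) x₀).map_source (by rw [extChartAt_source]; exact hs hx)
  have hχ0 : ∀ y ∈ U, y ∉ K → χ ((extChartAt (𝓡 d) x₀).symm y) = 0 := by
    intro y hy hyK
    by_contra hne
    refine hyK ⟨_, subset_tsupport _ hne, (extChartAt (𝓡 d) x₀).right_inv hy⟩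
  -- `χ` in the chart, extended by zero. It vanishes off the compact set `K` inside the chart
  -- target, so it is smooth on the whole model space.
  set c : EuclideanSpace ℝ (Fin d) → ℝ :=
    U.indicator fun y => χ ((extChartAt (𝓡 d) x₀).symm y) with hcdef
  have hcU : ∀ y ∈ U, c y = χ ((extChartAt (𝓡 d) x₀).symm y) := fun y hy =>
    indicator_of_mem hy _
  have hc0 : ∀ y ∉ K, c y = 0 := by
    intro y hy
    by_cases hyU : y ∈ U
    · rw [hcU y hyU, hχ0 y hyU hy]
    · exact indicator_of_notMem hyU _
  have hcs : ContDiff ℝ ∞ c := contDiff_of_eq_zero_off_compact (isOpen_target x₀) hKc hKU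
    ((contDiffOn_comp_symm hχ x₀).congr hcU) hc0
  set W : EuclideanSpace ℝ (Fin d) → EuclideanSpace ℝ (Fin d) :=
    fun y => c y • fieldInChart X x₀ y with hW
  have hWs : ContDiff ℝ ∞ W := contDiff_of_eq_zero_off_compact (isOpen_target x₀) hKc hKU
    (hcs.contDiffOn.smul (smoothField_iff.1 hX x₀)) (fun y hy => by simp [hW, hc0 y hy])
  have hus : ∀ i, ContDiff ℝ ∞ (fun y => Real.sqrt (density g x₀ y) * W y i) := by
    intro i
    refine contDiff_of_eq_zero_off_compact (isOpen_target x₀) hKc hKU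
      ((contDiffOn_sqrt_density g x₀).mul ?_) (fun y hy => by simp [hW, hc0 y hy])
    exact ((EuclideanSpace.proj i : EuclideanSpace ℝ (Fin d) →L[ℝ] ℝ).contDiff.comp hWs).contDiffOn
  have huc : ∀ i, HasCompactSupport (fun y => Real.sqrt (density g x₀ y) * W y i) := fun i =>
    HasCompactSupport.intro hKc (fun y hy => by simp [hW, hc0 y hy])
  have hsum : ∫ y, ∑ i, fderiv ℝ (fun y => Real.sqrt (density g x₀ y) * W y i) y
      (EuclideanSpace.single i 1) = 0 := by
    rw [integral_finsetSum]
    · refine Finset.sum_eq_zero fun i _ => ?_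
      exact integral_fderiv_eq_zero ((hus i).of_le (by exact_mod_cast le_top)) (huc i) _
    · intro i _
      refine Continuous.integrable_of_hasCompactSupport ?_ ((huc i).fderiv_apply (𝕜 := ℝ) _)
      exact ((hus i).continuous_fderiv (by simp)).clm_apply continuous_const
  -- A point outside `U` has a neighbourhood that avoids `K`, where the function is identically
  -- zero.
  have hoff : ∀ y ∉ U, ∑ i, fderiv ℝ (fun y => Real.sqrt (density g x₀ y) * W y i) y
      (EuclideanSpace.single i 1) = 0 := by
    intro y hy
    refine Finset.sum_eq_zero fun i _ => ?_
    have h1 : (fun y => Real.sqrt (density g x₀ y) * W y i) =ᶠ[𝓝 y] fun _ => 0 := by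
      filter_upwards [hKc.isClosed.isOpen_compl.mem_nhds (fun h => hy (hKU h))] with z hz
      simp [hW, hc0 z hz]
    rw [h1.fderiv_eq]
    simp
  rw [← setIntegral_eq_integral_of_forall_compl_eq_zero (s := U) hoff] at hsum
  rw [← hsum]
  refine setIntegral_congr_fun (isOpen_target x₀).measurableSet fun y hy => ?_
  have hp := density_pos g hy
  have hdd : DifferentiableAt ℝ (density g x₀) y :=
    ((contDiffOn_density g x₀).contDiffAt ((isOpen_target x₀).mem_nhds hy)).differentiableAt
      (by simp)
  have hXd : DifferentiableAt ℝ (fieldInChart X x₀) y :=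
    ((smoothField_iff.1 hX x₀).contDiffAt ((isOpen_target x₀).mem_nhds hy)).differentiableAt
      (by simp)
  have hcd : DifferentiableAt ℝ c y := (hcs.differentiable (by simp)) y
  have hce : c =ᶠ[𝓝 y] fun y => χ ((extChartAt (𝓡 d) x₀).symm y) := by
    filter_upwards [(isOpen_target x₀).mem_nhds hy] with z hz using hcU z hz
  have h1 : dFun χ ((extChartAt (𝓡 d) x₀).symm y) (X ((extChartAt (𝓡 d) x₀).symm y)) =
      fderiv ℝ c y (fieldInChart X x₀ y) := by
    rw [← fderiv_comp_symm_field hy (mdifferentiableAt_of_smooth hχ _), hce.fderiv_eq]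
  have h2 : divg W y = c y * divg (fieldInChart X x₀) y + fderiv ℝ c y (fieldInChart X x₀ y) := by
    have hW' : HasFDerivAt W _ y := hcd.hasFDerivAt.smul hXd.hasFDerivAt
    rw [clm_apply_eq_sum (fderiv ℝ c y) (fieldInChart X x₀ y)]
    simp only [divg, hW'.fderiv, Finset.mul_sum, ← Finset.sum_add_distrib]
    refine Finset.sum_congr rfl fun i _ => ?_
    simp [mul_comm]
  have h3 := h x₀ y hy
  have h4 : fderiv ℝ (density g x₀) y (W y) =
      c y * fderiv ℝ (density g x₀) y (fieldInChart X x₀ y) := by simp [hW]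
  simp only
  rw [sum_fderiv_sqrt_mul hdd ((hWs.differentiable (by simp)) y) hp, h1, h2, h4, ← hcU y hy]
  have hs := Real.sqrt_pos.2 hp
  have h5 : Real.sqrt (density g x₀ y) * Real.sqrt (density g x₀ y) = density g x₀ y :=
    Real.mul_self_sqrt hp.le
  have h6 : c y * fderiv ℝ (density g x₀) y (fieldInChart X x₀ y) +
      2 * (density g x₀ y * (c y * divg (fieldInChart X x₀) y +
        fderiv ℝ c y (fieldInChart X x₀ y))) =
      2 * (Real.sqrt (density g x₀ y) * Real.sqrt (density g x₀ y)) *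
        (fderiv ℝ c y (fieldInChart X x₀ y) + c y * D ((extChartAt (𝓡 d) x₀).symm y)) := by
    rw [h5]
    linear_combination c y * h3
  rw [h6]
  field_simp

/-- The divergence theorem: the divergence is, up to sign, the formal adjoint of derivation. -/
lemma HasDivergence.integral_eq_zero [T2Space M] [SigmaCompactSpace M] {X : VField d M}
    {D χ : M → ℝ} (h : HasDivergence g X D) (hμ : IsRiemannianVolume g μ)
    (hX : SmoothField X) (hχ : ContMDiff (𝓡 d) 𝓘(ℝ, ℝ) ∞ χ) (hc : HasCompactSupport χ) :
    ∫ x, (dFun χ x (X x) + χ x * D x) ∂μ = 0 := by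
  have hD := h.contMDiff hX
  obtain ⟨ρ, hρ⟩ := SmoothPartitionOfUnity.exists_isSubordinate (𝓡 d) (s := (univ : Set M))
    isClosed_univ (fun x => (chartAt (EuclideanSpace ℝ (Fin d)) x).source)
    (fun x => (chartAt _ x).open_source) (fun x _ => mem_iUnion.2 ⟨x, mem_chart_source _ x⟩)
  -- Only finitely many members of the partition of unity meet the support of `χ`, which makes the
  -- decomposition a finite sum of functions supported in charts.
  have hfin : {i | (Function.support (ρ i) ∩ tsupport χ).Nonempty}.Finite :=
    ρ.locallyFinite.finite_nonempty_inter_compact hc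
  set s := hfin.toFinset with hs
  set χ' : M → M → ℝ := fun i x => ρ i x * χ x with hχ'
  have hsum : χ = fun x => ∑ i ∈ s, χ' i x := by
    funext x
    by_cases hx : χ x = 0
    · simp [hχ', hx]
    · have h1 : ∑ i ∈ s, ρ i x = 1 := by
        rw [← ρ.sum_eq_one (mem_univ x), finsum_eq_sum_of_support_subset]
        intro i hi
        rw [hs, hfin.coe_toFinset]
        exact ⟨x, hi, subset_tsupport _ hx⟩
      simp only [hχ', ← Finset.sum_mul, h1, one_mul]
  have hχs : ∀ i, ContMDiff (𝓡 d) 𝓘(ℝ, ℝ) ∞ (χ' i) := fun i => (ρ i).contMDiff.mul hχ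
  have hχc : ∀ i, HasCompactSupport (χ' i) := fun i => hc.mul_left
  have hint : ∀ i, Integrable (fun x => dFun (χ' i) x (X x) + χ' i x * D x) μ := by
    intro i
    have := hμ.isLocallyFiniteMeasure
    refine Continuous.integrable_of_hasCompactSupport ((contMDiff_dFun (hχs i) hX).continuous.add
      ((hχs i).continuous.mul hD.continuous)) ?_
    refine HasCompactSupport.intro (hχc i) fun x hx => ?_
    simp [dFun_eq_zero_of_notMem_tsupport hx, image_eq_zero_of_notMem_tsupport hx]
  have hd : ∀ x, dFun χ x (X x) = ∑ i ∈ s, dFun (χ' i) x (X x) := by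
    intro x
    rw [hsum]
    exact dFun_sum _ (fun i _ => hχs i) x _
  have h0 : ∀ x, dFun χ x (X x) + χ x * D x =
      ∑ i ∈ s, (dFun (χ' i) x (X x) + χ' i x * D x) := by
    intro x
    rw [Finset.sum_add_distrib, ← hd, ← Finset.sum_mul]
    congr 2
    exact congrFun hsum x
  simp_rw [h0]
  rw [integral_finsetSum _ fun i _ => hint i]
  refine Finset.sum_eq_zero fun i _ => ?_
  refine h.integral_of_chart hμ hX (hχs i) (hχc i) i ?_
  exact (tsupport_mul_subset_left).trans (hρ i)

end Divergence

/-! ### Gradients and brackets of vector fields. -/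

section Gradient

variable {d : ℕ} {M : Type*} [TopologicalSpace M] [ChartedSpace (EuclideanSpace ℝ (Fin d)) M]

lemma formInChart_contDiffAt [IsManifold (𝓡 d) ∞ M] {θ : OneForm d M} (h : SmoothForm θ) {x₀ : M}
    {y : EuclideanSpace ℝ (Fin d)} (hy : y ∈ (extChartAt (𝓡 d) x₀).target) :
    ContDiffAt ℝ ∞ (formInChart θ x₀) y :=
  (h.contDiffOn x₀).contDiffAt ((isOpen_target x₀).mem_nhds hy)

lemma SmoothField.contDiffAt [IsManifold (𝓡 d) ∞ M] {X : VField d M} (h : SmoothField X) {x₀ : M}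
    {y : EuclideanSpace ℝ (Fin d)} (hy : y ∈ (extChartAt (𝓡 d) x₀).target) :
    ContDiffAt ℝ ∞ (fieldInChart X x₀) y :=
  (smoothField_iff.1 h x₀).contDiffAt ((isOpen_target x₀).mem_nhds hy)

lemma formInChart_fieldInChart [IsManifold (𝓡 d) ∞ M] (θ : OneForm d M) {x₀ : M}
    {y : EuclideanSpace ℝ (Fin d)} (hy : y ∈ (extChartAt (𝓡 d) x₀).target) (X : VField d M) :
    formInChart θ x₀ y (fieldInChart X x₀ y) =
      θ ((extChartAt (𝓡 d) x₀).symm y) (X ((extChartAt (𝓡 d) x₀).symm y)) := by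
  rw [formInChart_apply, pull_fieldInChart hy]

lemma SmoothForm.contMDiff_apply [IsManifold (𝓡 d) ∞ M] {θ : OneForm d M} (h : SmoothForm θ)
    {X : VField d M} (hX : SmoothField X) : ContMDiff (𝓡 d) 𝓘(ℝ, ℝ) ∞ (fun x => θ x (X x)) := by
  refine contMDiff_of_comp_symm fun x₀ => ?_
  refine ((h.contDiffOn x₀).clm_apply (smoothField_iff.1 hX x₀)).congr fun y hy => ?_
  exact (formInChart_fieldInChart θ hy X).symm

lemma dForm_antisymm [IsManifold (𝓡 d) ∞ M] {θ : OneForm d M} (h : SmoothForm θ) (x : M)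
    (v w : TangentSpace (𝓡 d) x) : dForm θ x v w = -dForm θ x w v := by
  obtain ⟨x₀, y, hy, rfl⟩ := exists_chart_point (d := d) x
  rw [← pull_push hy v, ← pull_push hy w, dForm_pull h hy, dForm_pull h hy]
  ring

/-- A field preserves `θ` if and only if it does so in charts. -/
lemma lieFree_iff [IsManifold (𝓡 d) ∞ M] {θ : OneForm d M} (h : SmoothForm θ) {X : VField d M}
    (hX : SmoothField X) {x₀ : M} {y : EuclideanSpace ℝ (Fin d)}
    (hy : y ∈ (extChartAt (𝓡 d) x₀).target) :
    LieFree (formInChart θ x₀) (fieldInChart X x₀) y ↔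
      ∀ w, dForm θ ((extChartAt (𝓡 d) x₀).symm y) (X ((extChartAt (𝓡 d) x₀).symm y)) w +
        dFun (fun z => θ z (X z)) ((extChartAt (𝓡 d) x₀).symm y) w = 0 := by
  -- Cartan's formula `ι_X dθ + d(θ(X)) = L_X θ` in the chart.
  have key : ∀ w, dForm θ ((extChartAt (𝓡 d) x₀).symm y) (X ((extChartAt (𝓡 d) x₀).symm y))
      (pull x₀ y w) + dFun (fun z => θ z (X z)) ((extChartAt (𝓡 d) x₀).symm y) (pull x₀ y w) =
      fderiv ℝ (formInChart θ x₀) y (fieldInChart X x₀ y) w +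
        formInChart θ x₀ y (fderiv ℝ (fieldInChart X x₀) y w) := by
    intro w
    rw [← pull_fieldInChart hy X, dForm_pull h hy,
      ← fderiv_comp_symm hy (mdifferentiableAt_of_smooth (h.contMDiff_apply hX) _)]
    have h1 : HasFDerivAt (fun z => formInChart θ x₀ z (fieldInChart X x₀ z)) _ y :=
      ((formInChart_contDiffAt h hy).differentiableAt (by simp)).hasFDerivAt.clm_apply
        ((hX.contDiffAt hy).differentiableAt (by simp)).hasFDerivAt
    have h2 : (fun y => (fun z => θ z (X z)) ((extChartAt (𝓡 d) x₀).symm y)) =ᶠ[𝓝 y]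
        fun z => formInChart θ x₀ z (fieldInChart X x₀ z) := by
      filter_upwards [(isOpen_target x₀).mem_nhds hy] with z hz
      exact (formInChart_fieldInChart θ hz X).symm
    rw [h2.fderiv_eq, h1.fderiv]
    simp
  constructor
  · intro hL w
    rw [← pull_push hy w, key]
    exact hL _
  · intro hL w
    rw [← key]
    exact hL _

/-- The gradient of a function. -/
def grad [IsManifold (𝓡 d) ∞ M] (g : RMetric d M) (f : M → ℝ) : VField d M := fun x =>
  Classical.epsilon fun u : TangentSpace (𝓡 d) x => ∀ w, g.inner x u w = dFun f x w

variable [IsManifold (𝓡 d) ∞ M]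

lemma eq_zero_of_inner_self (g : RMetric d M) {x : M} {v : TangentSpace (𝓡 d) x}
    (h : g.inner x v v = 0) : v = 0 := by
  by_contra hv
  exact (g.pos x v hv).ne' h

lemma exists_inner_eq (g : RMetric d M) (x : M) (l : TangentSpace (𝓡 d) x →L[ℝ] ℝ) :
    ∃ u, ∀ w, g.inner x u w = l w := by
  have : FiniteDimensional ℝ (TangentSpace (𝓡 d) x) :=
    inferInstanceAs (FiniteDimensional ℝ (EuclideanSpace ℝ (Fin d)))
  let A : TangentSpace (𝓡 d) x →ₗ[ℝ] Module.Dual ℝ (TangentSpace (𝓡 d) x) :=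
    { toFun := fun u => (g.inner x u).toLinearMap
      map_add' := fun u v => by ext w; simp
      map_smul' := fun c u => by ext w; simp }
  have hinj : Function.Injective A := by
    refine (injective_iff_map_eq_zero A).2 fun u hu => eq_zero_of_inner_self g ?_
    exact DFunLike.congr_fun hu u
  obtain ⟨u, hu⟩ := (LinearMap.injective_iff_surjective_of_finrank_eq_finrank
    (Subspace.dual_finrank_eq (K := ℝ) (V := TangentSpace (𝓡 d) x)).symm).1 hinj l.toLinearMap
  exact ⟨u, fun w => DFunLike.congr_fun hu w⟩

lemma inner_grad (g : RMetric d M) (f : M → ℝ) (x : M) (w : TangentSpace (𝓡 d) x) :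
    g.inner x (grad g f x) w = dFun f x w :=
  Classical.epsilon_spec (p := fun u : TangentSpace (𝓡 d) x => ∀ w, g.inner x u w = dFun f x w)
    (exists_inner_eq g x (dFun f x)) w

lemma metricInChart_grad (g : RMetric d M) {f : M → ℝ} (hf : ContMDiff (𝓡 d) 𝓘(ℝ, ℝ) ∞ f)
    {x₀ : M} {y : EuclideanSpace ℝ (Fin d)} (hy : y ∈ (extChartAt (𝓡 d) x₀).target)
    (w : EuclideanSpace ℝ (Fin d)) :
    metricInChart g x₀ y (fieldInChart (grad g f) x₀ y) w =
      fderiv ℝ (fun z => f ((extChartAt (𝓡 d) x₀).symm z)) y w := by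
  rw [metricInChart_apply, pull_fieldInChart hy, inner_grad,
    fderiv_comp_symm hy (mdifferentiableAt_of_smooth hf _)]

/-- The gradient is chosen point by point, but in a chart it solves a linear system with smooth
injective coefficients, and such solutions are smooth. -/
lemma smoothField_grad (g : RMetric d M) {f : M → ℝ} (hf : ContMDiff (𝓡 d) 𝓘(ℝ, ℝ) ∞ f) :
    SmoothField (grad g f) := by
  refine smoothField_iff.2 fun x₀ => ?_
  refine contDiffOn_of_clm_apply_eq (contDiffOn_metricInChart g x₀)
    ((contDiffOn_comp_symm hf x₀).fderiv_of_isOpen (m := ∞) (isOpen_target x₀) (by simp)) ?_ ?_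
  · intro y hy v hv
    by_contra hne
    have := metricInChart_pos g hy hne
    rw [hv] at this
    simp at this
  · intro y hy
    ext w
    exact metricInChart_grad g hf hy w

lemma laplacian_eq_grad (g : RMetric d M) {f : M → ℝ} (hf : ContMDiff (𝓡 d) 𝓘(ℝ, ℝ) ∞ f) (x : M) :
    laplacian g f x = 1 / 2 * ((bilinMat (metricInChart g x (extChartAt (𝓡 d) x x)))⁻¹ *
      lieMat (metricInChart g x) (fieldInChart (grad g f) x) (extChartAt (𝓡 d) x x)).trace := by
  have hx : extChartAt (𝓡 d) x x ∈ (extChartAt (𝓡 d) x).target := mem_extChartAt_target x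
  refine laplacian_eq g (((smoothField_grad g hf).contDiffAt hx).differentiableAt (by simp)) ?_
  filter_upwards [(isOpen_target x).mem_nhds hx] with z hz w using metricInChart_grad g hf hz w

/-- The bracket of vector fields, computed in the preferred chart at the point. -/
lemma mlieBracket_eq_pull (X Y : VField d M) (x : M) :
    push x x (VectorField.mlieBracket (𝓡 d) X Y x) =
      VectorField.lieBracket ℝ (fieldInChart X x) (fieldInChart Y x) (extChartAt (𝓡 d) x x) := by
  have hx : extChartAt (𝓡 d) x x ∈ (extChartAt (𝓡 d) x).target := mem_extChartAt_target x
  have hpb : ∀ Z : VField d M, VectorField.mpullbackWithin 𝓘(ℝ, EuclideanSpace ℝ (Fin d)) (𝓡 d)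
      (extChartAt (𝓡 d) x).symm Z (range (𝓡 d)) =ᶠ[𝓝 (extChartAt (𝓡 d) x x)]
      fieldInChart Z x := by
    intro Z
    filter_upwards [(isOpen_target x).mem_nhds hx] with z hz
    rw [VectorField.mpullbackWithin_apply, ← pull_eq, fieldInChart]
    have : (pull x z).inverse = push x ((extChartAt (𝓡 d) x).symm z) :=
      ContinuousLinearMap.inverse_eq (by ext v : 1; exact pull_push hz v)
        (by ext v : 1; exact push_pull hz v)
    exact DFunLike.congr_fun this _
  have hinv : ∀ v : EuclideanSpace ℝ (Fin d), push x x ((push x x).inverse v) = v := by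
    intro v
    have h1 : (push (d := d) x x).IsInvertible := isInvertible_mfderiv_extChartAt
      (mem_extChartAt_source x)
    exact h1.self_apply_inverse v
  rw [← VectorField.mlieBracketWithin_univ, VectorField.mlieBracketWithin_apply]
  refine (hinv _).trans ?_
  rw [preimage_univ, univ_inter, ModelWithCorners.range_eq_univ]
  refine (congrFun (VectorField.lieBracketWithin_univ (𝕜 := ℝ)
    (E := EuclideanSpace ℝ (Fin d))) _).trans ?_
  have h2 := hpb X
  have h3 := hpb Y
  rw [ModelWithCorners.range_eq_univ] at h2 h3
  exact Filter.EventuallyEq.lieBracket_vectorField_eq (𝕜 := ℝ)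
    (E := EuclideanSpace ℝ (Fin d)) h2 h3

/-- The bracket is taken at the image of `y` rather than at `x`, so that its type is that of `pull x
y`; `y` is a variable so that it can be generalised afterwards. -/
lemma mlieBracket_symm (X Y : VField d M) (x : M) {y : EuclideanSpace ℝ (Fin d)}
    (hy : y = extChartAt (𝓡 d) x x) :
    VectorField.mlieBracket (𝓡 d) X Y ((extChartAt (𝓡 d) x).symm y) =
      pull x y (VectorField.lieBracket ℝ (fieldInChart X x) (fieldInChart Y x) y) := by
  have hyt : y ∈ (extChartAt (𝓡 d) x).target := hy ▸ mem_extChartAt_target x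
  have hx : (extChartAt (𝓡 d) x).symm y = x := by rw [hy]; exact extChartAt_to_inv x
  rw [← pull_push hyt (VectorField.mlieBracket (𝓡 d) X Y ((extChartAt (𝓡 d) x).symm y))]
  refine congrArg (pull x y) ?_
  have h : ∀ p, p = x → push x p (VectorField.mlieBracket (𝓡 d) X Y p) =
      push x x (VectorField.mlieBracket (𝓡 d) X Y x) := by rintro _ rfl; rfl
  rw [h _ hx, mlieBracket_eq_pull, hy]

/-- Leibniz: `X(θ(Y)) = (L_X θ)(Y) + θ([X, Y])`, and the first term vanishes. -/
lemma LieFree.apply_lieBracket {θ : EuclideanSpace ℝ (Fin d) → EuclideanSpace ℝ (Fin d) →L[ℝ] ℝ}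
    {X Y : EuclideanSpace ℝ (Fin d) → EuclideanSpace ℝ (Fin d)} {y : EuclideanSpace ℝ (Fin d)}
    (h : LieFree θ X y) (hθ : DifferentiableAt ℝ θ y) (hY : DifferentiableAt ℝ Y y) :
    θ y (VectorField.lieBracket ℝ X Y y) = fderiv ℝ (fun z => θ z (Y z)) y (X y) := by
  have h1 : HasFDerivAt (fun z => θ z (Y z)) _ y := hθ.hasFDerivAt.clm_apply hY.hasFDerivAt
  rw [h1.fderiv, VectorField.lieBracket]
  have := h (Y y)
  simp
  linarith

end Gradient

/-! ### Contact fields: existence, smoothness, volume, brackets. -/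

section ContactGeometry

/-- `B = G L` gives `det B = det G * det L`, and `L² = -(1 - k e ⊗ θ)` has determinant `k - 1` in
odd dimension. Only `L²` is known, and with squares the sign of `det L` never matters. -/
lemma det_bilinMat_sq {d : ℕ} (hd : Odd d)
    {G B : EuclideanSpace ℝ (Fin d) →L[ℝ] EuclideanSpace ℝ (Fin d) →L[ℝ] ℝ}
    {L : EuclideanSpace ℝ (Fin d) →ₗ[ℝ] EuclideanSpace ℝ (Fin d)}
    {θ : EuclideanSpace ℝ (Fin d) →L[ℝ] ℝ} {e : EuclideanSpace ℝ (Fin d)} {k : ℝ}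
    (hB : ∀ v w, B v w = G v (L w)) (hL : ∀ w, L (L w) = -w + (k * θ w) • e) (hθ : θ e = 1) :
    (bilinMat B).det ^ 2 = (k - 1) * (bilinMat G).det ^ 2 := by
  set Lm : Matrix (Fin d) (Fin d) ℝ := Matrix.of fun i j => L (EuclideanSpace.single j 1) i with hLm
  set t : Fin d → ℝ := fun j => θ (EuclideanSpace.single j 1) with ht
  have h1 : bilinMat B = bilinMat G * Lm := by
    ext i j
    rw [Matrix.mul_apply]
    simp only [bilinMat, Matrix.of_apply, hB]
    rw [clm_apply_eq_sum (G _) (L _)]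
    simp [hLm, mul_comm]
  have h2 : Lm * Lm = -(1 + Matrix.vecMulVec (fun i => -k * e i) t) := by
    ext i j
    have h3 : ∀ v, L v i = ∑ a, Lm i a * v a := by
      intro v
      have h4 := congrArg (fun z : EuclideanSpace ℝ (Fin d) => z i)
        (clm_apply_eq_sum (LinearMap.toContinuousLinearMap L) v)
      simpa [hLm, mul_comm] using h4
    have h5 := congrArg (fun z : EuclideanSpace ℝ (Fin d) => z i) (hL (EuclideanSpace.single j 1))
    simp only at h5
    rw [h3] at h5
    rw [Matrix.mul_apply]
    refine Eq.trans ?_ (h5.trans ?_)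
    · simp [hLm]
    · by_cases hij : i = j
      · subst hij
        simp [Matrix.vecMulVec, ht]
        ring
      · simp [Matrix.vecMulVec, ht, hij]
        ring
  have h3 : Lm.det ^ 2 = k - 1 := by
    rw [sq, ← Matrix.det_mul, h2, Matrix.det_neg, Fintype.card_fin, hd.neg_one_pow,
      Matrix.vecMulVec_eq Unit, Matrix.det_one_add_replicateCol_mul_replicateRow]
    have h4 : ∑ j, t j * e j = 1 := by
      rw [← hθ, clm_apply_eq_sum θ e]
      simp [ht, mul_comm]
    have h5 : t ⬝ᵥ (fun i => -k * e i) = -k := by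
      rw [dotProduct]
      calc ∑ i, t i * (-k * e i) = -k * ∑ i, t i * e i := by
            rw [Finset.mul_sum]; exact Finset.sum_congr rfl fun i _ => by ring
        _ = -k := by rw [h4, mul_one]
    rw [h5]
    ring
  rw [h1, Matrix.det_mul, mul_pow, h3]
  ring

variable {n : ℕ} {M N : Type*}
  [TopologicalSpace M] [ChartedSpace (EuclideanSpace ℝ (Fin (2 * n + 1))) M]
  [IsManifold (𝓡 (2 * n + 1)) ∞ M]
  [TopologicalSpace N] [ChartedSpace (EuclideanSpace ℝ (Fin (2 * n))) N]
  [IsManifold (𝓡 (2 * n)) ∞ N] (D : BoothbyWang n M N)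

namespace BoothbyWang

/-- The `(1,1)`-tensor of the associated metric. -/
def phi (x : M) : TangentSpace (𝓡 (2 * n + 1)) x →L[ℝ] TangentSpace (𝓡 (2 * n + 1)) x :=
  D.associated.2.choose x

lemma phi_phi (x : M) (u : TangentSpace (𝓡 (2 * n + 1)) x) :
    D.phi x (D.phi x u) = -u + D.θ x u • D.reeb x := D.associated.2.choose_spec.1 x u

lemma dForm_eq (x : M) (u v : TangentSpace (𝓡 (2 * n + 1)) x) :
    dForm D.θ x u v = D.gM.inner x u (D.phi x v) := D.associated.2.choose_spec.2 x u v

lemma inner_reeb (x : M) (u : TangentSpace (𝓡 (2 * n + 1)) x) :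
    D.gM.inner x u (D.reeb x) = D.α ^ 2 * D.θ x u := (D.associated.1 x u).symm

lemma smoothForm : SmoothForm D.θ := D.contact.1

lemma θ_reeb (x : M) : D.θ x (D.reeb x) = 1 := (D.isReeb.2 x).1

lemma dForm_reeb (x : M) (w : TangentSpace (𝓡 (2 * n + 1)) x) : dForm D.θ x (D.reeb x) w = 0 :=
  (D.isReeb.2 x).2 w

lemma dForm_reeb_right (x : M) (w : TangentSpace (𝓡 (2 * n + 1)) x) :
    dForm D.θ x w (D.reeb x) = 0 := by
  rw [dForm_antisymm D.smoothForm, D.dForm_reeb, neg_zero]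

lemma α_sq_pos : 0 < D.α ^ 2 := pow_pos D.α_pos 2

lemma inner_phi_left (x : M) (u v : TangentSpace (𝓡 (2 * n + 1)) x) :
    D.gM.inner x (D.phi x u) v = -D.gM.inner x u (D.phi x v) := by
  rw [D.gM.symm, ← D.dForm_eq, ← D.dForm_eq, dForm_antisymm D.smoothForm]

lemma phi_reeb (x : M) : D.phi x (D.reeb x) = 0 := by
  refine eq_zero_of_inner_self D.gM ?_
  rw [D.inner_phi_left, ← D.dForm_eq, D.dForm_reeb, neg_zero]

lemma θ_phi (x : M) (u : TangentSpace (𝓡 (2 * n + 1)) x) : D.θ x (D.phi x u) = 0 := by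
  have h := D.inner_reeb x (D.phi x u)
  rw [D.inner_phi_left, D.phi_reeb, map_zero, neg_zero] at h
  exact (mul_eq_zero.1 h.symm).resolve_left D.α_sq_pos.ne'

lemma inner_phi_phi (x : M) (u v : TangentSpace (𝓡 (2 * n + 1)) x) :
    D.gM.inner x (D.phi x u) (D.phi x v) = D.gM.inner x u v - D.α ^ 2 * D.θ x u * D.θ x v := by
  rw [D.inner_phi_left, D.phi_phi, map_add, map_neg, map_smul, D.inner_reeb, smul_eq_mul]
  ring

/-- Nondegeneracy of `dθ` on the kernel of `θ`: the test vector `φ u` gives `dθ(u, φ u) = -⟨u, u⟩`.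
-/
lemma eq_zero_of_dForm {x : M} {u : TangentSpace (𝓡 (2 * n + 1)) x} (h : D.θ x u = 0)
    (h' : ∀ w, dForm D.θ x u w = 0) : u = 0 := by
  refine eq_zero_of_inner_self D.gM ?_
  have h1 := h' (D.phi x u)
  rw [D.dForm_eq, D.phi_phi, h, zero_smul, add_zero, map_neg] at h1
  linarith

lemma eq_of_dForm {x : M} {u v : TangentSpace (𝓡 (2 * n + 1)) x} (h : D.θ x u = D.θ x v)
    (h' : ∀ w, dForm D.θ x u w = dForm D.θ x v w) : u = v := by
  rw [← sub_eq_zero]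
  refine D.eq_zero_of_dForm (by rw [map_sub, h, sub_self]) fun w => ?_
  have := h' w
  simp only [D.dForm_eq] at this ⊢
  rw [map_sub, sub_apply, this, sub_self]

/-- The contact field of a function on `M`. -/
abbrev S (F : M → ℝ) : VField (2 * n + 1) M := contactField D.θ D.reeb F

lemma contactField_spec (F : M → ℝ) (x : M) : D.θ x (D.S F x) = F x ∧
    ∀ w, dForm D.θ x (D.S F x) w = dFun F x (D.reeb x) * D.θ x w - dFun F x w := by
  -- The witness is `F E - φ (grad F)`. Indeed `⟨φ u, φ w⟩ = ⟨u, w⟩ - α² θ(u) θ(w)`, and `α² θ(grad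
  -- F) = E(F)`.
  refine Classical.epsilon_spec (p := fun u : TangentSpace (𝓡 (2 * n + 1)) x =>
    D.θ x u = F x ∧ ∀ w, dForm D.θ x u w = dFun F x (D.reeb x) * D.θ x w - dFun F x w)
    ⟨F x • D.reeb x - D.phi x (grad D.gM F x), ?_, fun w => ?_⟩
  · rw [map_sub, map_smul, D.θ_phi, D.θ_reeb]; simp
  · rw [D.dForm_eq, map_sub, sub_apply, map_smul, smul_apply, ← D.dForm_eq, D.dForm_reeb,
      D.inner_phi_phi, inner_grad, mul_assoc, ← mul_assoc, ← D.inner_reeb, inner_grad]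
    simp

lemma S_unique {F : M → ℝ} {x : M} {u : TangentSpace (𝓡 (2 * n + 1)) x} (h : D.θ x u = F x)
    (h' : ∀ w, dForm D.θ x u w = dFun F x (D.reeb x) * D.θ x w - dFun F x w) : u = D.S F x :=
  D.eq_of_dForm (h.trans (D.contactField_spec F x).1.symm)
    fun w => (h' w).trans ((D.contactField_spec F x).2 w).symm

lemma S_eq (F : M → ℝ) (x : M) : D.S F x = F x • D.reeb x - D.phi x (grad D.gM F x) := by
  refine (D.S_unique ?_ fun w => ?_).symm
  · rw [map_sub, map_smul, D.θ_phi, D.θ_reeb]; simp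
  · rw [D.dForm_eq, map_sub, sub_apply, map_smul, smul_apply, ← D.dForm_eq, D.dForm_reeb,
      D.inner_phi_phi, inner_grad, mul_assoc, ← mul_assoc, ← D.inner_reeb, inner_grad]
    simp

lemma θ_S (F : M → ℝ) (x : M) : D.θ x (D.S F x) = F x := (D.contactField_spec F x).1

/-- Smooth functions that are constant along the Reeb orbits. -/
structure Invariant (F : M → ℝ) : Prop where
  smooth : ContMDiff (𝓡 (2 * n + 1)) 𝓘(ℝ, ℝ) ∞ F
  reeb : ∀ x, dFun F x (D.reeb x) = 0

variable {D}

namespace Invariant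

variable {F G : M → ℝ} (hF : D.Invariant F) (hG : D.Invariant G)
include hF

lemma dForm_S (x : M) (w : TangentSpace (𝓡 (2 * n + 1)) x) :
    dForm D.θ x (D.S F x) w = -dFun F x w := by
  rw [(D.contactField_spec F x).2, hF.reeb]; ring

lemma θ_grad (x : M) : D.θ x (grad D.gM F x) = 0 := by
  have h := D.inner_reeb x (grad D.gM F x)
  rw [inner_grad, hF.reeb] at h
  exact (mul_eq_zero.1 h.symm).resolve_left D.α_sq_pos.ne'

/-- The vertical part `F E` is orthogonal to the part `φ (grad F)`, `E` has length `α`, and `φ` is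
an isometry on the kernel of `θ`, which contains `grad F`. -/
lemma inner_S (x : M) : D.gM.inner x (D.S F x) (D.S G x) =
    D.α ^ 2 * (F x * G x) + dFun G x (grad D.gM F x) := by
  rw [D.S_eq, D.S_eq]
  simp only [map_sub, sub_apply, map_smul, smul_apply, D.inner_phi_phi, D.inner_reeb,
    D.θ_reeb, D.θ_phi, hF.θ_grad, smul_eq_mul]
  rw [D.gM.symm x (grad D.gM F x), inner_grad, ← D.dForm_eq, D.dForm_reeb]
  ring

lemma formInChart_S {x₀ : M} {y : EuclideanSpace ℝ (Fin (2 * n + 1))}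
    (hy : y ∈ (extChartAt (𝓡 (2 * n + 1)) x₀).target) (w : EuclideanSpace ℝ (Fin (2 * n + 1))) :
    contactBilin (formInChart D.θ x₀) y (fieldInChart (D.S F) x₀ y) w =
      F ((extChartAt (𝓡 (2 * n + 1)) x₀).symm y) * formInChart D.θ x₀ y w -
        fderiv ℝ (fun z => F ((extChartAt (𝓡 (2 * n + 1)) x₀).symm z)) y w := by
  rw [contactBilin_apply, ← dForm_pull D.smoothForm hy, pull_fieldInChart hy, hF.dForm_S,
    formInChart_fieldInChart D.θ hy, D.θ_S, fderiv_comp_symm hy (mdifferentiableAt_of_smooth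
      hF.smooth _)]
  ring

/-- Adding `θ ⊗ θ` to `dθ` merges the two conditions on `S F` into one linear system `(dθ + θ ⊗
θ)(u, ·) = F θ - dF` with smooth injective coefficients. -/
lemma smoothField_S : SmoothField (D.S F) := by
  refine smoothField_iff.2 fun x₀ => ?_
  have h1 := contDiffOn_comp_symm hF.smooth x₀
  refine contDiffOn_of_clm_apply_eq (A := contactBilin (formInChart D.θ x₀))
    (b := fun y => F ((extChartAt (𝓡 (2 * n + 1)) x₀).symm y) • formInChart D.θ x₀ y -
      fderiv ℝ (fun z => F ((extChartAt (𝓡 (2 * n + 1)) x₀).symm z)) y)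
    (fun y hy => (contDiffAt_contactBilin
      (formInChart_contDiffAt D.smoothForm hy)).contDiffWithinAt)
    ((h1.smul (D.smoothForm.contDiffOn x₀)).sub
      (h1.fderiv_of_isOpen (m := ∞) (isOpen_target x₀) (by simp))) ?_ ?_
  · intro y hy v hv
    have h2 : ∀ w, dForm D.θ ((extChartAt (𝓡 (2 * n + 1)) x₀).symm y) (pull x₀ y v)
        (pull x₀ y w) + D.θ _ (pull x₀ y v) * D.θ _ (pull x₀ y w) = 0 := by
      intro w
      have := DFunLike.congr_fun hv w
      rw [contactBilin_apply, ← dForm_pull D.smoothForm hy] at this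
      exact this
    have h3 : ∀ w, dForm D.θ ((extChartAt (𝓡 (2 * n + 1)) x₀).symm y) (pull x₀ y v) w +
        D.θ _ (pull x₀ y v) * D.θ _ w = 0 := by
      intro w
      rw [← pull_push hy w]
      exact h2 _
    -- Pairing with `E` isolates `θ(v) = 0`; what remains is `dθ(v, ·) = 0`.
    have h4 := h3 (D.reeb _)
    rw [D.dForm_reeb_right, D.θ_reeb, zero_add, mul_one] at h4
    rw [← pull_eq_zero_iff hy]
    refine D.eq_zero_of_dForm h4 fun w => ?_
    have := h3 w
    rwa [h4, zero_mul, add_zero] at this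
  · intro y hy
    ext w
    rw [hF.formInChart_S hy]
    simp

lemma isQuantField : IsQuantField D.θ (D.S F) := by
  refine ⟨hF.smoothField_S, fun x w => ?_⟩
  have : (fun y => D.θ y (D.S F y)) = F := funext fun y => D.θ_S F y
  rw [this, hF.dForm_S]
  ring

end Invariant

lemma _root_.QuantExt.IsQuantField.invariant {X : VField (2 * n + 1) M}
    (hX : IsQuantField D.θ X) : D.Invariant (fun x => D.θ x (X x)) := by
  refine ⟨D.smoothForm.contMDiff_apply hX.1, fun x => ?_⟩
  have := hX.2 x (D.reeb x)
  rwa [D.dForm_reeb_right, zero_add] at this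

lemma _root_.QuantExt.IsQuantField.eq_S {X : VField (2 * n + 1) M} (hX : IsQuantField D.θ X) :
    X = D.S (fun x => D.θ x (X x)) := by
  funext x
  refine D.S_unique rfl fun w => ?_
  rw [hX.invariant.reeb]
  linarith [hX.2 x w]

lemma _root_.QuantExt.IsQuantField.lieFree {X : VField (2 * n + 1) M} (hX : IsQuantField D.θ X)
    {x₀ : M} {y : EuclideanSpace ℝ (Fin (2 * n + 1))}
    (hy : y ∈ (extChartAt (𝓡 (2 * n + 1)) x₀).target) :
    ∀ᶠ z in 𝓝 y, LieFree (formInChart D.θ x₀) (fieldInChart X x₀) z := by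
  filter_upwards [(isOpen_target x₀).mem_nhds hy] with z hz
  exact (lieFree_iff D.smoothForm hX.1 hz).2 (hX.2 _)

/-- Contact fields preserve the Riemannian volume. -/
lemma _root_.QuantExt.IsQuantField.hasDivergence {X : VField (2 * n + 1) M}
    (hX : IsQuantField D.θ X) : HasDivergence D.gM X (fun _ => 0) := by
  intro x₀ y hy
  rw [mul_zero, mul_zero]
  refine fderiv_det_add_divg_eq_zero (c := D.α ^ 4) (θ := formInChart D.θ x₀)
    (((contDiffOn_metricInChart D.gM x₀).contDiffAt
      ((isOpen_target x₀).mem_nhds hy)).differentiableAt (by simp))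
    (formInChart_contDiffAt D.smoothForm hy) (hX.1.contDiffAt hy) (hX.lieFree hy)
    (density_pos D.gM hy).ne' ?_
  filter_upwards [(isOpen_target x₀).mem_nhds hy] with z hz
  have hα := D.α_pos
  let x := (extChartAt (𝓡 (2 * n + 1)) x₀).symm z
  -- `L = φ + α⁻² θ ⊗ E` represents `dθ + θ ⊗ θ` in the metric, and `L² = -1 + (1 + α⁻⁴) θ ⊗ E`.
  -- Hence `k = 1 + α⁻⁴`, and the ratio of squared determinants is `c = α⁴`.
  let L : EuclideanSpace ℝ (Fin (2 * n + 1)) →ₗ[ℝ] EuclideanSpace ℝ (Fin (2 * n + 1)) :=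
    { toFun := fun w => push x₀ x (D.phi x (pull x₀ z w) +
        ((D.α ^ 2)⁻¹ * D.θ x (pull x₀ z w)) • D.reeb x)
      map_add' := fun u v => by
        simp only [map_add, map_smul, mul_add, add_smul]; abel
      map_smul' := fun c u => by
        simp only [map_add, map_smul, smul_add, smul_eq_mul, RingHom.id_apply, smul_smul]
        congr 2; ring }
  have hpL : ∀ w, pull x₀ z (L w) = D.phi x (pull x₀ z w) +
        ((D.α ^ 2)⁻¹ * D.θ x (pull x₀ z w)) • D.reeb x := fun w => pull_push hz _
  have h := det_bilinMat_sq (d := 2 * n + 1) ⟨n, rfl⟩ (G := metricInChart D.gM x₀ z)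
    (B := contactBilin (formInChart D.θ x₀) z) (L := L) (θ := formInChart D.θ x₀ z)
    (e := fieldInChart D.reeb x₀ z) (k := 1 + ((D.α ^ 2)⁻¹) ^ 2) ?_ ?_ ?_
  · rw [h]
    field_simp
    ring
  · intro v w
    rw [contactBilin_apply, ← dForm_pull D.smoothForm hz, metricInChart_apply, hpL, map_add,
      map_smul, D.inner_reeb, D.dForm_eq, smul_eq_mul, formInChart_apply, formInChart_apply]
    field_simp
    rfl
  · intro w
    have h1 : D.phi x (D.phi x (pull x₀ z w) + ((D.α ^ 2)⁻¹ * D.θ x (pull x₀ z w)) • D.reeb x) =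
        -pull x₀ z w + D.θ x (pull x₀ z w) • D.reeb x := by
      rw [map_add, map_smul, D.phi_phi, D.phi_reeb, smul_zero, add_zero]
    have h2 : D.θ x (D.phi x (pull x₀ z w) + ((D.α ^ 2)⁻¹ * D.θ x (pull x₀ z w)) • D.reeb x) =
        (D.α ^ 2)⁻¹ * D.θ x (pull x₀ z w) := by
      rw [map_add, map_smul, D.θ_phi, D.θ_reeb, zero_add, smul_eq_mul, mul_one]
    rw [← push_pull hz (L (L w)), hpL, hpL, h1, h2, add_assoc, ← add_smul, map_add, map_smul,
      map_neg, push_pull hz, formInChart_apply]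
    refine congrArg (fun c => -w + c • fieldInChart D.reeb x₀ z) ?_
    simp only [x]
    ring
  · rw [formInChart_fieldInChart D.θ hz, D.θ_reeb]

namespace Invariant

variable {F G : M → ℝ} (hF : D.Invariant F) (hG : D.Invariant G)
include hF hG

/-- The first half is `θ([u, v]) = u(θ(v))` for `L_u θ = 0`. For the second, `[u, v]` preserves `θ`
as well, so Cartan's formula gives `dθ([u, v], ·) = -d(θ([u, v]))`. -/
lemma θ_mlieBracket (x : M) : D.θ x (VectorField.mlieBracket (𝓡 (2 * n + 1)) (D.S F) (D.S G) x) =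
      dFun G x (D.S F x) ∧
    ∀ w, dForm D.θ x (VectorField.mlieBracket (𝓡 (2 * n + 1)) (D.S F) (D.S G) x) w =
      -dFun (fun x => dFun G x (D.S F x)) x w := by
  suffices h : ∀ p, p = (extChartAt (𝓡 (2 * n + 1)) x).symm (extChartAt (𝓡 (2 * n + 1)) x x) →
      D.θ p (VectorField.mlieBracket (𝓡 (2 * n + 1)) (D.S F) (D.S G) p) = dFun G p (D.S F p) ∧
      ∀ w, dForm D.θ p (VectorField.mlieBracket (𝓡 (2 * n + 1)) (D.S F) (D.S G) p) w =
        -dFun (fun x => dFun G x (D.S F x)) p w from h x (extChartAt_to_inv x).symm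
  rintro _ rfl
  have hy : extChartAt (𝓡 (2 * n + 1)) x x ∈ (extChartAt (𝓡 (2 * n + 1)) x).target :=
    mem_extChartAt_target x
  rw [mlieBracket_symm _ _ x rfl]
  generalize extChartAt (𝓡 (2 * n + 1)) x x = y at hy
  set θ' := formInChart D.θ x with hθ'
  set u := fieldInChart (D.S F) x with hu
  set v := fieldInChart (D.S G) x with hv
  have hLu := hF.isQuantField.lieFree hy
  have hLv := hG.isQuantField.lieFree hy
  have hθs : ∀ z ∈ (extChartAt (𝓡 (2 * n + 1)) x).target, ContDiffAt ℝ ∞ θ' z := fun z hz =>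
    formInChart_contDiffAt D.smoothForm hz
  have hus := hF.smoothField_S.contDiffAt hy
  have hvs := fun {z} hz => hG.smoothField_S.contDiffAt (x₀ := x) (y := z) hz
  have hθv : ∀ z ∈ (extChartAt (𝓡 (2 * n + 1)) x).target, LieFree θ' u z →
      θ' z (VectorField.lieBracket ℝ u v z) =
        dFun G ((extChartAt (𝓡 (2 * n + 1)) x).symm z)
          (D.S F ((extChartAt (𝓡 (2 * n + 1)) x).symm z)) := by
    intro z hz hL
    rw [hL.apply_lieBracket ((hθs z hz).differentiableAt (by simp))
      ((hvs hz).differentiableAt (by simp)), ← fderiv_comp_symm_field hz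
      (mdifferentiableAt_of_smooth hG.smooth _)]
    refine DFunLike.congr_fun (Filter.EventuallyEq.fderiv_eq (𝕜 := ℝ) ?_) _
    filter_upwards [(isOpen_target x).mem_nhds hz] with z' hz'
    rw [hθ', formInChart_fieldInChart D.θ hz', D.θ_S]
  refine ⟨hθv y hy hLu.self_of_nhds, fun w => ?_⟩
  obtain ⟨w, rfl⟩ : ∃ w', pull x y w' = w := ⟨_, pull_push hy w⟩
  have hH : ContMDiff (𝓡 (2 * n + 1)) 𝓘(ℝ, ℝ) ∞ (fun x => dFun G x (D.S F x)) :=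
    contMDiff_dFun hG.smooth hF.smoothField_S
  have hB : DifferentiableAt ℝ (VectorField.lieBracket ℝ u v) y :=
    (((hvs hy).fderiv_right (m := ∞) (by simp)).clm_apply hus |>.sub
      ((hus.fderiv_right (m := ∞) (by simp)).clm_apply (hvs hy))).differentiableAt (by simp)
  have h1 : HasFDerivAt (fun z => θ' z (VectorField.lieBracket ℝ u v z)) _ y :=
    ((hθs y hy).differentiableAt (by simp)).hasFDerivAt.clm_apply hB.hasFDerivAt
  have h2 : (fun z => dFun G ((extChartAt (𝓡 (2 * n + 1)) x).symm z)
          (D.S F ((extChartAt (𝓡 (2 * n + 1)) x).symm z))) =ᶠ[𝓝 y]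
      fun z => θ' z (VectorField.lieBracket ℝ u v z) := by
    filter_upwards [(isOpen_target x).mem_nhds hy, hLu] with z hz hL using (hθv z hz hL).symm
  rw [dForm_pull D.smoothForm hy, ← fderiv_comp_symm hy (mdifferentiableAt_of_smooth hH _),
    h2.fderiv_eq, h1.fderiv]
  have h3 := LieFree.lieBracket (hθs y hy) hus (hvs hy) hLu hLv w
  simp only [add_apply, ContinuousLinearMap.comp_apply, ContinuousLinearMap.flip_apply]
  linarith

/-- Evaluate the second half of `θ_mlieBracket` on `E`, which `dθ` annihilates. -/
lemma dFun_S : D.Invariant (fun x => dFun G x (D.S F x)) := by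
  refine ⟨contMDiff_dFun hG.smooth hF.smoothField_S, fun x => ?_⟩
  have := (hF.θ_mlieBracket hG x).2 (D.reeb x)
  rw [D.dForm_reeb_right] at this
  linarith

/-- `S` is a homomorphism from the contact bracket to the bracket of vector fields. -/
lemma mlieBracket_S : VectorField.mlieBracket (𝓡 (2 * n + 1)) (D.S F) (D.S G) =
    D.S (fun x => dFun G x (D.S F x)) := by
  funext x
  refine D.S_unique (hF.θ_mlieBracket hG x).1 fun w => ?_
  rw [(hF.θ_mlieBracket hG x).2 w, (hF.dFun_S hG).reeb]
  ring

/-- Up to sign both sides are `dθ(S F, S G)`. -/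
lemma dFun_S_antisymm (x : M) : dFun G x (D.S F x) = -dFun F x (D.S G x) := by
  have h1 := hF.dForm_S x (D.S G x)
  have h2 := hG.dForm_S x (D.S F x)
  rw [dForm_antisymm D.smoothForm] at h1
  linarith

end Invariant

end BoothbyWang

end ContactGeometry

/-! ### Geometry of the Boothby-Wang projection. -/

section Submersion

section Transport

variable {d : ℕ} {M : Type*} [TopologicalSpace M] [ChartedSpace (EuclideanSpace ℝ (Fin d)) M]

lemma fieldInChart_extChartAt (X : VField d M) {x₀ x : M}
    (hx : x ∈ (chartAt (EuclideanSpace ℝ (Fin d)) x₀).source) :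
    fieldInChart X x₀ (extChartAt (𝓡 d) x₀ x) = push x₀ x (X x) := by
  obtain ⟨y, hy, rfl⟩ := exists_mem_target hx
  rw [(extChartAt (𝓡 d) x₀).right_inv hy, fieldInChart]

variable [IsManifold (𝓡 d) ∞ M]

lemma push_inverse_push {x₀ x : M} (hx : x ∈ (chartAt (EuclideanSpace ℝ (Fin d)) x₀).source)
    (v : TangentSpace (𝓡 d) x) : (push x₀ x).inverse (push x₀ x v) = v := by
  have h1 : (push (d := d) x₀ x).IsInvertible := isInvertible_mfderiv_extChartAt
    (by rwa [extChartAt_source])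
  exact h1.inverse_apply_self v

lemma push_self_inverse {x₀ x : M} (hx : x ∈ (chartAt (EuclideanSpace ℝ (Fin d)) x₀).source)
    (v : EuclideanSpace ℝ (Fin d)) : push x₀ x ((push x₀ x).inverse v) = v := by
  have h1 : (push (d := d) x₀ x).IsInvertible := isInvertible_mfderiv_extChartAt
    (by rwa [extChartAt_source])
  exact h1.self_apply_inverse v

lemma metricInChart_extChartAt (g : RMetric d M) {x₀ x : M}
    (hx : x ∈ (chartAt (EuclideanSpace ℝ (Fin d)) x₀).source) (v w : TangentSpace (𝓡 d) x) :
    metricInChart g x₀ (extChartAt (𝓡 d) x₀ x) (push x₀ x v) (push x₀ x w) = g.inner x v w := by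
  obtain ⟨y, hy, rfl⟩ := exists_mem_target hx
  rw [(extChartAt (𝓡 d) x₀).right_inv hy, metricInChart_apply, pull_push hy, pull_push hy]

end Transport

variable {n : ℕ} {M N : Type*}
  [TopologicalSpace M] [ChartedSpace (EuclideanSpace ℝ (Fin (2 * n + 1))) M]
  [IsManifold (𝓡 (2 * n + 1)) ∞ M]
  [TopologicalSpace N] [ChartedSpace (EuclideanSpace ℝ (Fin (2 * n))) N]
  [IsManifold (𝓡 (2 * n)) ∞ N] (D : BoothbyWang n M N)

namespace BoothbyWang

/-- The differential of the projection. -/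
def dproj (x : M) : TangentSpace (𝓡 (2 * n + 1)) x →L[ℝ] TangentSpace (𝓡 (2 * n)) (D.proj x) :=
  mfderiv (𝓡 (2 * n + 1)) (𝓡 (2 * n)) D.proj x

lemma Ω_dproj (x : M) (v w : TangentSpace (𝓡 (2 * n + 1)) x) :
    D.Ω (D.proj x) (D.dproj x v) (D.dproj x w) = dForm D.θ x v w := D.proj_pullback x v w

lemma mdifferentiableAt_proj (x : M) :
    MDifferentiableAt (𝓡 (2 * n + 1)) (𝓡 (2 * n)) D.proj x :=
  (D.proj_smooth x).mdifferentiableAt (by simp)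

lemma proj_integralCurve {γ : ℝ → M} (hγ : IsMIntegralCurve (I := 𝓡 (2 * n + 1)) γ D.reeb)
    (t : ℝ) : D.proj (γ t) = D.proj (γ 0) :=
  ((D.proj_fibres _ _).2 ⟨γ, hγ, rfl, t, rfl⟩).symm

/-- The fibres are orbits, so the projection is constant along integral curves of `E`; regularity
provides such a curve through every point. -/
lemma dproj_reeb (x : M) : D.dproj x (D.reeb x) = 0 := by
  have aux : ∀ γ : ℝ → M, IsMIntegralCurve (I := 𝓡 (2 * n + 1)) γ D.reeb →
      D.dproj (γ 0) (D.reeb (γ 0)) = 0 := by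
    intro γ hγ
    have h2 : HasMFDerivAt 𝓘(ℝ, ℝ) (𝓡 (2 * n)) (D.proj ∘ γ) 0
        ((D.dproj (γ 0)).comp (ContinuousLinearMap.smulRight (1 : ℝ →L[ℝ] ℝ) (D.reeb (γ 0)))) :=
      HasMFDerivAt.comp (0 : ℝ) (D.mdifferentiableAt_proj _).hasMFDerivAt (hγ 0)
    have h3 : D.proj ∘ γ = fun _ => D.proj (γ 0) := funext fun t => D.proj_integralCurve hγ t
    have h4 := h2.mfderiv
    rw [h3, mfderiv_const] at h4
    have h5 := congrArg (fun L : ℝ →L[ℝ] EuclideanSpace ℝ (Fin (2 * n)) => L 1) h4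
    refine Eq.trans ?_ h5.symm
    change _ = D.dproj (γ 0) ((1 : ℝ) • D.reeb (γ 0))
    rw [one_smul]
  obtain ⟨T, -, Φ, -, hΦ0, hΦ, -⟩ := D.regular
  have h : ∀ p, p = x → D.dproj p (D.reeb p) = 0 → D.dproj x (D.reeb x) = 0 := by
    rintro _ rfl h; exact h
  exact h _ (hΦ0 x) (aux _ (hΦ x))

/-- Since `π^* Ω = dθ`, a vertical vector is annihilated by `dθ`, and so is its part in the kernel
of `θ`, where `dθ` is nondegenerate. -/
lemma eq_smul_reeb {x : M} {v : TangentSpace (𝓡 (2 * n + 1)) x} (h : D.dproj x v = 0) :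
    v = D.θ x v • D.reeb x := by
  rw [← sub_eq_zero]
  refine D.eq_zero_of_dForm ?_ fun w => ?_
  · rw [map_sub, map_smul, D.θ_reeb]; simp
  · rw [← D.Ω_dproj, map_sub, map_smul, h, D.dproj_reeb, smul_zero, sub_zero, map_zero]
    rfl

/-- The splitting of the metric into vertical and horizontal parts. -/
lemma inner_eq (x : M) (v w : TangentSpace (𝓡 (2 * n + 1)) x) :
    D.gM.inner x v w = D.α ^ 2 * (D.θ x v * D.θ x w) +
      D.gN.inner (D.proj x) (D.dproj x v) (D.dproj x w) := by
  -- Subtracting the Reeb component yields a horizontal vector, the only kind to which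
  -- `proj_isometry` applies.
  have hor : ∀ u : TangentSpace (𝓡 (2 * n + 1)) x, ∀ k, D.dproj x k = 0 →
      D.gM.inner x (u - D.θ x u • D.reeb x) k = 0 := by
    intro u k hk
    rw [D.eq_smul_reeb hk, map_smul, D.inner_reeb, map_sub, map_smul, D.θ_reeb]
    simp
  have hp : ∀ u : TangentSpace (𝓡 (2 * n + 1)) x,
      D.dproj x (u - D.θ x u • D.reeb x) = D.dproj x u := by
    intro u
    rw [map_sub, map_smul, D.dproj_reeb, smul_zero, sub_zero]
  have h := D.proj_isometry x _ _ (hor v) (hor w)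
  change D.gN.inner (D.proj x) (D.dproj x (v - D.θ x v • D.reeb x))
    (D.dproj x (w - D.θ x w • D.reeb x)) = _ at h
  rw [hp, hp] at h
  rw [h]
  simp only [map_sub, sub_apply, map_smul, smul_apply, D.inner_reeb, D.θ_reeb, smul_eq_mul]
  rw [D.gM.symm x (D.reeb x) w, D.inner_reeb]
  ring

/-- The projection in the preferred charts at `x₀` and `x₁`. -/
def projInChart (x₀ : M) (x₁ : N) (z : EuclideanSpace ℝ (Fin (2 * n + 1))) :
    EuclideanSpace ℝ (Fin (2 * n)) :=
  extChartAt (𝓡 (2 * n)) x₁ (D.proj ((extChartAt (𝓡 (2 * n + 1)) x₀).symm z))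

section Charts

variable {x₀ : M} {x₁ : N} {y : EuclideanSpace ℝ (Fin (2 * n + 1))}
  (hy : y ∈ (extChartAt (𝓡 (2 * n + 1)) x₀).target)
  (hx : D.proj ((extChartAt (𝓡 (2 * n + 1)) x₀).symm y) ∈
    (chartAt (EuclideanSpace ℝ (Fin (2 * n))) x₁).source)
include hy

lemma contMDiffAt_proj_symm :
    ContMDiffAt 𝓘(ℝ, EuclideanSpace ℝ (Fin (2 * n + 1))) (𝓡 (2 * n)) ∞
      (fun z => D.proj ((extChartAt (𝓡 (2 * n + 1)) x₀).symm z)) y :=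
  (D.proj_smooth _).comp y ((contMDiffOn_symm x₀).contMDiffAt ((isOpen_target x₀).mem_nhds hy))

include hx

lemma contDiffAt_projInChart : ContDiffAt ℝ ∞ (D.projInChart x₀ x₁) y :=
  (ContMDiffAt.comp y (contMDiffAt_extChartAt' (I := 𝓡 (2 * n)) (x := x₁) hx)
    (D.contMDiffAt_proj_symm hy)).contDiffAt

lemma eventually_proj_symm_mem : ∀ᶠ z in 𝓝 y, z ∈ (extChartAt (𝓡 (2 * n + 1)) x₀).target ∧
    D.proj ((extChartAt (𝓡 (2 * n + 1)) x₀).symm z) ∈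
      (chartAt (EuclideanSpace ℝ (Fin (2 * n))) x₁).source :=
  Filter.Eventually.and ((isOpen_target x₀).mem_nhds hy)
    ((D.contMDiffAt_proj_symm hy).continuousAt.preimage_mem_nhds
      ((chartAt (EuclideanSpace ℝ (Fin (2 * n))) x₁).open_source.mem_nhds hx))

lemma fderiv_projInChart (v : EuclideanSpace ℝ (Fin (2 * n + 1))) :
    fderiv ℝ (D.projInChart x₀ x₁) y v =
      push x₁ (D.proj ((extChartAt (𝓡 (2 * n + 1)) x₀).symm y))
        (D.dproj ((extChartAt (𝓡 (2 * n + 1)) x₀).symm y) (pull x₀ y v)) := by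
  have e1 := mfderiv_comp (I := 𝓡 (2 * n + 1)) (I' := 𝓡 (2 * n))
    (I'' := 𝓘(ℝ, EuclideanSpace ℝ (Fin (2 * n)))) (f := D.proj) (g := extChartAt (𝓡 (2 * n)) x₁)
    ((extChartAt (𝓡 (2 * n + 1)) x₀).symm y) (mdifferentiableAt_extChartAt hx)
    (D.mdifferentiableAt_proj _)
  have e2 := mfderiv_comp (I := 𝓘(ℝ, EuclideanSpace ℝ (Fin (2 * n + 1)))) (I' := 𝓡 (2 * n + 1))
    (I'' := 𝓘(ℝ, EuclideanSpace ℝ (Fin (2 * n))))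
    (f := (extChartAt (𝓡 (2 * n + 1)) x₀).symm) (g := extChartAt (𝓡 (2 * n)) x₁ ∘ D.proj) y
    ((mdifferentiableAt_extChartAt hx).comp _ (D.mdifferentiableAt_proj _))
    (mdifferentiableAt_symm hy)
  rw [mfderiv_eq_fderiv, e1] at e2
  exact congrArg (fun L => L v) e2

lemma surjective_fderiv_projInChart :
    Function.Surjective (fderiv ℝ (D.projInChart x₀ x₁) y) := by
  intro w
  obtain ⟨u, hu⟩ := D.proj_submersion ((extChartAt (𝓡 (2 * n + 1)) x₀).symm y)
    ((push x₁ (D.proj ((extChartAt (𝓡 (2 * n + 1)) x₀).symm y))).inverse w)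
  refine ⟨push x₀ ((extChartAt (𝓡 (2 * n + 1)) x₀).symm y) u, ?_⟩
  rw [D.fderiv_projInChart hy hx, pull_push hy]
  refine (congrArg (push x₁ (D.proj ((extChartAt (𝓡 (2 * n + 1)) x₀).symm y))) hu).trans ?_
  exact push_self_inverse hx w

end Charts

variable {D}

lemma dFun_comp_proj {f : N → ℝ} (hf : ContMDiff (𝓡 (2 * n)) 𝓘(ℝ, ℝ) ∞ f) (x : M)
    (w : TangentSpace (𝓡 (2 * n + 1)) x) :
    dFun (f ∘ D.proj) x w = dFun f (D.proj x) (D.dproj x w) :=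
  congrArg (fun L => L w) (mfderiv_comp (I' := 𝓡 (2 * n)) x
    (mdifferentiableAt_of_smooth hf _) (D.mdifferentiableAt_proj x))

lemma invariant_comp_proj {f : N → ℝ} (hf : ContMDiff (𝓡 (2 * n)) 𝓘(ℝ, ℝ) ∞ f) :
    D.Invariant (f ∘ D.proj) :=
  ⟨hf.comp D.proj_smooth, fun x => by rw [dFun_comp_proj hf, D.dproj_reeb, map_zero]⟩

/-- The gradient upstairs is horizontal, so both sides have the same inner product with every
projected vector; their difference is itself such a vector. -/
lemma dproj_grad {f : N → ℝ} (hf : ContMDiff (𝓡 (2 * n)) 𝓘(ℝ, ℝ) ∞ f) (x : M) :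
    D.dproj x (grad D.gM (f ∘ D.proj) x) = grad D.gN f (D.proj x) := by
  rw [← sub_eq_zero]
  refine eq_zero_of_inner_self D.gN ?_
  obtain ⟨w, hw⟩ : ∃ w, D.dproj x w = D.dproj x (grad D.gM (f ∘ D.proj) x) -
    grad D.gN f (D.proj x) := D.proj_submersion x _
  rw [← hw]
  have h1 : D.gN.inner (D.proj x) (D.dproj x w) (D.dproj x w) =
      D.gN.inner (D.proj x) (D.dproj x (grad D.gM (f ∘ D.proj) x)) (D.dproj x w) -
        D.gN.inner (D.proj x) (grad D.gN f (D.proj x)) (D.dproj x w) := by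
    rw [← sub_apply, ← map_sub, ← hw]
  have h2 := D.inner_eq x (grad D.gM (f ∘ D.proj) x) w
  rw [(invariant_comp_proj hf).θ_grad, inner_grad, dFun_comp_proj hf] at h2
  rw [h1, inner_grad]
  linarith

/-- The projected contact field solves the Hamiltonian equation because `π^* Ω = dθ`. Uniqueness:
lifts of two solutions differ by a vector in the kernel of `dθ`, a multiple of `E`. -/
lemma hamiltonianField_proj {f : N → ℝ} (hf : ContMDiff (𝓡 (2 * n)) 𝓘(ℝ, ℝ) ∞ f) (x : M) :
    hamiltonianField D.Ω f (D.proj x) = D.dproj x (D.lift f x) := by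
  have hS : ∀ w, D.Ω (D.proj x) (D.dproj x (D.lift f x)) w = -dFun f (D.proj x) w := by
    intro w
    obtain ⟨w, rfl⟩ : ∃ w', D.dproj x w' = w := D.proj_submersion x w
    rw [D.Ω_dproj, ← dFun_comp_proj hf]
    exact (invariant_comp_proj hf).dForm_S x w
  have hH : ∀ w, D.Ω (D.proj x) (hamiltonianField D.Ω f (D.proj x)) w = -dFun f (D.proj x) w :=
    Classical.epsilon_spec (p := fun X : TangentSpace (𝓡 (2 * n)) (D.proj x) =>
      ∀ w, D.Ω (D.proj x) X w = -(dFun f (D.proj x) w)) ⟨_, hS⟩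
  obtain ⟨u, hu⟩ : ∃ u, D.dproj x u = hamiltonianField D.Ω f (D.proj x) := D.proj_submersion x _
  rw [← hu] at hH ⊢
  rw [← sub_eq_zero, ← map_sub]
  set v := u - D.lift f x with hv
  have h0 : v - D.θ x v • D.reeb x = 0 := by
    refine D.eq_zero_of_dForm ?_ fun w => ?_
    · rw [map_sub, map_smul, D.θ_reeb]; simp
    · rw [← D.Ω_dproj, map_sub, map_smul, D.dproj_reeb, smul_zero, sub_zero, hv, map_sub, map_sub,
        sub_apply, hS, hH, sub_self]
  rw [sub_eq_zero.1 h0, map_smul, D.dproj_reeb, smul_zero]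

lemma poissonBracket_proj {f h : N → ℝ} (hf : ContMDiff (𝓡 (2 * n)) 𝓘(ℝ, ℝ) ∞ f)
    (hh : ContMDiff (𝓡 (2 * n)) 𝓘(ℝ, ℝ) ∞ h) (x : M) :
    poissonBracket D.Ω f h (D.proj x) = dFun (h ∘ D.proj) x (D.lift f x) := by
  rw [poissonBracket, hamiltonianField_proj hf, dFun_comp_proj hh]

/-- The gradient of a basic function has the Laplacian on the base as its divergence. -/
lemma hasDivergence_grad {f : N → ℝ} (hf : ContMDiff (𝓡 (2 * n)) 𝓘(ℝ, ℝ) ∞ f) :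
    HasDivergence D.gM (grad D.gM (f ∘ D.proj)) (fun x => laplacian D.gN f (D.proj x)) := by
  intro x₀ y hy
  have hF := invariant_comp_proj (D := D) hf
  have hgr := smoothField_grad D.gM hF.smooth
  set x := (extChartAt (𝓡 (2 * n + 1)) x₀).symm y with hx
  -- The chart on `N` is centred at the projected point because `laplacian` is computed in the chart
  -- at its own argument.
  set x₁ := D.proj x with hx₁
  set P := D.projInChart x₀ x₁ with hP
  set Z := fieldInChart (grad D.gM (f ∘ D.proj)) x₀ with hZ
  set Y := fieldInChart (grad D.gN f) x₁ with hY
  have hPy : P y = extChartAt (𝓡 (2 * n)) x₁ x₁ := rfl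
  have hx₁t : extChartAt (𝓡 (2 * n)) x₁ x₁ ∈ (extChartAt (𝓡 (2 * n)) x₁).target :=
    mem_extChartAt_target x₁
  have hxs : x₁ ∈ (chartAt (EuclideanSpace ℝ (Fin (2 * n))) x₁).source := mem_chart_source _ _
  have hPs : ContDiffAt ℝ ∞ P y := D.contDiffAt_projInChart hy hxs
  have hev := D.eventually_proj_symm_mem (x₁ := x₁) hy hxs
  have hGM : DifferentiableAt ℝ (metricInChart D.gM x₀) y :=
    ((contDiffOn_metricInChart D.gM x₀).contDiffAt ((isOpen_target x₀).mem_nhds hy)).differentiableAt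
      (by simp)
  have hdens := density_pos D.gM hy
  -- The functional `l` is `Ω(dπ Z, ·)` in the chart: `ι_Z dθ` is the pullback of this form.
  have key := trace_lieMat_of_submersion (P := P) (θ := formInChart D.θ x₀) (Z := Z) (Y := Y)
    (GM := metricInChart D.gM x₀) (GN := metricInChart D.gN x₁) (α := D.α) (y := y)
    (E := fieldInChart D.reeb x₀ y)
    (l := (D.Ω x₁ (D.dproj x (grad D.gM (f ∘ D.proj) x))).comp (push x₁ x₁).inverse)
    D.α_pos.ne' hPs ((formInChart_contDiffAt D.smoothForm hy).differentiableAt (by simp))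
    ((hgr.contDiffAt hy).differentiableAt (by simp))
    (((smoothField_grad D.gN hf).contDiffAt hx₁t).differentiableAt (by simp)) hGM
    (((contDiffOn_metricInChart D.gN x₁).contDiffAt
      ((isOpen_target x₁).mem_nhds hx₁t)).differentiableAt (by simp))
    (by
      filter_upwards [hev] with z hz v w
      rw [hP, D.fderiv_projInChart hz.1 hz.2, D.fderiv_projInChart hz.1 hz.2, projInChart,
        metricInChart_extChartAt D.gN hz.2, metricInChart_apply,
        D.inner_eq]
      rfl)
    (by
      filter_upwards [hev] with z hz
      rw [hZ, formInChart_fieldInChart D.θ hz.1, hF.θ_grad])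
    (by
      filter_upwards [hev] with z hz
      rw [hP, D.fderiv_projInChart hz.1 hz.2, hZ, pull_fieldInChart hz.1, hY, projInChart,
        fieldInChart_extChartAt _ hz.2, dproj_grad hf])
    (by
      intro v
      rw [← dForm_pull D.smoothForm hy, hZ, pull_fieldInChart hy, ← D.Ω_dproj,
        hP, D.fderiv_projInChart hy hxs, ContinuousLinearMap.comp_apply,
        push_inverse_push (mem_chart_source _ _)])
    (by rw [hP, D.fderiv_projInChart hy hxs, pull_fieldInChart hy, D.dproj_reeb, map_zero])
    (by rw [formInChart_fieldInChart D.θ hy, D.θ_reeb])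
    (by
      intro v hv
      rw [hP, D.fderiv_projInChart hy hxs] at hv
      have h1 := congrArg (push x₁ x₁).inverse hv
      rw [push_inverse_push (mem_chart_source _ _), map_zero] at h1
      have h2 := D.eq_smul_reeb h1
      have h3 := congrArg (push x₀ _) h2
      rwa [push_pull hy, map_smul] at h3)
    (D.surjective_fderiv_projInChart hy hxs)
    (density_pos D.gN hx₁t).ne'
  have h1 := fderiv_det_add_divg Z hGM
  have h2 : (bilinMat (metricInChart D.gM x₀ y)).adjugate =
      density D.gM x₀ y • (bilinMat (metricInChart D.gM x₀ y))⁻¹ := by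
    rw [Matrix.inv_def, smul_smul, density, Ring.mul_inverse_cancel _ (by
      exact isUnit_iff_ne_zero.2 hdens.ne'), one_smul]
  rw [h2, Matrix.smul_mul, Matrix.trace_smul, key, hPy] at h1
  refine h1.trans ?_
  simp only
  rw [laplacian_eq_grad D.gN hf, smul_eq_mul]
  ring

end BoothbyWang

end Submersion

/-! ### Descent to the quotient and the fundamental lemma. -/

section Descent

/-- A submersion has smooth local sections. -/
lemma exists_section_of_surjective {E F : Type*} [NormedAddCommGroup E] [NormedSpace ℝ E]
    [CompleteSpace E] [NormedAddCommGroup F] [NormedSpace ℝ F] [FiniteDimensional ℝ F]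
    {P : E → F} {y : E} (hP : ContDiffAt ℝ ∞ P y) (hs : Function.Surjective (fderiv ℝ P y)) :
    ∃ s : F → E, ContDiffAt ℝ ∞ s (P y) ∧ s (P y) = y ∧ ∀ᶠ z in 𝓝 (P y), P (s z) = z := by
  have : CompleteSpace F := FiniteDimensional.complete ℝ F
  obtain ⟨R, hR⟩ := (fderiv ℝ P y).exists_rightInverse_of_surjective
    (LinearMap.range_eq_top.2 hs)
  -- `P` on an affine slice transverse to its kernel. Its derivative at `P y` is the identity, so
  -- the inverse function theorem applies, and its local inverse gives the section.
  set Q : F → F := fun z => P (y + R (z - P y)) with hQ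
  have haff : ContDiff ℝ ∞ fun z : F => y + R (z - P y) :=
    contDiff_const.add (R.contDiff.comp (contDiff_id.sub contDiff_const))
  have hy : y + R (P y - P y) = y := by simp
  have hQs : ContDiffAt ℝ ∞ Q (P y) := by
    refine ContDiffAt.comp (P y) ?_ haff.contDiffAt
    rw [hy]; exact hP
  have hQd : HasFDerivAt Q ((ContinuousLinearEquiv.refl ℝ F : F ≃L[ℝ] F) : F →L[ℝ] F) (P y) := by
    have h1 : HasFDerivAt (fun z : F => y + R (z - P y)) R (P y) := by
      have := (R.hasFDerivAt.comp (P y) ((hasFDerivAt_id (P y)).sub_const (P y))).const_add y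
      simpa using this
    have h2 : HasFDerivAt P (fderiv ℝ P y) (y + R (P y - P y)) := by
      rw [hy]; exact (hP.differentiableAt (by simp)).hasFDerivAt
    have h3 := h2.comp (P y) h1
    rw [hR] at h3
    exact h3
  have hQy : Q (P y) = P y := by simp [hQ]
  set g := hQs.localInverse hQd (by simp) with hg
  have hgs : ContDiffAt ℝ ∞ g (P y) := by
    have := hQs.to_localInverse hQd (by simp)
    rwa [hQy] at this
  have hgy : g (P y) = P y := by
    have := hQs.localInverse_apply_image hQd (by simp)
    rwa [hQy] at this
  have hQg : ∀ᶠ z in 𝓝 (P y), Q (g z) = z := by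
    have := (hQs.hasStrictFDerivAt' hQd (by simp)).eventually_right_inverse
    rwa [hQy] at this
  exact ⟨fun z => y + R (g z - P y), haff.contDiffAt.comp (P y) hgs, by simp [hgy], hQg⟩

variable {n : ℕ} {M N : Type*}
  [TopologicalSpace M] [ChartedSpace (EuclideanSpace ℝ (Fin (2 * n + 1))) M]
  [IsManifold (𝓡 (2 * n + 1)) ∞ M]
  [TopologicalSpace N] [ChartedSpace (EuclideanSpace ℝ (Fin (2 * n))) N]
  [IsManifold (𝓡 (2 * n)) ∞ N] (D : BoothbyWang n M N)

namespace BoothbyWang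

lemma exists_section (x : M) : ∃ σ : N → M,
    ContMDiffAt (𝓡 (2 * n)) (𝓡 (2 * n + 1)) ∞ σ (D.proj x) ∧ σ (D.proj x) = x ∧
      ∀ᶠ z in 𝓝 (D.proj x), D.proj (σ z) = z := by
  have hy : extChartAt (𝓡 (2 * n + 1)) x x ∈ (extChartAt (𝓡 (2 * n + 1)) x).target :=
    mem_extChartAt_target x
  have hyx := extChartAt_to_inv (I := 𝓡 (2 * n + 1)) x
  have hx : D.proj ((extChartAt (𝓡 (2 * n + 1)) x).symm (extChartAt (𝓡 (2 * n + 1)) x x)) ∈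
      (chartAt (EuclideanSpace ℝ (Fin (2 * n))) (D.proj x)).source := by
    rw [hyx]; exact mem_chart_source _ _
  obtain ⟨s, hs, hsy, hPs⟩ := exists_section_of_surjective (D.contDiffAt_projInChart hy hx)
    (D.surjective_fderiv_projInChart hy hx)
  have hPy : D.projInChart x (D.proj x) (extChartAt (𝓡 (2 * n + 1)) x x) =
      extChartAt (𝓡 (2 * n)) (D.proj x) (D.proj x) := by rw [projInChart, hyx]
  rw [hPy] at hs hsy hPs
  have hσ : ContMDiffAt (𝓡 (2 * n)) (𝓡 (2 * n + 1)) ∞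
      (fun z => (extChartAt (𝓡 (2 * n + 1)) x).symm (s (extChartAt (𝓡 (2 * n)) (D.proj x) z)))
      (D.proj x) := by
    have h1 : ContMDiffAt 𝓘(ℝ, EuclideanSpace ℝ (Fin (2 * n + 1))) (𝓡 (2 * n + 1)) ∞
        (extChartAt (𝓡 (2 * n + 1)) x).symm
        (s (extChartAt (𝓡 (2 * n)) (D.proj x) (D.proj x))) := by
      rw [hsy]
      exact (contMDiffOn_symm x).contMDiffAt ((isOpen_target x).mem_nhds hy)
    have h2 := ContMDiffAt.comp (D.proj x) hs.contMDiffAt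
      (contMDiffAt_extChartAt (I := 𝓡 (2 * n)) (x := D.proj x) (n := ∞))
    exact ContMDiffAt.comp (D.proj x) h1 h2
  refine ⟨_, hσ, ?_, ?_⟩
  · rw [hsy, hyx]
  · have hpσ := (D.proj_smooth.continuous.continuousAt.comp hσ.continuousAt).preimage_mem_nhds
      ((chartAt (EuclideanSpace ℝ (Fin (2 * n))) (D.proj x)).open_source.mem_nhds (by
        simp only [Function.comp, hsy, hyx]; exact mem_chart_source _ _))
    have hc : ContinuousAt (extChartAt (𝓡 (2 * n)) (D.proj x)) (D.proj x) :=
      continuousAt_extChartAt (D.proj x)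
    filter_upwards [hc.eventually hPs, hpσ,
      (chartAt (EuclideanSpace ℝ (Fin (2 * n))) (D.proj x)).open_source.mem_nhds
        (mem_chart_source _ (D.proj x))] with z h1 h2 h3
    exact (extChartAt (𝓡 (2 * n)) (D.proj x)).injOn (by rw [extChartAt_source]; exact h2)
      (by rw [extChartAt_source]; exact h3) h1

variable {D}

/-- Smoothness descends along the projection. -/
lemma contMDiff_of_comp_proj {h : N → ℝ}
    (hh : ContMDiff (𝓡 (2 * n + 1)) 𝓘(ℝ, ℝ) ∞ (h ∘ D.proj)) :
    ContMDiff (𝓡 (2 * n)) 𝓘(ℝ, ℝ) ∞ h := by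
  intro z
  obtain ⟨x, rfl⟩ := D.proj_surjective z
  obtain ⟨σ, hσ, hσx, hpσ⟩ := D.exists_section x
  have h1 : ContMDiffAt (𝓡 (2 * n)) 𝓘(ℝ, ℝ) ∞ ((h ∘ D.proj) ∘ σ) (D.proj x) :=
    ContMDiffAt.comp (D.proj x) (hh _) hσ
  refine h1.congr_of_eventuallyEq ?_
  filter_upwards [hpσ] with z hz
  simp [hz]

lemma image_proj_mem_nhds {x : M} {C : Set M} (hC : C ∈ 𝓝 x) : D.proj '' C ∈ 𝓝 (D.proj x) := by
  obtain ⟨σ, hσ, hσx, hpσ⟩ := D.exists_section x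
  have h1 : σ ⁻¹' C ∈ 𝓝 (D.proj x) := hσ.continuousAt.preimage_mem_nhds (by rwa [hσx])
  filter_upwards [h1, hpσ] with z hz hz' using ⟨σ z, hz, hz'⟩

lemma Invariant.eq_of_sameOrbit {F : M → ℝ} (hF : D.Invariant F) {x y : M}
    (h : SameOrbit D.reeb x y) : F x = F y := by
  obtain ⟨γ, hγ, rfl, t, rfl⟩ := h
  have hd : ∀ s, HasDerivAt (F ∘ γ) 0 s := by
    intro s
    set L : ℝ →L[ℝ] ℝ := (dFun F (γ s)).comp
      (ContinuousLinearMap.smulRight (1 : ℝ →L[ℝ] ℝ) (D.reeb (γ s)))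
    have h1 : HasMFDerivAt 𝓘(ℝ, ℝ) 𝓘(ℝ, ℝ) (F ∘ γ) s L :=
      HasMFDerivAt.comp s (mdifferentiableAt_of_smooth hF.smooth _).hasMFDerivAt (hγ s)
    have h2 : HasFDerivAt (F ∘ γ) L s := h1.hasFDerivAt
    have h3 : L 1 = 0 := by
      change dFun F (γ s) ((1 : ℝ) • D.reeb (γ s)) = 0
      rw [one_smul, hF.reeb]
    rw [← h3]
    exact h2.hasDerivAt
  exact is_const_of_deriv_eq_zero (fun s => (hd s).differentiableAt) (fun s => (hd s).deriv) 0 t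

lemma Invariant.exists_eq_comp {F : M → ℝ} (hF : D.Invariant F) :
    ∃ f : N → ℝ, ContMDiff (𝓡 (2 * n)) 𝓘(ℝ, ℝ) ∞ f ∧ F = f ∘ D.proj := by
  have h : F = (F ∘ Function.surjInv D.proj_surjective) ∘ D.proj := by
    funext x
    refine hF.eq_of_sameOrbit ((D.proj_fibres _ _).1 ?_)
    exact (Function.surjInv_eq D.proj_surjective (D.proj x)).symm
  exact ⟨_, contMDiff_of_comp_proj (h ▸ hF.smooth), h⟩

/-- The stream function is `θ(X)` pushed down to `N`; uniqueness follows from `θ(S F) = F` and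
surjectivity of the projection. -/
lemma isQuantField_iff (X : VField (2 * n + 1) M) : IsQuantField D.θ X ↔
    ∃! f : N → ℝ, ContMDiff (𝓡 (2 * n)) 𝓘(ℝ, ℝ) ∞ f ∧ X = D.lift f := by
  constructor
  · intro hX
    obtain ⟨f, hf, hfX⟩ := hX.invariant.exists_eq_comp
    refine ⟨f, ⟨hf, ?_⟩, ?_⟩
    · rw [lift, ← hfX]; exact hX.eq_S
    · rintro f' ⟨-, rfl⟩
      funext z
      obtain ⟨x, rfl⟩ := D.proj_surjective z
      have h1 := congrFun hfX x
      have h2 := D.θ_S (f' ∘ D.proj) x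
      exact h2.symm.trans h1
  · rintro ⟨f, ⟨hf, rfl⟩, -⟩
    exact (invariant_comp_proj hf).isQuantField

variable (D)

/-- The preimages of small compact sets are compact. -/
lemma exists_isCompact_preimage [T2Space M] (z : N) : ∃ V ∈ 𝓝 z, IsCompact (D.proj ⁻¹' V) := by
  obtain ⟨x, rfl⟩ := D.proj_surjective z
  have : LocallyCompactSpace M := ChartedSpace.locallyCompactSpace (EuclideanSpace ℝ (Fin (2 * n + 1))) M
  obtain ⟨C, hC, hCx⟩ := exists_compact_mem_nhds x
  refine ⟨D.proj '' C, image_proj_mem_nhds hCx, ?_⟩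
  obtain ⟨T, hT, Φ, hΦs, hΦ0, hΦ, hΦT⟩ := D.regular
  have hE : ContMDiff (𝓡 (2 * n + 1)) (𝓡 (2 * n + 1)).tangent 1
      (fun x => (⟨x, D.reeb x⟩ : TangentBundle (𝓡 (2 * n + 1)) M)) :=
    ContMDiff.of_le D.isReeb.1 (by exact_mod_cast le_top)
  have hper : ∀ c, Function.Periodic (fun t => Φ t c) T := by
    intro c
    have h1 := (hΦ c).periodic_of_eq (a := T) (b := 0) hE (by
      rw [hΦ0]; exact (hΦT c T).2 ⟨1, by simp⟩)
    rwa [sub_zero] at h1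
  -- The saturation of `C` is its flow-out over one period: orbits through `C` are curves of `Φ` by
  -- uniqueness of integral curves, and times reduce modulo `T`.
  have h : D.proj ⁻¹' (D.proj '' C) = Function.uncurry Φ '' (Icc 0 T ×ˢ C) := by
    ext p
    constructor
    · rintro ⟨c, hc, hcp⟩
      obtain ⟨γ, hγ, h0, t, ht⟩ := (D.proj_fibres _ _).1 hcp
      have h1 : γ = fun t => Φ t c := isMIntegralCurve_Ioo_eq_of_contMDiff_boundaryless
        (t₀ := 0) hE hγ (hΦ c) (by rw [h0, hΦ0])
      obtain ⟨s, hs, hs'⟩ := (hper c).exists_mem_Ico₀ hT t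
      refine ⟨(s, c), ⟨Ico_subset_Icc_self hs, hc⟩, ?_⟩
      rw [← ht, h1]
      exact hs'.symm
    · rintro ⟨⟨t, c⟩, ⟨-, hc⟩, rfl⟩
      refine ⟨c, hc, ?_⟩
      have := D.proj_integralCurve (hΦ c) t
      rw [hΦ0] at this
      exact this.symm
  rw [h]
  exact (isCompact_Icc.prod hC).image hΦs.continuous

/-- The fundamental lemma of the calculus of variations, for basic functions. -/
lemma eq_zero_of_integral_eq_zero [T2Space M] [SigmaCompactSpace M] [T2Space N]
    [MeasurableSpace M] [BorelSpace M] {μ : Measure M} (hμ : IsRiemannianVolume D.gM μ) {h : N → ℝ}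
    (hh : ContMDiff (𝓡 (2 * n)) 𝓘(ℝ, ℝ) ∞ h)
    (hint : ∀ g : N → ℝ, ContMDiff (𝓡 (2 * n)) 𝓘(ℝ, ℝ) ∞ g → HasCompactSupport (g ∘ D.proj) →
      ∫ x, g (D.proj x) * h (D.proj x) ∂μ = 0) (z : N) : h z = 0 := by
  have := hμ.isLocallyFiniteMeasure
  have := hμ.isOpenPosMeasure
  obtain ⟨V, hV, hVc⟩ := D.exists_isCompact_preimage z
  obtain ⟨χ, -, hχ⟩ := (SmoothBumpFunction.nhds_basis_tsupport (I := 𝓡 (2 * n)) z).mem_iff.1 hV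
  by_contra hne
  obtain ⟨x, rfl⟩ := D.proj_surjective z
  -- The test function is `χ h`, so the integrand is `χ h² ≥ 0`, positive at `x`.
  have hsm : ContMDiff (𝓡 (2 * n)) 𝓘(ℝ, ℝ) ∞ (fun y => χ y * h y) := χ.contMDiff.mul hh
  have hcs : HasCompactSupport (fun x => χ (D.proj x)) := by
    refine HasCompactSupport.intro hVc fun p hp => ?_
    exact image_eq_zero_of_notMem_tsupport (f := χ) fun h => hp (hχ h)
  have h1 := hint _ hsm hcs.mul_right
  refine absurd h1 (ne_of_gt ?_)
  refine Continuous.integral_pos_of_hasCompactSupport_nonneg_nonzero (x := x)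
    ((hsm.continuous.comp D.proj_smooth.continuous).mul
      (hh.continuous.comp D.proj_smooth.continuous)) ?_ ?_ ?_
  · exact (hcs.mul_right (f' := fun x => h (D.proj x))).mul_right
      (f' := fun x => h (D.proj x))
  · intro p
    have := mul_nonneg (χ.nonneg (x := D.proj p)) (mul_self_nonneg (h (D.proj p)))
    simpa [mul_assoc] using this
  · simp [hne]

end BoothbyWang

end Descent

/-! ### The weak form of the Euler-Arnold equation. -/

section WeakForm

section

variable {d : ℕ} {M : Type*} [TopologicalSpace M] [ChartedSpace (EuclideanSpace ℝ (Fin d)) M]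

lemma hasCompactSupport_dFun [R1Space M] {f : M → ℝ} (hf : HasCompactSupport f) (X : VField d M) :
    HasCompactSupport (fun x => dFun f x (X x)) :=
  HasCompactSupport.intro hf fun _ hx => dFun_eq_zero_of_notMem_tsupport hx _

lemma IsRiemannianVolume.integrable [IsManifold (𝓡 d) ∞ M] [MeasurableSpace M] [BorelSpace M]
    {g : RMetric d M} {μ : Measure M} (hμ : IsRiemannianVolume g μ) {u : M → ℝ}
    (hu : Continuous u) (hc : HasCompactSupport u) : Integrable u μ := by
  have := hμ.isLocallyFiniteMeasure
  exact hu.integrable_of_hasCompactSupport hc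

lemma dFun_neg (f : M → ℝ) (x : M) (v : TangentSpace (𝓡 d) x) :
    dFun (fun x => -f x) x v = -dFun f x v := by
  have h : mfderiv (𝓡 d) 𝓘(ℝ, ℝ) (fun x => -f x) x = -mfderiv (𝓡 d) 𝓘(ℝ, ℝ) f x :=
    mfderiv_neg
  unfold dFun
  rw [h]
  rfl

end

variable {n : ℕ} {M N : Type*}
  [TopologicalSpace M] [ChartedSpace (EuclideanSpace ℝ (Fin (2 * n + 1))) M]
  [IsManifold (𝓡 (2 * n + 1)) ∞ M]
  [TopologicalSpace N] [ChartedSpace (EuclideanSpace ℝ (Fin (2 * n))) N]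
  [IsManifold (𝓡 (2 * n)) ∞ N] {D : BoothbyWang n M N}

namespace BoothbyWang

/-- The chart in the definition of `laplacian` changes with the point. Smoothness is obtained
instead from `M`, where the pullback is a divergence, and descends. -/
lemma contMDiff_laplacian {f : N → ℝ} (hf : ContMDiff (𝓡 (2 * n)) 𝓘(ℝ, ℝ) ∞ f) :
    ContMDiff (𝓡 (2 * n)) 𝓘(ℝ, ℝ) ∞ (laplacian D.gN f) :=
  contMDiff_of_comp_proj (D := D) ((hasDivergence_grad hf).contMDiff
    (smoothField_grad D.gM (invariant_comp_proj hf).smooth))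

lemma contMDiff_poissonBracket {f h : N → ℝ} (hf : ContMDiff (𝓡 (2 * n)) 𝓘(ℝ, ℝ) ∞ f)
    (hh : ContMDiff (𝓡 (2 * n)) 𝓘(ℝ, ℝ) ∞ h) :
    ContMDiff (𝓡 (2 * n)) 𝓘(ℝ, ℝ) ∞ (poissonBracket D.Ω f h) := by
  refine contMDiff_of_comp_proj (D := D) ?_
  have : poissonBracket D.Ω f h ∘ D.proj = fun x => dFun (h ∘ D.proj) x (D.S (f ∘ D.proj) x) :=
    funext fun x => poissonBracket_proj hf hh x
  rw [this]
  exact contMDiff_dFun (hh.comp D.proj_smooth) (invariant_comp_proj hf).smoothField_S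

variable {p q : M → ℝ} {ψ : N → ℝ}

lemma IsCocyclePair.invariant_p (h : D.IsCocyclePair p q ψ) : D.Invariant p :=
  ⟨h.p_smooth, h.p_invariant⟩

lemma IsCocyclePair.invariant_q (h : D.IsCocyclePair p q ψ) : D.Invariant q :=
  ⟨h.q_smooth, h.q_invariant⟩

lemma IsCocyclePair.dFun_eq (h : D.IsCocyclePair p q ψ) (x : M) :
    dFun q x (D.S p x) = ψ (D.proj x) := by
  rw [← h.bracket, contactBracket, h.p_invariant, mul_zero, sub_zero]

/-- No regularity of `ψ` is assumed: it descends from the contact bracket of `p` and `q`. -/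
lemma IsCocyclePair.smooth (h : D.IsCocyclePair p q ψ) :
    ContMDiff (𝓡 (2 * n)) 𝓘(ℝ, ℝ) ∞ ψ := by
  refine contMDiff_of_comp_proj (D := D) ?_
  have : ψ ∘ D.proj = fun x => dFun q x (D.S p x) := funext fun x => (h.dFun_eq x).symm
  rw [this]
  exact contMDiff_dFun h.q_smooth h.invariant_p.smoothField_S

lemma Invariant.neg {F : M → ℝ} (hF : D.Invariant F) : D.Invariant (fun x => -F x) :=
  ⟨hF.smooth.neg, fun x => by rw [dFun_neg, hF.reeb, neg_zero]⟩

lemma Invariant.S_neg {F : M → ℝ} (hF : D.Invariant F) : D.S (fun x => -F x) = -D.S F := by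
  funext x
  refine (D.S_unique ?_ fun w => ?_).symm
  · rw [Pi.neg_apply, map_neg, D.θ_S]
  · rw [Pi.neg_apply, hF.neg.reeb, dFun_neg, D.dForm_eq, map_neg, neg_apply, ← D.dForm_eq,
      hF.dForm_S]
    ring

lemma Invariant.S_eq_zero_of_notMem_tsupport {F : M → ℝ} {x : M} (hF : D.Invariant F)
    (hx : x ∉ tsupport F) : D.S F x = 0 := by
  refine D.eq_zero_of_dForm ?_ fun w => ?_
  · rw [D.θ_S, image_eq_zero_of_notMem_tsupport hx]
  · rw [hF.dForm_S, dFun_eq_zero_of_notMem_tsupport hx, neg_zero]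

variable [T2Space M] [SigmaCompactSpace M] [MeasurableSpace M] [BorelSpace M]
  {μ : Measure M} (hμ : IsRiemannianVolume D.gM μ)

-- Contact fields are divergence free, so applying the divergence theorem to `G Q` leaves no extra
-- term; only `G` needs compact support.
include hμ in
lemma Invariant.integral_dFun_mul {F G Q : M → ℝ} (hF : D.Invariant F)
    (hG : ContMDiff (𝓡 (2 * n + 1)) 𝓘(ℝ, ℝ) ∞ G) (hQ : ContMDiff (𝓡 (2 * n + 1)) 𝓘(ℝ, ℝ) ∞ Q)
    (hc : HasCompactSupport G) :
    ∫ x, dFun G x (D.S F x) * Q x ∂μ = -∫ x, G x * dFun Q x (D.S F x) ∂μ := by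
  have h := hF.isQuantField.hasDivergence.integral_eq_zero hμ hF.smoothField_S (hG.mul hQ)
    hc.mul_right
  have e : ∀ x, dFun (G * Q) x (D.S F x) + (G * Q) x * 0 =
      G x * dFun Q x (D.S F x) + dFun G x (D.S F x) * Q x := by
    intro x
    have := dFun_mul hG hQ x (D.S F x)
    change dFun (fun x => G x * Q x) x (D.S F x) + _ = _
    rw [this]; ring
  simp only [e] at h
  have hi1 : Integrable (fun x => G x * dFun Q x (D.S F x)) μ := hμ.integrable
    (hG.continuous.mul (contMDiff_dFun hQ hF.smoothField_S).continuous) hc.mul_right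
  have hi2 : Integrable (fun x => dFun G x (D.S F x) * Q x) μ := hμ.integrable
    ((contMDiff_dFun hG hF.smoothField_S).continuous.mul hQ.continuous)
    (hasCompactSupport_dFun hc _).mul_right
  rw [integral_add hi1 hi2] at h
  linarith

include hμ in
/-- The operator `α² - Δ` of the kinetic energy. -/
lemma integral_inner_S {f : N → ℝ} (hf : ContMDiff (𝓡 (2 * n)) 𝓘(ℝ, ℝ) ∞ f) {G : M → ℝ}
    (hG : ContMDiff (𝓡 (2 * n + 1)) 𝓘(ℝ, ℝ) ∞ G) (hc : HasCompactSupport G) :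
    ∫ x, D.gM.inner x (D.lift f x) (D.S G x) ∂μ =
      ∫ x, G x * (D.α ^ 2 * f (D.proj x) - laplacian D.gN f (D.proj x)) ∂μ := by
  have hF := invariant_comp_proj (D := D) hf
  have hgr := smoothField_grad D.gM hF.smooth
  have hdiv := hasDivergence_grad (D := D) hf
  have h := hdiv.integral_eq_zero hμ hgr hG hc
  have hΔ := (hdiv.contMDiff hgr).continuous
  have h1 := contMDiff_dFun hG hgr
  have hi1 : Integrable (fun x => dFun G x (grad D.gM (f ∘ D.proj) x) +
      G x * laplacian D.gN f (D.proj x)) μ := hμ.integrable (h1.continuous.add (hG.continuous.mul hΔ))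
    ((hasCompactSupport_dFun hc _).add hc.mul_right)
  have hi2 : Integrable (fun x => G x * (D.α ^ 2 * f (D.proj x) -
      laplacian D.gN f (D.proj x))) μ := hμ.integrable (hG.continuous.mul ((continuous_const (y := D.α ^ 2)).mul
    hF.smooth.continuous |>.sub hΔ)) hc.mul_right
  -- The first summand is the divergence of `G grad (f ∘ π)`, which integrates to zero.
  have e : ∀ x, D.gM.inner x (D.lift f x) (D.S G x) =
      (dFun G x (grad D.gM (f ∘ D.proj) x) + G x * laplacian D.gN f (D.proj x)) +
      G x * (D.α ^ 2 * f (D.proj x) - laplacian D.gN f (D.proj x)) := by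
    intro x
    refine (hF.inner_S x).trans ?_
    simp only [Function.comp]
    ring
  simp_rw [e]
  rw [integral_add hi1 hi2, h, zero_add]

-- With `H = dG(S f)` the bracket is `S H`. Antisymmetry turns `dq(S H)` into `-dH(S q)`;
-- integrating by parts along `S q` leaves `dp(S q) = -ψ`, and once more along `S f` frees `G` and
-- produces the bracket of `f` with `ψ`.
include hμ in
lemma IsCocyclePair.cocycle_eq (h : D.IsCocyclePair p q ψ) {f : N → ℝ}
    (hf : ContMDiff (𝓡 (2 * n)) 𝓘(ℝ, ℝ) ∞ f) {G : M → ℝ} (hG : D.Invariant G)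
    (hc : HasCompactSupport G) :
    cocycle μ p q (D.lift f) (D.S G) = -∫ x, G x * poissonBracket D.Ω f ψ (D.proj x) ∂μ := by
  have hF := invariant_comp_proj (D := D) hf
  set H : M → ℝ := fun x => dFun G x (D.S (f ∘ D.proj) x) with hH
  have hHi : D.Invariant H := hF.dFun_S hG
  have hHc : HasCompactSupport H := hasCompactSupport_dFun hc _
  have e1 : ∀ x, p x * dFun q x (VectorField.mlieBracket (𝓡 (2 * n + 1)) (D.lift f) (D.S G) x) =
      -(dFun H x (D.S q x) * p x) := by
    intro x
    rw [lift, hF.mlieBracket_S hG, hHi.dFun_S_antisymm h.invariant_q]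
    ring
  have e2 : ∀ x, H x * dFun p x (D.S q x) = -(dFun G x (D.S (f ∘ D.proj) x) * (ψ ∘ D.proj) x) := by
    intro x
    rw [h.invariant_q.dFun_S_antisymm h.invariant_p, h.dFun_eq, hH]
    simp
  rw [cocycle]
  simp_rw [e1]
  rw [integral_neg, neg_neg, h.invariant_q.integral_dFun_mul hμ hHi.smooth h.p_smooth hHc]
  simp_rw [e2]
  rw [integral_neg, neg_neg, hF.integral_dFun_mul hμ hG.smooth (h.smooth.comp D.proj_smooth) hc]
  simp_rw [poissonBracket_proj hf h.smooth]
  rfl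

include hμ in
/-- The weak form of the Euler-Arnold equation. -/
lemma innerExt_sub_eq (h : D.IsCocyclePair p q ψ) {f f' : N → ℝ}
    (hf : ContMDiff (𝓡 (2 * n)) 𝓘(ℝ, ℝ) ∞ f) (hf' : ContMDiff (𝓡 (2 * n)) 𝓘(ℝ, ℝ) ∞ f')
    (c c' : ℝ) {G : M → ℝ} (hG : D.Invariant G) (hc : HasCompactSupport G) (b : ℝ) :
    innerExt D.gM μ (-(D.lift f', c')) (D.S G, b) -
      innerExt D.gM μ (D.lift f, c) (adExt μ p q (D.lift f, c) (D.S G, b)) =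
    ∫ x, G x * (laplacian D.gN f' (D.proj x) - D.α ^ 2 * f' (D.proj x) +
      poissonBracket D.Ω f (fun z => laplacian D.gN f z - D.α ^ 2 * f z) (D.proj x) +
      c * poissonBracket D.Ω f ψ (D.proj x)) ∂μ - c' * b := by
  have hF := invariant_comp_proj (D := D) hf
  have hF' := invariant_comp_proj (D := D) hf'
  set Q : N → ℝ := fun z => laplacian D.gN f z - D.α ^ 2 * f z with hQ
  have hα : ∀ {u : N → ℝ}, ContMDiff (𝓡 (2 * n)) 𝓘(ℝ, ℝ) ∞ u →
      ContMDiff (𝓡 (2 * n)) 𝓘(ℝ, ℝ) ∞ (fun z => laplacian D.gN u z - D.α ^ 2 * u z) := fun hu =>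
    (contMDiff_laplacian hu).sub (contMDiff_const.mul hu)
  have hQs := hα hf
  set H : M → ℝ := fun x => dFun G x (D.S (f ∘ D.proj) x) with hH
  have hHi : D.Invariant H := hF.dFun_S hG
  have hHc : HasCompactSupport H := hasCompactSupport_dFun hc _
  have hπ := D.proj_smooth.continuous
  have h1 : ∫ x, D.gM.inner x (-D.lift f' x) (D.S G x) ∂μ =
      ∫ x, G x * (laplacian D.gN f' (D.proj x) - D.α ^ 2 * f' (D.proj x)) ∂μ := by
    have e : ∀ x, D.gM.inner x (-D.lift f' x) (D.S G x) = -D.gM.inner x (D.lift f' x) (D.S G x) :=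
      fun x => by rw [map_neg, neg_apply]
    simp_rw [e]
    rw [integral_neg, integral_inner_S hμ hf' hG.smooth hc, ← integral_neg]
    refine integral_congr_ae (Eventually.of_forall fun x => ?_)
    ring
  have h2 : ∫ x, D.gM.inner x (D.lift f x)
      (-VectorField.mlieBracket (𝓡 (2 * n + 1)) (D.lift f) (D.S G) x) ∂μ =
      -∫ x, G x * poissonBracket D.Ω f Q (D.proj x) ∂μ := by
    have e : ∀ x, H x * (D.α ^ 2 * f (D.proj x) - laplacian D.gN f (D.proj x)) =
        -(dFun G x (D.S (f ∘ D.proj) x) * (Q ∘ D.proj) x) := by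
      intro x
      simp only [hH, hQ, Function.comp]
      ring
    have hbr : VectorField.mlieBracket (𝓡 (2 * n + 1)) (D.lift f) (D.S G) = D.S H :=
      hF.mlieBracket_S hG
    have e' : ∀ x, D.gM.inner x (D.lift f x) (-D.S H x) = -D.gM.inner x (D.lift f x) (D.S H x) :=
      fun x => map_neg _ _
    rw [hbr]
    simp_rw [e']
    rw [integral_neg, integral_inner_S hμ hf hHi.smooth hHc]
    simp_rw [e]
    rw [integral_neg, hF.integral_dFun_mul hμ hG.smooth (hQs.comp D.proj_smooth) hc]
    have hb : ∀ x, poissonBracket D.Ω f Q (D.proj x) = dFun (Q ∘ D.proj) x (D.lift f x) :=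
      fun x => poissonBracket_proj hf hQs x
    simp_rw [hb]
    rw [neg_neg]
    rfl
  have hi : ∀ {u : N → ℝ}, ContMDiff (𝓡 (2 * n)) 𝓘(ℝ, ℝ) ∞ u →
      Integrable (fun x => G x * u (D.proj x)) μ := fun hu =>
    hμ.integrable (hG.smooth.continuous.mul (hu.continuous.comp hπ)) hc.mul_right
  have h3 : ∫ x, G x * (laplacian D.gN f' (D.proj x) - D.α ^ 2 * f' (D.proj x) +
      poissonBracket D.Ω f Q (D.proj x) + c * poissonBracket D.Ω f ψ (D.proj x)) ∂μ =
      ∫ x, G x * (laplacian D.gN f' (D.proj x) - D.α ^ 2 * f' (D.proj x)) ∂μ +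
      ∫ x, G x * poissonBracket D.Ω f Q (D.proj x) ∂μ +
      c * ∫ x, G x * poissonBracket D.Ω f ψ (D.proj x) ∂μ := by
    have i1 := hi (hα hf')
    have i2 := hi (contMDiff_poissonBracket (D := D) hf hQs)
    have i3 := (hi (contMDiff_poissonBracket (D := D) hf h.smooth)).const_mul c
    have i12 : Integrable (fun x => G x * (laplacian D.gN f' (D.proj x) - D.α ^ 2 * f' (D.proj x)) +
      G x * poissonBracket D.Ω f Q (D.proj x)) μ := i1.add i2
    rw [← integral_const_mul, ← integral_add i1 i2, ← integral_add i12 i3]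
    refine integral_congr_ae (Eventually.of_forall fun x => ?_)
    simp only
    ring
  have h4 := h.cocycle_eq hμ hf hG hc
  rw [h3]
  simp only [innerExt, adExt, Prod.fst_neg, Prod.snd_neg, Pi.neg_apply, h1, h2, h4]
  ring

-- Compactly supported fields preserving `θ` are the `S G` with `G = θ(v)` invariant and compactly
-- supported, so the weak form covers every admissible `V`. Conversely, pullbacks of functions on
-- `N` suffice as test functions.
include hμ in
lemma isAdTranspose_iff [T2Space N] (h : D.IsCocyclePair p q ψ) {f f' : N → ℝ}
    (hf : ContMDiff (𝓡 (2 * n)) 𝓘(ℝ, ℝ) ∞ f) (hf' : ContMDiff (𝓡 (2 * n)) 𝓘(ℝ, ℝ) ∞ f')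
    (c c' : ℝ) :
    IsAdTranspose D.θ D.gM μ p q (D.lift f, c) (D.lift f, c) (-(D.lift f', c')) ↔
      c' = 0 ∧ ∀ z, laplacian D.gN f' z - D.α ^ 2 * f' z +
        poissonBracket D.Ω f (fun z => laplacian D.gN f z - D.α ^ 2 * f z) z +
        c * poissonBracket D.Ω f ψ z = 0 := by
  have hQs : ∀ {u : N → ℝ}, ContMDiff (𝓡 (2 * n)) 𝓘(ℝ, ℝ) ∞ u →
      ContMDiff (𝓡 (2 * n)) 𝓘(ℝ, ℝ) ∞ (fun z => laplacian D.gN u z - D.α ^ 2 * u z) := fun hu =>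
    (contMDiff_laplacian hu).sub (contMDiff_const.mul hu)
  have hsupp : ∀ {G : M → ℝ}, D.Invariant G → HasCompactSupport G →
      CompactlySupported (D.S G) := fun hG hc =>
    ⟨_, hc, fun x hx => hG.S_eq_zero_of_notMem_tsupport hx⟩
  constructor
  · rintro ⟨-, hV⟩
    have key : ∀ {G : M → ℝ}, D.Invariant G → HasCompactSupport G → ∀ b : ℝ, _ := fun hG hc b =>
      (innerExt_sub_eq hμ h hf hf' c c' hG hc b).symm.trans
        (sub_eq_zero.2 (hV (D.S _, b) hG.isQuantField (hsupp hG hc)))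
    -- The test vector is the central element: `G = 0`, `b = 1`.
    have hc0 : c' = 0 := by
      have h0 : D.Invariant (fun _ : M => (0 : ℝ)) := invariant_comp_proj
        (f := fun _ => (0 : ℝ)) contMDiff_const
      have := key h0 (HasCompactSupport.intro isCompact_empty fun _ _ => rfl) 1
      simpa using this
    refine ⟨hc0, fun z => ?_⟩
    refine D.eq_zero_of_integral_eq_zero hμ (h := fun z => laplacian D.gN f' z - D.α ^ 2 * f' z +
        poissonBracket D.Ω f (fun z => laplacian D.gN f z - D.α ^ 2 * f z) z +
        c * poissonBracket D.Ω f ψ z)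
      (((hQs hf').add (contMDiff_poissonBracket hf (hQs hf))).add
        (contMDiff_const.mul (contMDiff_poissonBracket hf h.smooth))) (fun g hg hgc => ?_) z
    have := key (invariant_comp_proj hg) hgc 0
    rwa [mul_zero, sub_zero] at this
  · rintro ⟨rfl, hW⟩
    have hF' := invariant_comp_proj (D := D) hf'
    refine ⟨?_, ?_⟩
    · have := hF'.neg.isQuantField
      rwa [hF'.S_neg] at this
    · rintro ⟨v, b⟩ hv ⟨K, hK, hKv⟩
      change IsQuantField D.θ v at hv
      change ∀ x ∉ K, v x = 0 at hKv
      have hG := hv.invariant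
      have hGc : HasCompactSupport (fun x => D.θ x (v x)) :=
        HasCompactSupport.intro hK fun x hx => by rw [hKv x hx, map_zero]
      have := innerExt_sub_eq hμ h hf hf' c 0 hG hGc b
      simp only [hW, mul_zero, integral_zero, zero_mul, sub_zero] at this
      rw [← hv.eq_S] at this
      exact sub_eq_zero.1 this

end BoothbyWang

end WeakForm

/-! ### Time derivatives of stream functions and their fields. -/

section TimeDerivative

section Calculus

variable {E : Type*} [NormedAddCommGroup E] [NormedSpace ℝ E] {u : ℝ × E → ℝ} {t : ℝ} {y : E}

lemma fderiv_comp_prodMk (hu : DifferentiableAt ℝ u (t, y)) (v : E) :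
    fderiv ℝ (fun z => u (t, z)) y v = fderiv ℝ u (t, y) (0, v) := by
  have h : HasFDerivAt (fun z => u (t, z)) _ y :=
    HasFDerivAt.comp (g := u) (f := fun z : E => (t, z)) y hu.hasFDerivAt
      (hasFDerivAt_prodMk_right t y)
  rw [h.fderiv]
  simp

lemma hasDerivAt_comp_prodMk (hu : DifferentiableAt ℝ u (t, y)) :
    HasDerivAt (fun s => u (s, y)) (fderiv ℝ u (t, y) (1, 0)) t :=
  HasFDerivAt.comp_hasDerivAt (l := u) (f := fun s : ℝ => (s, y)) t hu.hasFDerivAt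
    ((hasDerivAt_id t).prodMk (hasDerivAt_const t y))

lemma ContDiffAt.eventually_differentiableAt (hu : ContDiffAt ℝ ∞ u (t, y)) :
    ∀ᶠ p in 𝓝 (t, y), DifferentiableAt ℝ u p := by
  filter_upwards [(hu.of_le (m := 1) (by exact_mod_cast le_top)).eventually (by simp)] with p hp
  exact hp.differentiableAt (by simp)

lemma contDiffAt_deriv_fst (hu : ContDiffAt ℝ ∞ u (t, y)) :
    ContDiffAt ℝ ∞ (fun z => deriv (fun s => u (s, z)) t) y := by
  have h1 : ContDiffAt ℝ ∞ (fun z : E => fderiv ℝ u (t, z) (1, 0)) y :=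
    ((hu.fderiv_right (m := ∞) (by simp)).comp (f := fun z : E => (t, z)) y
      (contDiff_const.prodMk contDiff_id).contDiffAt).clm_apply contDiffAt_const
  refine h1.congr_of_eventuallyEq ?_
  have h2 : ContinuousAt (fun z : E => (t, z)) y := by fun_prop
  filter_upwards [h2.eventually (ContDiffAt.eventually_differentiableAt hu)] with z hz
  exact (hasDerivAt_comp_prodMk hz).deriv

lemma contDiffAt_fderiv_snd (hu : ContDiffAt ℝ ∞ u (t, y)) (v : E) :
    ContDiffAt ℝ ∞ (fun p : ℝ × E => fderiv ℝ (fun z => u (p.1, z)) p.2 v) (t, y) := by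
  have h1 : ContDiffAt ℝ ∞ (fun p : ℝ × E => fderiv ℝ u p (0, v)) (t, y) :=
    (hu.fderiv_right (m := ∞) (by simp)).clm_apply contDiffAt_const
  refine h1.congr_of_eventuallyEq ?_
  filter_upwards [ContDiffAt.eventually_differentiableAt hu] with p hp
  exact fderiv_comp_prodMk hp v

/-- Derivatives in time and in space commute. -/
lemma hasDerivAt_fderiv_snd (hu : ContDiffAt ℝ ∞ u (t, y)) (v : E) :
    HasDerivAt (fun s => fderiv ℝ (fun z => u (s, z)) y v)
      (fderiv ℝ (fun z => deriv (fun s => u (s, z)) t) y v) t := by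
  have hu' : DifferentiableAt ℝ (fderiv ℝ u) (t, y) :=
    (hu.fderiv_right (m := ∞) (by simp)).differentiableAt (by simp)
  have h1 : HasFDerivAt (fun z : E => fderiv ℝ u (t, z) (1, 0)) _ y :=
    (HasFDerivAt.comp (g := fderiv ℝ u) (f := fun z : E => (t, z)) y hu'.hasFDerivAt
      (hasFDerivAt_prodMk_right t y)).clm_apply (hasFDerivAt_const _ y)
  have h2 : HasDerivAt (fun s : ℝ => fderiv ℝ u (s, y) (0, v)) _ t :=
    (HasFDerivAt.comp_hasDerivAt (l := fderiv ℝ u) (f := fun s : ℝ => (s, y)) t hu'.hasFDerivAt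
      ((hasDerivAt_id t).prodMk (hasDerivAt_const t y))).clm_apply (hasDerivAt_const t (0, v))
  have hev := ContDiffAt.eventually_differentiableAt hu
  have hcs : ContinuousAt (fun s : ℝ => (s, y)) t := by fun_prop
  have hcz : ContinuousAt (fun z : E => (t, z)) y := by fun_prop
  have e1 : (fun z => deriv (fun s => u (s, z)) t) =ᶠ[𝓝 y] fun z => fderiv ℝ u (t, z) (1, 0) := by
    filter_upwards [hcz.eventually hev] with z hz using (hasDerivAt_comp_prodMk hz).deriv
  have e2 : (fun s => fderiv ℝ (fun z => u (s, z)) y v) =ᶠ[𝓝 t]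
      fun s => fderiv ℝ u (s, y) (0, v) := by
    filter_upwards [hcs.eventually hev] with s hs using fderiv_comp_prodMk hs v
  rw [e1.fderiv_eq, h1.fderiv]
  refine (h2.congr_of_eventuallyEq e2).congr_deriv ?_
  have hsym := (hu.isSymmSndFDerivAt (by simpa using two_le_infty)) (1, 0) (0, v)
  simpa using hsym

end Calculus

section Manifold

variable {d : ℕ} {N : Type*} [TopologicalSpace N] [ChartedSpace (EuclideanSpace ℝ (Fin d)) N]
  [IsManifold (𝓡 d) ∞ N] {J : Set ℝ} {f : ℝ → N → ℝ}

lemma contDiffAt_uncurry_symm (hJ : IsOpen J)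
    (hf : ContMDiffOn (𝓘(ℝ, ℝ).prod (𝓡 d)) 𝓘(ℝ, ℝ) ∞ (Function.uncurry f) (J ×ˢ univ))
    {t : ℝ} (ht : t ∈ J) {x₀ : N} {y : EuclideanSpace ℝ (Fin d)}
    (hy : y ∈ (extChartAt (𝓡 d) x₀).target) :
    ContDiffAt ℝ ∞ (fun p : ℝ × EuclideanSpace ℝ (Fin d) =>
      f p.1 ((extChartAt (𝓡 d) x₀).symm p.2)) (t, y) := by
  have h1 : ContMDiffAt 𝓘(ℝ, ℝ × EuclideanSpace ℝ (Fin d)) (𝓘(ℝ, ℝ).prod (𝓡 d)) ∞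
      (fun p : ℝ × EuclideanSpace ℝ (Fin d) => (p.1, (extChartAt (𝓡 d) x₀).symm p.2)) (t, y) := by
    refine ContMDiffAt.prodMk contDiffAt_fst.contMDiffAt ?_
    exact ContMDiffAt.comp (t, y) (g := (extChartAt (𝓡 d) x₀).symm)
      ((contMDiffOn_symm x₀).contMDiffAt ((isOpen_target x₀).mem_nhds hy))
      contDiffAt_snd.contMDiffAt
  have h2 : ContMDiffAt (𝓘(ℝ, ℝ).prod (𝓡 d)) 𝓘(ℝ, ℝ) ∞ (Function.uncurry f)
      (t, (extChartAt (𝓡 d) x₀).symm y) :=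
    hf.contMDiffAt ((hJ.prod isOpen_univ).mem_nhds ⟨ht, mem_univ _⟩)
  exact (ContMDiffAt.comp (t, y) h2 h1).contDiffAt

lemma contMDiff_of_uncurry (hJ : IsOpen J)
    (hf : ContMDiffOn (𝓘(ℝ, ℝ).prod (𝓡 d)) 𝓘(ℝ, ℝ) ∞ (Function.uncurry f) (J ×ˢ univ))
    {t : ℝ} (ht : t ∈ J) : ContMDiff (𝓡 d) 𝓘(ℝ, ℝ) ∞ (f t) := by
  refine contMDiff_of_comp_symm fun x₀ y hy => ContDiffAt.contDiffWithinAt ?_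
  exact ContDiffAt.comp (f := fun z : EuclideanSpace ℝ (Fin d) => (t, z)) y
    (contDiffAt_uncurry_symm hJ hf ht hy) (contDiff_const.prodMk contDiff_id).contDiffAt

lemma contMDiff_deriv (hJ : IsOpen J)
    (hf : ContMDiffOn (𝓘(ℝ, ℝ).prod (𝓡 d)) 𝓘(ℝ, ℝ) ∞ (Function.uncurry f) (J ×ˢ univ))
    {t : ℝ} (ht : t ∈ J) : ContMDiff (𝓡 d) 𝓘(ℝ, ℝ) ∞ (fun z => deriv (fun s => f s z) t) :=
  contMDiff_of_comp_symm fun _ _ hy =>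
    (contDiffAt_deriv_fst (contDiffAt_uncurry_symm hJ hf ht hy)).contDiffWithinAt

lemma hasDerivAt_of_uncurry (hJ : IsOpen J)
    (hf : ContMDiffOn (𝓘(ℝ, ℝ).prod (𝓡 d)) 𝓘(ℝ, ℝ) ∞ (Function.uncurry f) (J ×ˢ univ))
    {t : ℝ} (ht : t ∈ J) (z : N) :
    HasDerivAt (fun s => f s z) (deriv (fun s => f s z) t) t := by
  obtain ⟨x₀, y, hy, rfl⟩ := exists_chart_point (d := d) z
  exact (hasDerivAt_comp_prodMk ((contDiffAt_uncurry_symm hJ hf ht hy).differentiableAt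
    (by simp))).differentiableAt.hasDerivAt

lemma hasDerivAt_dFun (hJ : IsOpen J)
    (hf : ContMDiffOn (𝓘(ℝ, ℝ).prod (𝓡 d)) 𝓘(ℝ, ℝ) ∞ (Function.uncurry f) (J ×ˢ univ))
    {t : ℝ} (ht : t ∈ J) (z : N) (v : TangentSpace (𝓡 d) z) :
    HasDerivAt (fun s => dFun (f s) z v) (dFun (fun z => deriv (fun s => f s z) t) z v) t := by
  obtain ⟨x₀, y, hy, rfl⟩ := exists_chart_point (d := d) z
  obtain ⟨w, rfl⟩ : ∃ w, pull x₀ y w = v := ⟨_, pull_push hy v⟩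
  have h := hasDerivAt_fderiv_snd (contDiffAt_uncurry_symm hJ hf ht hy) w
  rw [← fderiv_comp_symm hy (mdifferentiableAt_of_smooth (contMDiff_deriv hJ hf ht) _)]
  refine h.congr_of_eventuallyEq ?_
  filter_upwards [hJ.mem_nhds ht] with s hs
  exact (fderiv_comp_symm hy (mdifferentiableAt_of_smooth (contMDiff_of_uncurry hJ hf hs) _) w).symm

lemma contDiffOn_inv_bilinMat (g : RMetric d N) (x₀ : N) (i j : Fin d) :
    ContDiffOn ℝ ∞ (fun y => (bilinMat (metricInChart g x₀ y))⁻¹ i j)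
      (extChartAt (𝓡 d) x₀).target := by
  -- Column `j` of the inverse Gram matrix is the vector that the metric pairs into the `j`-th
  -- coordinate functional, hence a smooth solution of a linear system.
  have h : ContDiffOn ℝ ∞ (fun y => (WithLp.toLp 2 fun i => (bilinMat (metricInChart g x₀ y))⁻¹ i j :
      EuclideanSpace ℝ (Fin d))) (extChartAt (𝓡 d) x₀).target := by
    refine contDiffOn_of_clm_apply_eq (contDiffOn_metricInChart g x₀)
      (b := fun _ => (EuclideanSpace.proj j : EuclideanSpace ℝ (Fin d) →L[ℝ] ℝ))
      contDiffOn_const ?_ ?_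
    · intro y hy v hv
      by_contra hne
      have := metricInChart_pos g hy hne
      rw [hv] at this
      simp at this
    · intro y hy
      ext w
      have hdet : IsUnit (bilinMat (metricInChart g x₀ y)).det :=
        isUnit_iff_ne_zero.2 (density_pos g hy).ne'
      set u : EuclideanSpace ℝ (Fin d) :=
        WithLp.toLp 2 fun i => (bilinMat (metricInChart g x₀ y))⁻¹ i j with hu
      have h1 : ∀ a, metricInChart g x₀ y u (EuclideanSpace.single a 1) =
          (1 : Matrix (Fin d) (Fin d) ℝ) a j := by
        intro a
        rw [metricInChart_comm, ← bilinMat_mulVec, ← Matrix.mul_nonsing_inv _ hdet,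
          Matrix.mul_apply]
        rfl
      rw [clm_apply_eq_sum (metricInChart g x₀ y u) w]
      simp [h1, Matrix.one_apply]
  exact (EuclideanSpace.proj i : EuclideanSpace ℝ (Fin d) →L[ℝ] ℝ).contDiff.comp_contDiffOn h

/-- The metric coefficients do not depend on time, so mixed derivatives are exchanged twice: for the
outer derivative of `W`, then for the derivatives of `f` inside it. -/
lemma hasDerivAt_laplacian (hJ : IsOpen J)
    (hf : ContMDiffOn (𝓘(ℝ, ℝ).prod (𝓡 d)) 𝓘(ℝ, ℝ) ∞ (Function.uncurry f) (J ×ˢ univ))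
    {t : ℝ} (ht : t ∈ J) (g : RMetric d N) (x : N) :
    HasDerivAt (fun s => laplacian g (f s) x)
      (laplacian g (fun z => deriv (fun s => f s z) t) x) t := by
  set y := extChartAt (𝓡 d) x x with hy
  have hyt : y ∈ (extChartAt (𝓡 d) x).target := mem_extChartAt_target x
  set a : Fin d → Fin d → EuclideanSpace ℝ (Fin d) → ℝ := fun i j z =>
    Real.sqrt (density g x z) * (bilinMat (metricInChart g x z))⁻¹ i j with ha
  have has : ∀ i j, ContDiffOn ℝ ∞ (a i j) (extChartAt (𝓡 d) x).target := fun i j =>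
    (contDiffOn_sqrt_density g x).mul (contDiffOn_inv_bilinMat g x i j)
  have hlap : ∀ h : N → ℝ, laplacian g h x = (Real.sqrt (density g x y))⁻¹ *
      ∑ i, fderiv ℝ (fun z => ∑ j, a i j z *
        fderiv ℝ (fun z => h ((extChartAt (𝓡 d) x).symm z)) z (EuclideanSpace.single j 1)) y
        (EuclideanSpace.single i 1) := by
    intro h
    have e : ∀ i z, (∑ j, a i j z * fderiv ℝ (fun z => h ((extChartAt (𝓡 d) x).symm z)) z
        (EuclideanSpace.single j 1)) = Real.sqrt (density g x z) *
        ∑ j, (bilinMat (metricInChart g x z))⁻¹ i j *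
          fderiv ℝ (fun z => h ((extChartAt (𝓡 d) x).symm z)) z (EuclideanSpace.single j 1) := by
      intro i z
      rw [Finset.mul_sum]
      exact Finset.sum_congr rfl fun j _ => by simp only [ha]; ring
    simp_rw [e]
    rfl
  simp_rw [hlap]
  refine HasDerivAt.const_mul _ (HasDerivAt.fun_sum fun i _ => ?_)
  set W : ℝ × EuclideanSpace ℝ (Fin d) → ℝ := fun p => ∑ j, a i j p.2 *
    fderiv ℝ (fun z => f p.1 ((extChartAt (𝓡 d) x).symm z)) p.2 (EuclideanSpace.single j 1) with hW
  have hu : ∀ z ∈ (extChartAt (𝓡 d) x).target, ContDiffAt ℝ ∞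
      (fun p : ℝ × EuclideanSpace ℝ (Fin d) => f p.1 ((extChartAt (𝓡 d) x).symm p.2)) (t, z) :=
    fun z hz => contDiffAt_uncurry_symm hJ hf ht hz
  have hWs : ContDiffAt ℝ ∞ W (t, y) := by
    refine ContDiffAt.sum fun j _ => ContDiffAt.mul ?_ (contDiffAt_fderiv_snd (hu y hyt) _)
    exact ((has i j).contDiffAt ((isOpen_target x).mem_nhds hyt)).comp (t, y) contDiffAt_snd
  have h1 := hasDerivAt_fderiv_snd hWs (EuclideanSpace.single i 1)
  have h2 : (fun z => deriv (fun s => W (s, z)) t) =ᶠ[𝓝 y] fun z => ∑ j, a i j z *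
      fderiv ℝ (fun z => deriv (fun s => f s ((extChartAt (𝓡 d) x).symm z)) t) z
        (EuclideanSpace.single j 1) := by
    filter_upwards [(isOpen_target x).mem_nhds hyt] with z hz
    exact HasDerivAt.deriv (HasDerivAt.fun_sum fun j _ =>
      (hasDerivAt_fderiv_snd (hu z hz) _).const_mul (a i j z))
  rw [h2.fderiv_eq] at h1
  exact h1

end Manifold

variable {n : ℕ} {M N : Type*}
  [TopologicalSpace M] [ChartedSpace (EuclideanSpace ℝ (Fin (2 * n + 1))) M]
  [IsManifold (𝓡 (2 * n + 1)) ∞ M]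
  [TopologicalSpace N] [ChartedSpace (EuclideanSpace ℝ (Fin (2 * n))) N]
  [IsManifold (𝓡 (2 * n)) ∞ N] (D : BoothbyWang n M N)

namespace BoothbyWang

/-- The contact field at a point depends linearly on the 1-jet of the function. -/
lemma exists_S_eq_sum (x : M) : ∃ a : Fin (2 * n + 1) → TangentSpace (𝓡 (2 * n + 1)) x,
    ∀ F : M → ℝ, D.S F x = F x • D.reeb x -
      ∑ k, dFun F x (EuclideanSpace.single k (1 : ℝ)) • a k := by
  have hr : ∀ k, ∃ r, ∀ w, D.gM.inner x r w =
      (EuclideanSpace.proj k : EuclideanSpace ℝ (Fin (2 * n + 1)) →L[ℝ] ℝ) w := fun k =>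
    exists_inner_eq D.gM x (EuclideanSpace.proj k : EuclideanSpace ℝ (Fin (2 * n + 1)) →L[ℝ] ℝ)
  choose r hr using hr
  refine ⟨fun k => D.phi x (r k), fun F => ?_⟩
  have h : grad D.gM F x = ∑ k, dFun F x (EuclideanSpace.single k (1 : ℝ)) • r k := by
    rw [← sub_eq_zero]
    refine eq_zero_of_inner_self D.gM ?_
    have h0 : ∀ w, D.gM.inner x (grad D.gM F x -
        ∑ k, dFun F x (EuclideanSpace.single k (1 : ℝ)) • r k) w = 0 := by
      intro w
      rw [map_sub, sub_apply, inner_grad, map_sum, sum_apply]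
      simp only [map_smul, smul_apply, hr]
      rw [sub_eq_zero]
      refine (clm_apply_eq_sum (F := ℝ) (dFun F x) w).trans ?_
      refine Finset.sum_congr rfl fun k _ => ?_
      exact mul_comm _ _
    exact h0 _
  rw [D.S_eq, h, map_sum]
  simp only [map_smul]

/-- At a fixed point the contact field is a fixed finite linear combination of the value and first
derivatives of the stream function, each differentiable in time. -/
lemma velocity_lift {J : Set ℝ} (hJ : IsOpen J) {f : ℝ → N → ℝ}
    (hf : ContMDiffOn (𝓘(ℝ, ℝ).prod (𝓡 (2 * n))) 𝓘(ℝ, ℝ) ∞ (Function.uncurry f) (J ×ˢ univ))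
    (c : ℝ → ℝ) {t : ℝ} (ht : t ∈ J) :
    velocity (fun t => (D.lift (f t), c t)) t =
      (D.lift (fun z => deriv (fun s => f s z) t), deriv c t) := by
  refine Prod.ext (funext fun x => ?_) rfl
  obtain ⟨a', ha⟩ := D.exists_S_eq_sum x
  let a : Fin (2 * n + 1) → EuclideanSpace ℝ (Fin (2 * n + 1)) := a'
  let r : EuclideanSpace ℝ (Fin (2 * n + 1)) := D.reeb x
  have h : HasDerivAt (fun s => (f s (D.proj x) • r -
      ∑ k, dFun (f s) (D.proj x) (D.dproj x (EuclideanSpace.single k (1 : ℝ))) • a k :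
        EuclideanSpace ℝ (Fin (2 * n + 1))))
      (deriv (fun s => f s (D.proj x)) t • r -
      ∑ k, dFun (fun z => deriv (fun s => f s z) t) (D.proj x)
        (D.dproj x (EuclideanSpace.single k (1 : ℝ))) • a k) t := by
    refine ((hasDerivAt_of_uncurry hJ hf ht (D.proj x)).smul_const _).sub
      (HasDerivAt.fun_sum fun k _ => ?_)
    exact (hasDerivAt_dFun hJ hf ht (D.proj x) _).smul_const (a k)
  have e : ∀ {h : N → ℝ}, ContMDiff (𝓡 (2 * n)) 𝓘(ℝ, ℝ) ∞ h → (D.lift h x : EuclideanSpace ℝ (Fin (2 * n + 1))) =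
      h (D.proj x) • r -
      ∑ k, dFun h (D.proj x) (D.dproj x (EuclideanSpace.single k (1 : ℝ))) • a k := by
    intro h hh
    refine (ha (h ∘ D.proj)).trans ?_
    exact congrArg (fun v : EuclideanSpace ℝ (Fin (2 * n + 1)) => h (D.proj x) • r - v)
      (Finset.sum_congr rfl fun k _ => congrArg (· • a k) (dFun_comp_proj hh x _))
  change deriv (F := EuclideanSpace ℝ (Fin (2 * n + 1))) (fun s => D.lift (f s) x) t = _
  refine Eq.trans ?_ (e (contMDiff_deriv hJ hf ht)).symm
  refine (h.congr_of_eventuallyEq ?_).deriv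
  filter_upwards [hJ.mem_nhds ht] with s hs using e (contMDiff_of_uncurry hJ hf hs)

end BoothbyWang

end TimeDerivative

/-! ### The vorticity equation. -/

section EulerArnold

lemma dFun_sub_const_mul {d : ℕ} {M : Type*} [TopologicalSpace M]
    [ChartedSpace (EuclideanSpace ℝ (Fin d)) M] [IsManifold (𝓡 d) ∞ M] {f h : M → ℝ}
    (hf : ContMDiff (𝓡 d) 𝓘(ℝ, ℝ) ∞ f) (hh : ContMDiff (𝓡 d) 𝓘(ℝ, ℝ) ∞ h) (c : ℝ) (x : M)
    (v : TangentSpace (𝓡 d) x) :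
    dFun (fun x => f x - c * h x) x v = dFun f x v - c * dFun h x v := by
  obtain ⟨x₀, y, hy, rfl⟩ := exists_chart_point (d := d) x
  obtain ⟨w, rfl⟩ : ∃ w, pull x₀ y w = v := ⟨_, pull_push hy v⟩
  rw [← fderiv_comp_symm hy (mdifferentiableAt_of_smooth hf _),
    ← fderiv_comp_symm hy (mdifferentiableAt_of_smooth hh _), ← fderiv_comp_symm
    (f := fun x => f x - c * h x) hy
    (mdifferentiableAt_of_smooth (hf.sub (contMDiff_const.mul hh)) _)]
  have h1 : HasFDerivAt (fun y => (fun x => f x - c * h x) ((extChartAt (𝓡 d) x₀).symm y)) _ y :=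
    (differentiableAt_comp_symm hf hy).hasFDerivAt.sub
      ((differentiableAt_comp_symm hh hy).hasFDerivAt.const_mul c)
  rw [h1.fderiv]
  simp

namespace BoothbyWang

variable {n : ℕ} {M N : Type*}
  [TopologicalSpace M] [ChartedSpace (EuclideanSpace ℝ (Fin (2 * n + 1))) M]
  [IsManifold (𝓡 (2 * n + 1)) ∞ M] [T2Space M] [SigmaCompactSpace M]
  [MeasurableSpace M] [BorelSpace M]
  [TopologicalSpace N] [ChartedSpace (EuclideanSpace ℝ (Fin (2 * n))) N]
  [IsManifold (𝓡 (2 * n)) ∞ N] [T2Space N] {D : BoothbyWang n M N}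

/-- The Euler-Arnold equation in terms of the stream function on the quotient. -/
lemma solvesEulerArnold_iff {μ : Measure M} (hμ : IsRiemannianVolume D.gM μ) {p q : M → ℝ}
    {ψ : N → ℝ} (h : D.IsCocyclePair p q ψ) {J : Set ℝ} (hJ : IsOpen J) (hJc : J.OrdConnected)
    {f : ℝ → N → ℝ}
    (hf : ContMDiffOn (𝓘(ℝ, ℝ).prod (𝓡 (2 * n))) 𝓘(ℝ, ℝ) ∞ (Function.uncurry f) (J ×ˢ univ))
    {c : ℝ → ℝ} (hc : DifferentiableOn ℝ c J) :
    SolvesEulerArnold D.θ D.gM μ p q J (fun t => (D.lift (f t), c t)) ↔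
      ∃ β : ℝ, (∀ t ∈ J, c t = -β) ∧ ∀ t ∈ J, ∀ y : N,
        deriv (fun s => D.vorticity β ψ (f s) y) t +
          poissonBracket D.Ω (f t) (D.vorticity β ψ (f t)) y = 0 := by
  have hQs : ∀ {u : N → ℝ}, ContMDiff (𝓡 (2 * n)) 𝓘(ℝ, ℝ) ∞ u →
      ContMDiff (𝓡 (2 * n)) 𝓘(ℝ, ℝ) ∞ (fun z => laplacian D.gN u z - D.α ^ 2 * u z) := fun hu =>
    (contMDiff_laplacian hu).sub (contMDiff_const.mul hu)
  -- The term `-β ψ` drops out of the time derivative, while in the bracket it yields `-β {f, ψ} = c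
  -- {f, ψ}`.
  have key : ∀ β : ℝ, ∀ t ∈ J, c t = -β → ∀ z : N,
      laplacian D.gN (fun z => deriv (fun s => f s z) t) z -
        D.α ^ 2 * deriv (fun s => f s z) t +
        poissonBracket D.Ω (f t) (fun z => laplacian D.gN (f t) z - D.α ^ 2 * f t z) z +
        c t * poissonBracket D.Ω (f t) ψ z =
      deriv (fun s => D.vorticity β ψ (f s) z) t +
          poissonBracket D.Ω (f t) (D.vorticity β ψ (f t)) z := by
    intro β t ht hct z
    have h1 : HasDerivAt (fun s => D.vorticity β ψ (f s) z)
        (laplacian D.gN (fun z => deriv (fun s => f s z) t) z -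
          D.α ^ 2 * deriv (fun s => f s z) t) t :=
      ((hasDerivAt_laplacian hJ hf ht D.gN z).sub
        ((hasDerivAt_of_uncurry hJ hf ht z).const_mul _)).sub_const _
    have h2 : poissonBracket D.Ω (f t) (D.vorticity β ψ (f t)) z =
        poissonBracket D.Ω (f t) (fun z => laplacian D.gN (f t) z - D.α ^ 2 * f t z) z -
          β * poissonBracket D.Ω (f t) ψ z :=
      dFun_sub_const_mul (hQs (contMDiff_of_uncurry hJ hf ht)) h.smooth β z _
    rw [h1.deriv, h2, hct]
    ring
  have heq : SolvesEulerArnold D.θ D.gM μ p q J (fun t => (D.lift (f t), c t)) ↔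
      ∀ t ∈ J, deriv c t = 0 ∧ ∀ z : N,
      laplacian D.gN (fun z => deriv (fun s => f s z) t) z -
        D.α ^ 2 * deriv (fun s => f s z) t +
        poissonBracket D.Ω (f t) (fun z => laplacian D.gN (f t) z - D.α ^ 2 * f t z) z +
        c t * poissonBracket D.Ω (f t) ψ z = 0 := by
    refine forall₂_congr fun t ht => ?_
    rw [D.velocity_lift hJ hf c ht]
    exact isAdTranspose_iff hμ h (contMDiff_of_uncurry hJ hf ht) (contMDiff_deriv hJ hf ht) _ _
  rw [heq]
  constructor
  · intro H
    have hconst : ∃ β : ℝ, ∀ t ∈ J, c t = -β := by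
      -- On empty `J` any `β` would do; otherwise it is read off at one time.
      rcases J.eq_empty_or_nonempty with rfl | ⟨t₀, ht₀⟩
      · exact ⟨0, by simp⟩
      · refine ⟨-c t₀, fun t ht => ?_⟩
        rw [neg_neg]
        exact hJ.is_const_of_deriv_eq_zero hJc.isPreconnected hc (fun s hs => (H s hs).1) ht ht₀
    obtain ⟨β, hβ⟩ := hconst
    exact ⟨β, hβ, fun t ht z => by rw [← key β t ht (hβ t ht)]; exact (H t ht).2 z⟩
  · rintro ⟨β, hβ, H⟩ t ht
    refine ⟨?_, fun z => by rw [key β t ht (hβ t ht)]; exact H t ht z⟩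
    have : c =ᶠ[𝓝 t] fun _ => -β := by
      filter_upwards [hJ.mem_nhds ht] with s hs using hβ s hs
    rw [this.deriv_eq, deriv_const]

end BoothbyWang

/-! ### The plane -/

lemma fderiv_plane (f : Plane → ℝ) (z v : Plane) :
    fderiv ℝ f z v = v 0 * partialX f z + v 1 * partialY f z := by
  rw [clm_apply_eq_sum (fderiv ℝ f z) v]
  simp [partialX, partialY, Fin.sum_univ_two]

lemma dFun_plane (f : Plane → ℝ) (z v : Plane) : dFun (d := 2 * 1) f z v = fderiv ℝ f z v := by
  rw [dFun]
  exact congrArg (fun L : Plane →L[ℝ] ℝ => L v) (mfderiv_eq_fderiv (f := f) (x := z))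

lemma poissonBracket_plane {Ω : TwoForm (2 * 1) Plane} {σ : ℝ} (hσ : σ = 1 ∨ σ = -1)
    (hΩ : ∀ z (v w : Plane), Ω z v w = σ * (v 0 * w 1 - v 1 * w 0)) (f g : Plane → ℝ) (z : Plane) :
    poissonBracket Ω f g z = σ * planeBracket f g z := by
  have hσ2 : σ * σ = 1 := by rcases hσ with rfl | rfl <;> norm_num
  -- An explicit Hamiltonian vector, valid since `σ² = 1`. It shows that the choice in
  -- `hamiltonianField` meets its specification; testing on the basis then determines that choice.
  have hex : ∀ w : Plane, σ * ((!₂[-σ * partialY f z, σ * partialX f z] : Plane) 0 * w 1 -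
      (!₂[-σ * partialY f z, σ * partialX f z] : Plane) 1 * w 0) =
      -dFun (d := 2 * 1) f z w := by
    intro w
    rw [dFun_plane, fderiv_plane]
    simp
    linear_combination (-(w 1 * partialY f z) - w 0 * partialX f z) * hσ2
  set X : Plane := hamiltonianField Ω f z with hX
  have hspec : ∀ w : Plane, Ω z X w = -dFun (d := 2 * 1) f z w := by
    refine Classical.epsilon_spec (p := fun X : TangentSpace (𝓡 (2 * 1)) z =>
      ∀ w, Ω z X w = -(dFun f z w)) ⟨(!₂[-σ * partialY f z, σ * partialX f z] : Plane), fun w => ?_⟩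
    exact (hΩ z _ w).trans (hex w)
  have h0 := hspec (EuclideanSpace.single 0 1)
  have h1 := hspec (EuclideanSpace.single 1 1)
  rw [hΩ, dFun_plane, fderiv_plane] at h0 h1
  simp at h0 h1
  have e : poissonBracket Ω f g z = X 0 * partialX g z + X 1 * partialY g z := by
    rw [← fderiv_plane, ← dFun_plane]
    rfl
  rw [e, planeBracket]
  linear_combination (-(X 0 * partialX g z) - X 1 * partialY g z) * hσ2 +
    σ * partialX g z * h1 + σ * partialY g z * h0

/-- The preferred chart of the plane is the identity, so the Gram matrix is `1` everywhere. -/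
lemma laplacian_plane {g : RMetric (2 * 1) Plane}
    (hg : ∀ z (v w : Plane), g.inner z v w = inner ℝ v w) (f : Plane → ℝ) (z : Plane) :
    laplacian g f z = planeLaplacian f z := by
  have hgram : ∀ y, gramMatrix g (chartAt Plane z) y = 1 := by
    intro y
    ext i j
    rw [gramMatrix, Matrix.of_apply]
    have hs : mfderiv (𝓡 (2 * 1)) (𝓡 (2 * 1)) (chartAt Plane z).symm y =
        ContinuousLinearMap.id ℝ Plane := by
      rw [chartAt_self_eq]
      exact mfderiv_id
    rw [hs]
    refine (hg _ _ _).trans ?_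
    change inner ℝ (EuclideanSpace.single i (1 : ℝ) : Plane) (EuclideanSpace.single j 1) = _
    simp [Matrix.one_apply, EuclideanSpace.inner_single_left]
  unfold laplacian
  simp only [hgram]
  simp [chartAt_self_eq, Matrix.one_apply, Fin.sum_univ_two, planeLaplacian]
  rfl

/-- The bracket of `f` with itself vanishes, and its bracket with the coordinate `y` is `∂_x f`. -/
lemma planeBracket_vorticity {f w : Plane → ℝ} {z : Plane} (hf : DifferentiableAt ℝ f z)
    (hw : DifferentiableAt ℝ w z) (a β : ℝ) :
    planeBracket f (fun z => w z - a * f z - β * z 1) z =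
      planeBracket f w z - β * partialX f z := by
  have h1 : HasFDerivAt (fun z : Plane => z 1)
      (EuclideanSpace.proj 1 : Plane →L[ℝ] ℝ) z :=
    (EuclideanSpace.proj 1 : Plane →L[ℝ] ℝ).hasFDerivAt
  have h : HasFDerivAt (fun z : Plane => w z - a * f z - β * z 1) _ z :=
    (hw.hasFDerivAt.sub (hf.hasFDerivAt.const_mul a)).sub (h1.const_mul β)
  simp only [planeBracket, partialX, partialY, h.fderiv]
  simp
  ring

/-- The `β`-plane quasigeostrophic equation as an Euler-Arnold equation. -/
lemma solvesEulerArnold_plane_iff {M : Type*}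
    [TopologicalSpace M] [ChartedSpace (EuclideanSpace ℝ (Fin (2 * 1 + 1))) M]
    [IsManifold (𝓡 (2 * 1 + 1)) ∞ M] [T2Space M] [SigmaCompactSpace M]
    [MeasurableSpace M] [BorelSpace M] {D : BoothbyWang 1 M Plane}
    (hg : ∀ z (v w : Plane), D.gN.inner z v w = inner ℝ v w)
    {σ : ℝ} (hσ : σ = 1 ∨ σ = -1)
    (hΩ : ∀ z (v w : Plane), D.Ω z v w = σ * (v 0 * w 1 - v 1 * w 0))
    {μ : Measure M} (hμ : IsRiemannianVolume D.gM μ)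
    {p q : M → ℝ} (h : D.IsCocyclePair p q (fun z => z 1))
    {J : Set ℝ} (hJ : IsOpen J) (hJc : J.OrdConnected) {f : ℝ → Plane → ℝ}
    (hf : ContDiffOn ℝ ∞ (Function.uncurry f) (J ×ˢ univ))
    {c : ℝ → ℝ} (hc : DifferentiableOn ℝ c J) :
    SolvesEulerArnold D.θ D.gM μ p q J (fun t => (D.lift (f t), c t)) ↔
      ∃ β : ℝ, (∀ t ∈ J, c t = -β) ∧ ∀ t ∈ J, ∀ z : Plane,
        deriv (fun s => -D.α ^ 2 * f s z + planeLaplacian (f s) z) t +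
          σ * planeBracket (f t) (planeLaplacian (f t)) z - σ * β * partialX (f t) z = 0 := by
  have hf' : ContMDiffOn (𝓘(ℝ, ℝ).prod (𝓡 (2 * 1))) 𝓘(ℝ, ℝ) ∞ (Function.uncurry f)
      (J ×ˢ univ) := by
    rw [← modelWithCornersSelf_prod, chartedSpaceSelf_prod]
    exact hf.contMDiffOn
  rw [BoothbyWang.solvesEulerArnold_iff hμ h hJ hJc hf' hc]
  refine exists_congr fun β => and_congr_right fun _ => forall₃_congr fun t ht z => ?_
  have hft : ContDiff ℝ ∞ (f t) := (contMDiff_of_uncurry hJ hf' ht).contDiff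
  have hp : ∀ {u : Plane → ℝ} (v : Plane), ContDiff ℝ ∞ u →
      ContDiff ℝ ∞ (fun z => fderiv ℝ u z v) := fun v hu =>
    (hu.fderiv_right (m := ∞) (by simp)).clm_apply contDiff_const
  have hΔ : ContDiff ℝ ∞ (planeLaplacian (f t)) := (hp _ (hp _ hft)).add (hp _ (hp _ hft))
  have hv : ∀ s, D.vorticity β (fun z => z 1) (f s) =
      fun z => planeLaplacian (f s) z - D.α ^ 2 * f s z - β * z 1 := fun s =>
    funext fun z => by rw [BoothbyWang.vorticity, laplacian_plane hg]
  have h1 : deriv (fun s => D.vorticity β (fun z => z 1) (f s) z) t =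
      deriv (fun s => -D.α ^ 2 * f s z + planeLaplacian (f s) z) t := by
    have h2 : (fun s => D.vorticity β (fun z => z 1) (f s) z) =
        fun s => (-D.α ^ 2 * f s z + planeLaplacian (f s) z) - β * z 1 := by
      funext s
      rw [hv]
      ring
    rw [h2, deriv_sub_const]
  rw [h1, hv, poissonBracket_plane hσ hΩ, planeBracket_vorticity
    (hft.differentiable (by simp) z) (hΔ.differentiable (by simp) z)]
  ring_nf

end EulerArnold

end QuantExt

end

theorem proposition4p5 :
    -- The general statement.
    (∀ (n : ℕ) (M N : Type*)
      [TopologicalSpace M] [ChartedSpace (EuclideanSpace ℝ (Fin (2 * n + 1))) M]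
      [IsManifold (𝓡 (2 * n + 1)) ∞ M] [T2Space M] [SigmaCompactSpace M]
      [MeasurableSpace M] [BorelSpace M]
      [TopologicalSpace N] [ChartedSpace (EuclideanSpace ℝ (Fin (2 * n))) N]
      [IsManifold (𝓡 (2 * n)) ∞ N] [T2Space N] [SigmaCompactSpace N]
      (D : QuantExt.BoothbyWang n M N)
      (μ : Measure M) (_ : QuantExt.IsRiemannianVolume D.gM μ)
      (p q : M → ℝ) (ψ : N → ℝ) (_ : D.IsCocyclePair p q ψ),
      -- The elements of the Lie algebra are the fields `S(f ∘ π)`, for unique `f` on the quotient.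
      (∀ X : QuantExt.VField (2 * n + 1) M, QuantExt.IsQuantField D.θ X ↔
        ∃! f : N → ℝ, ContMDiff (𝓡 (2 * n)) 𝓘(ℝ, ℝ) ∞ f ∧ X = D.lift f) ∧
      -- The Euler-Arnold equation in terms of the stream function on the quotient.
      (∀ (J : Set ℝ) (_ : IsOpen J) (_ : J.OrdConnected)
        (f : ℝ → N → ℝ)
        (_ : ContMDiffOn (𝓘(ℝ, ℝ).prod (𝓡 (2 * n))) 𝓘(ℝ, ℝ) ∞ (Function.uncurry f)
          (J ×ˢ Set.univ))
        (c : ℝ → ℝ) (_ : DifferentiableOn ℝ c J),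
        QuantExt.SolvesEulerArnold D.θ D.gM μ p q J (fun t => (D.lift (f t), c t)) ↔
          ∃ β : ℝ, (∀ t ∈ J, c t = -β) ∧
            ∀ t ∈ J, ∀ y : N,
              deriv (fun s => D.vorticity β ψ (f s) y) t +
                QuantExt.poissonBracket D.Ω (f t) (D.vorticity β ψ (f t)) y = 0)) ∧
    -- The flat plane with `Ω = σ dx ∧ dy`, `σ = ± 1`, and `ψ = y`.
    (∀ (M : Type*)
      [TopologicalSpace M] [ChartedSpace (EuclideanSpace ℝ (Fin (2 * 1 + 1))) M]
      [IsManifold (𝓡 (2 * 1 + 1)) ∞ M] [T2Space M] [SigmaCompactSpace M]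
      [MeasurableSpace M] [BorelSpace M]
      (D : QuantExt.BoothbyWang 1 M QuantExt.Plane)
      (_ : ∀ z (v w : QuantExt.Plane), D.gN.inner z v w = inner ℝ v w)
      (σ : ℝ) (_ : σ = 1 ∨ σ = -1)
      (_ : ∀ z (v w : QuantExt.Plane), D.Ω z v w = σ * (v 0 * w 1 - v 1 * w 0))
      (μ : Measure M) (_ : QuantExt.IsRiemannianVolume D.gM μ)
      (p q : M → ℝ) (_ : D.IsCocyclePair p q (fun z => z 1))
      (J : Set ℝ) (_ : IsOpen J) (_ : J.OrdConnected)
      (f : ℝ → QuantExt.Plane → ℝ)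
      (_ : ContDiffOn ℝ ∞ (Function.uncurry f) (J ×ˢ Set.univ))
      (c : ℝ → ℝ) (_ : DifferentiableOn ℝ c J),
      QuantExt.SolvesEulerArnold D.θ D.gM μ p q J (fun t => (D.lift (f t), c t)) ↔
        ∃ β : ℝ, (∀ t ∈ J, c t = -β) ∧
          ∀ t ∈ J, ∀ z : QuantExt.Plane,
            deriv (fun s => -D.α ^ 2 * f s z + QuantExt.planeLaplacian (f s) z) t +
              σ * QuantExt.planeBracket (f t) (QuantExt.planeLaplacian (f t)) z -
              σ * β * QuantExt.partialX (f t) z = 0) := by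
  refine ⟨?_, ?_⟩
  · intro n M N _ _ _ _ _ _ _ _ _ _ _ _ D μ hμ p q ψ h
    exact ⟨fun X => D.isQuantField_iff X, fun J hJ hJc f hf c hc =>
      QuantExt.BoothbyWang.solvesEulerArnold_iff hμ h hJ hJc hf hc⟩
  · intro M _ _ _ _ _ _ _ D hg σ hσ hΩ μ hμ p q h J hJ hJc f hf c hc
    exact QuantExt.solvesEulerArnold_plane_iff hg hσ hΩ hμ h hJ hJc hf hc
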